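/- Let $\eta_0(x)=\sqrt{1-x^2}$ for $|x|\le 1$ and $\eta_0(x)=0$ otherwise. For $\mu>0$, call a *state* at $\mu$ a classical solution $u$ of $$-\frac{d}{dy}\Big[\eta_0(\mu y)^2\frac{du}{dy}\Big]+\tfrac14\,\eta_0(\mu y)^4\sin(4u)=0,\qquad -\tfrac1\mu<y<\tfrac1\mu,\qquad u(0)=\tfrac{\pi}{4},$$ of finite energy $\frac12\int_{-1/\mu}^{1/\mu}\big[\eta_0(\mu y)^2(u')^2+\frac14\eta_0(\mu y)^4\sin^2(2u)\big]dy<\infty$. States are considered as functions on $(-1/\mu,1/\mu)$, and a state is *nonconstant* if it is not identically $\frac{\pi}{4}$. Consider also the spectral problem $$-\frac{d}{dx}\Big[(1-x^2)\frac{dv}{dx}\Big]=\nu(1-x^2)^2v,\qquad 0<x<1,\qquad v(0)=0,$$ with eigenfunctions $v\not\equiv0$ that are continuous on $[0,1)$ and satisfy $\int_0^1(1-x^2)(v')^2dx<\infty$ and $\int_0^1(1-x^2)^2v^2dx<\infty$. Then it has a smallest eigenvalue $\nu_0$, $\nu_0>0$, and with $\mu_0:=\nu_0^{-1/2}$ the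 following holds. 1. For every $\mu>0$ the constant $u=\frac{\pi}{4}$ is a state. Nonconstant states exist only if $\mu<\mu_0$. 2. There is a constant $C>0$, independent of $\mu$, such that every nonconstant state $u$ at any $\mu\in(0,\mu_0)$ satisfies $\|u-\frac{\pi}{4}\|_{L^\infty(-1/\mu,1/\mu)}\le C\sqrt{\mu_0-\mu}$. 3. There is $r\in(0,\mu_0]$ such that for every $\mu\in(\mu_0-r,\mu_0)$ there are exactly two nonconstant states: one, $u$, with $u'(0)>0$, and the other, $\frac{\pi}{2}-u$. 4. (Normal form.) Let $v_0$ be any eigenfunction for $\nu_0$, and set $$\delta_2:=-\frac83\,\mu_0^2\,\frac{\int_0^1(1-x^2)^2v_0^4\,dx}{\int_0^1(1-x^2)^2v_0^2\,dx}.$$ Then $\delta_2<0$, and there are $a_0,C_0,r>0$, an even continuous function $\delta:(-a_0,a_0)\to\mathbb R$ with $\delta(0)=0$ and $\mu_0^2+\delta(a)>0$, and functions $w_a:[0,1)\to\mathbb R$ $(|a|<a_0)$, continuous in $a$ with respect to the supremum norm, with $w_{-a}=-w_a$ and $\int_0^1(1-x^2)^2v_0w_a\,dx=0$, such that for every $|a|<a_0$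 there is a state $u_a$ at $\mu=\sqrt{\mu_0^2+\delta(a)}$ with $$u_a(y)=\tfrac{\pi}{4}+a\,v_0(\mu y)+w_a(\mu y),\qquad 0\le y<\tfrac1\mu,$$ $$|\delta(a)-\delta_2a^2|\le C_0a^4,\qquad \sup_{[0,1)}|w_a|\le C_0|a|^3,$$ and, for $a\ne0$, $\delta(a)<0$ and $u_a'(0)\ne0$. Moreover, every nonconstant state at a parameter $\mu>0$ with $|\mu-\mu_0|<r$ equals $u_a$, with $\mu^2=\mu_0^2+\delta(a)$, for exactly one $a\in(-a_0,a_0)\setminus\{0\}$. -/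

import Mathlib

open Real Set Filter Topology MeasureTheory

noncomputable section

/-- The Thomas-Fermi profile `η₀(x) = (1 - x²)^{1/2}` for `|x| ≤ 1` and `η₀(x) = 0` for `|x| > 1`
(`Real.sqrt` vanishes on negative numbers). -/
def etaZero (x : ℝ) : ℝ := √(1 - x ^ 2)

/-- The interval `(-1/μ, 1/μ)`. -/
def stateInterval (μ : ℝ) : Set ℝ := Ioo (-(1 / μ)) (1 / μ)

/-- Twice the energy density of the reduced energy
`I_μ(u) = (1/2) ∫ [η₀(μy)² u'(y)² + (1/4) η₀(μy)⁴ sin²(2u(y))] dy`. -/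
def energyDensity (μ : ℝ) (u : ℝ → ℝ) (y : ℝ) : ℝ :=
  etaZero (μ * y) ^ 2 * deriv u y ^ 2 + 1 / 4 * etaZero (μ * y) ^ 4 * sin (2 * u y) ^ 2

/-- `u` is a classical solution of finite energy on `(-1/μ, 1/μ)` of the Euler-Lagrange equation
`-(η₀(μy)² u')' + (1/4) η₀(μy)⁴ sin(4u) = 0` with `u(0) = π/4`.
Only the values of `u` on `(-1/μ, 1/μ)` matter. -/
structure IsState (μ : ℝ) (u : ℝ → ℝ) : Prop where
  differentiable : ∀ y ∈ stateInterval μ, DifferentiableAt ℝ u y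
  differentiable_flux : ∀ y ∈ stateInterval μ,
    DifferentiableAt ℝ (fun z => etaZero (μ * z) ^ 2 * deriv u z) y
  euler_lagrange : ∀ y ∈ stateInterval μ,
    -deriv (fun z => etaZero (μ * z) ^ 2 * deriv u z) y
      + 1 / 4 * etaZero (μ * y) ^ 4 * sin (4 * u y) = 0
  finite_energy : IntegrableOn (energyDensity μ u) (stateInterval μ)
  center : u 0 = π / 4

/-- The state differs somewhere on its interval from the constant state `π/4`. -/
def IsNonconstant (μ : ℝ) (u : ℝ → ℝ) : Prop := ∃ y ∈ stateInterval μ, u y ≠ π / 4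

/-- `v` is an eigenfunction, for the eigenvalue `ν`, of
`-((1 - x²) v')' = ν (1 - x²)² v` on `0 < x < 1`, with `v(0) = 0` and with finite integrals
`∫₀¹ (1 - x²) v'²` and `∫₀¹ (1 - x²)² v²` (the boundary condition at the singular point `x = 1`). -/
structure IsEigenfunction (ν : ℝ) (v : ℝ → ℝ) : Prop where
  continuous : ContinuousOn v (Ico 0 1)
  dirichlet : v 0 = 0
  differentiable : ∀ x ∈ Ioo (0 : ℝ) 1, DifferentiableAt ℝ v x
  differentiable_flux : ∀ x ∈ Ioo (0 : ℝ) 1,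
    DifferentiableAt ℝ (fun z => (1 - z ^ 2) * deriv v z) x
  equation : ∀ x ∈ Ioo (0 : ℝ) 1,
    -deriv (fun z => (1 - z ^ 2) * deriv v z) x = ν * (1 - x ^ 2) ^ 2 * v x
  finite_gradient : IntegrableOn (fun x => (1 - x ^ 2) * deriv v x ^ 2) (Ioo 0 1)
  finite_weighted : IntegrableOn (fun x => (1 - x ^ 2) ^ 2 * v x ^ 2) (Ioo 0 1)
  nonzero : ∃ x ∈ Ioo (0 : ℝ) 1, v x ≠ 0

/-- The eigenvalues of the spectral problem above. -/
def eigenvalueSet : Set ℝ := {ν | ∃ v, IsEigenfunction ν v}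

/-- The normal-form coefficient
`δ₂ = -(8/3) μ₀² ∫₀¹ (1 - x²)² v₀⁴ dx / ∫₀¹ (1 - x²)² v₀² dx`. -/
def deltaTwo (μ₀ : ℝ) (v₀ : ℝ → ℝ) : ℝ :=
  -(8 / 3) * μ₀ ^ 2 * ((∫ x in (0 : ℝ)..1, (1 - x ^ 2) ^ 2 * v₀ x ^ 4)
    / ∫ x in (0 : ℝ)..1, (1 - x ^ 2) ^ 2 * v₀ x ^ 2)

/-- A branch of states with amplitude `a ∈ (-a₀, a₀)`, at the parameter `μ = (μ₀² + δ(a))^{1/2}`: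
`U a` is a state which, in the variable `x = μ y ∈ [0, 1)`, is `π/4 + a v₀(x) + w a x`, with
`w a` orthogonal to `v₀` for the weight `(1 - x²)²`. The branch depends continuously on `a`, is
symmetric under `a ↦ -a`, and is nonconstant for `a ≠ 0`. -/
structure IsBranch (μ₀ : ℝ) (v₀ : ℝ → ℝ) (a₀ : ℝ) (δ : ℝ → ℝ) (w U : ℝ → ℝ → ℝ) : Prop where
  delta_zero : δ 0 = 0
  delta_even : ∀ a ∈ Ioo (-a₀) a₀, δ (-a) = δ a
  delta_continuous : ContinuousOn δ (Ioo (-a₀) a₀)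
  pos : ∀ a ∈ Ioo (-a₀) a₀, 0 < μ₀ ^ 2 + δ a
  w_odd : ∀ a ∈ Ioo (-a₀) a₀, ∀ x ∈ Ico (0 : ℝ) 1, w (-a) x = -w a x
  w_continuous : ∀ a ∈ Ioo (-a₀) a₀,
    TendstoUniformlyOn w (w a) (𝓝[Ioo (-a₀) a₀] a) (Ico 0 1)
  orthogonal : ∀ a ∈ Ioo (-a₀) a₀, ∫ x in (0 : ℝ)..1, (1 - x ^ 2) ^ 2 * v₀ x * w a x = 0
  state : ∀ a ∈ Ioo (-a₀) a₀, IsState √(μ₀ ^ 2 + δ a) (U a)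
  decomposition : ∀ a ∈ Ioo (-a₀) a₀, ∀ y ∈ Ico 0 (1 / √(μ₀ ^ 2 + δ a)),
    U a y = π / 4 + (a * v₀ (√(μ₀ ^ 2 + δ a) * y) + w a (√(μ₀ ^ 2 + δ a) * y))
  nonconstant : ∀ a ∈ Ioo (-a₀) a₀, a ≠ 0 → deriv (U a) 0 ≠ 0

end

/-! With `x = μ y`, `k = 1/μ²` and `u = π/4 + W`, each half of a state solves `-((1 - x²) W')' = k
(1 - x²)² sin(4W)/4` on `(0, 1)` with `W(0) = 0`. A nonzero limit of the flux `(1 - x²) W'` at 1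
would make `(1 - x²) W'²` comparable to `1/(1 - x)`, which finite energy forbids. Hence the flux is
the integral of the right-hand side over `[x, 1]` (`exists_solves_of_finite_energy`), `W` extends to
1, and `W(1)` determines `W`. The singular problem becomes shooting from `x = 1` (`exists_solves`,
`Solves.eqOn_of_lipschitz`), and Green's identity has no boundary term at 1.

An energy that increases towards 1 gives `|W| ≤ |W(1)| < π/4` for half states
(`IsHalfState.abs_le`). For positive values in this range `sin(4W)/4` lies below `W` with a cubic
gap, and `sin(4W)/W` decreases. Green's identity against the principal eigenfunction, taken from the
last zero of `W`, then yields nonexistence for `k ≤ ν` (`IsHalfState.eq_zero_of_le`) and `W(1)² ≤ C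
(k - ν)` (`IsPrincipal.exists_amplitude_bound`). Just above `ν` it forces the last zero to be 0, so
half states have one sign (`IsPrincipal.exists_pos`). For each `k > ν` a positive half state exists
and is unique (`IsPrincipal.exists_halfState`, `IsHalfState.eqOn_of_pos`). The two halves of a state
share the slope at 0, and near the bifurcation its sign decides the sign of each half; so states
there are odd about `π/4`, and exactly two are nonconstant.

The normal form is a Lyapunov–Schmidt reduction done by a priori estimates instead of the implicit
function theorem. Testing with the eigenfunction gives one scalar equation (`IsMode.solvability`),
and the linearization has a bounded inverse on the complement (`IsMode.exists_inverse_bound`).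
Together with `k - ν = O(W(1)²)` this gives the cubic remainder, the expansion of `1/k`, and
Lipschitz dependence on the amplitude (`IsMode.exists_normal_form`, `IsMode.exists_lipschitz`). The
amplitude is thus an injective parameter; that every small value occurs follows from continuity in
`k` and the intermediate value theorem (`IsMode.exists_of_amplitude`). -/

/-! ### The singular equation in integral form, and Green's identity -/

/-- The flux `∫ₓ¹ (1 - t²)² g(t) dt` at `x` of the solution of `-((1 - x²) W')' = (1 - x²)² g`
that satisfies the natural boundary condition at the singular point `1`. -/
noncomputable def fluxInt (g : ℝ → ℝ) (x : ℝ) : ℝ := ∫ t in x..1, (1 - t ^ 2) ^ 2 * g t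

/-- `W` solves `-((1 - x²) W')' = (1 - x²)² g` on `(0, 1)` with vanishing flux at `1`. -/
structure Solves (W g : ℝ → ℝ) : Prop where
  cont : ContinuousOn W (Icc 0 1)
  cont_rhs : ContinuousOn g (Icc 0 1)
  hasDerivAt : ∀ x ∈ Ioo (0 : ℝ) 1, HasDerivAt W (fluxInt g x / (1 - x ^ 2)) x

theorem one_mem_unit : (1 : ℝ) ∈ Icc (0 : ℝ) 1 := ⟨zero_le_one, le_rfl⟩

theorem zero_mem_unit : (0 : ℝ) ∈ Icc (0 : ℝ) 1 := ⟨le_rfl, zero_le_one⟩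

theorem intervalIntegrable_unit {g : ℝ → ℝ} (h : ContinuousOn g (Icc 0 1)) {x y : ℝ}
    (hx : x ∈ Icc (0 : ℝ) 1) (hy : y ∈ Icc (0 : ℝ) 1) : IntervalIntegrable g volume x y :=
  (h.mono (uIcc_subset_Icc hx hy)).intervalIntegrable

theorem continuousOn_weight_mul {g : ℝ → ℝ} {s : Set ℝ} (h : ContinuousOn g s) :
    ContinuousOn (fun t => (1 - t ^ 2) ^ 2 * g t) s :=
  ContinuousOn.mul (by fun_prop) h

theorem one_sub_sq_pos {x : ℝ} (hx : x ∈ Ico (0 : ℝ) 1) : 0 < 1 - x ^ 2 := by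
  nlinarith [hx.1, hx.2]

theorem one_sub_sq_nonneg {x : ℝ} (hx : x ∈ Icc (0 : ℝ) 1) : 0 ≤ 1 - x ^ 2 := by
  nlinarith [hx.1, hx.2]

theorem fluxInt_one (g : ℝ → ℝ) : fluxInt g 1 = 0 := by simp [fluxInt]

theorem hasDerivAt_fluxInt {g : ℝ → ℝ} (h : ContinuousOn g (Icc 0 1)) {x : ℝ}
    (hx : x ∈ Ioo (0 : ℝ) 1) : HasDerivAt (fluxInt g) (-((1 - x ^ 2) ^ 2 * g x)) x := by
  have hc := continuousOn_weight_mul h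
  refine intervalIntegral.integral_hasDerivAt_left
    (intervalIntegrable_unit hc (Ioo_subset_Icc_self hx) one_mem_unit) ?_ ?_
  · exact (hc.mono Ioo_subset_Icc_self).stronglyMeasurableAtFilter isOpen_Ioo x hx
  · exact hc.continuousAt (Icc_mem_nhds hx.1 hx.2)

theorem continuousOn_fluxInt {g : ℝ → ℝ} (h : ContinuousOn g (Icc 0 1)) :
    ContinuousOn (fluxInt g) (Icc 0 1) := by
  have hc := continuousOn_weight_mul h
  have := intervalIntegral.continuousOn_primitive_interval_left (a := (0 : ℝ)) (b := 1)
    (μ := volume) (f := fun t => (1 - t ^ 2) ^ 2 * g t)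
    (by rw [uIcc_of_le zero_le_one]; exact hc.integrableOn_Icc)
  rwa [uIcc_of_le zero_le_one] at this

theorem fluxInt_add {g h : ℝ → ℝ} (hg : ContinuousOn g (Icc 0 1)) (hh : ContinuousOn h (Icc 0 1))
    {x : ℝ} (hx : x ∈ Icc (0 : ℝ) 1) :
    fluxInt (fun t => g t + h t) x = fluxInt g x + fluxInt h x := by
  unfold fluxInt
  rw [← intervalIntegral.integral_add
    (intervalIntegrable_unit (continuousOn_weight_mul hg) hx one_mem_unit)
    (intervalIntegrable_unit (continuousOn_weight_mul hh) hx one_mem_unit)]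
  congr 1; ext t; ring

theorem fluxInt_const_mul (g : ℝ → ℝ) (k x : ℝ) :
    fluxInt (fun t => k * g t) x = k * fluxInt g x := by
  unfold fluxInt
  rw [← intervalIntegral.integral_const_mul]
  congr 1; ext t; ring

theorem fluxInt_congr {g h : ℝ → ℝ} {x : ℝ} (hx : x ∈ Icc (0 : ℝ) 1)
    (H : ∀ t ∈ Icc (0 : ℝ) 1, g t = h t) : fluxInt g x = fluxInt h x := by
  unfold fluxInt
  refine intervalIntegral.integral_congr fun t ht => ?_
  rw [H t (uIcc_subset_Icc hx one_mem_unit ht)]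

theorem fluxInt_nonneg {g : ℝ → ℝ} {x : ℝ} (hx : x ≤ 1)
    (H : ∀ t ∈ Icc x 1, 0 ≤ g t) : 0 ≤ fluxInt g x :=
  intervalIntegral.integral_nonneg hx fun t ht => mul_nonneg (sq_nonneg _) (H t ht)

theorem fluxInt_pos {g : ℝ → ℝ} (h : ContinuousOn g (Icc 0 1)) {x : ℝ} (hx : x ∈ Ico (0 : ℝ) 1)
    (H : ∀ t ∈ Ioo x 1, 0 < g t) : 0 < fluxInt g x := by
  refine intervalIntegral.intervalIntegral_pos_of_pos_on
    (intervalIntegrable_unit (continuousOn_weight_mul h) (Ico_subset_Icc_self hx) one_mem_unit)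
    (fun t ht => mul_pos (pow_pos (one_sub_sq_pos ⟨hx.1.trans ht.1.le, ht.2⟩) 2) (H t ht)) hx.2

theorem fluxInt_split {g : ℝ → ℝ} (h : ContinuousOn g (Icc 0 1)) {x y : ℝ}
    (hx : x ∈ Icc (0 : ℝ) 1) (hy : y ∈ Icc (0 : ℝ) 1) :
    fluxInt g x = (∫ t in x..y, (1 - t ^ 2) ^ 2 * g t) + fluxInt g y :=
  (intervalIntegral.integral_add_adjacent_intervals
    (intervalIntegrable_unit (continuousOn_weight_mul h) hx hy)
    (intervalIntegrable_unit (continuousOn_weight_mul h) hy one_mem_unit)).symm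

/-- The weight decreases on `[x, 1]`, so it can be taken out at `x`. The flux therefore vanishes to
second order at 1, one order more than the division by `1 - x²` costs. -/
theorem abs_fluxInt_le {g : ℝ → ℝ} (h : ContinuousOn g (Icc 0 1)) {x : ℝ}
    (hx : x ∈ Icc (0 : ℝ) 1) : |fluxInt g x| ≤ (1 - x ^ 2) ^ 2 * ∫ t in x..1, |g t| := by
  rw [← intervalIntegral.integral_const_mul, ← Real.norm_eq_abs, fluxInt]
  refine intervalIntegral.norm_integral_le_of_norm_le hx.2 ?_
    ((intervalIntegrable_unit (continuousOn_const.mul h.abs) hx one_mem_unit))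
  refine Eventually.of_forall fun t ht => ?_
  rw [norm_mul, norm_of_nonneg (sq_nonneg _), Real.norm_eq_abs]
  have h0 : 0 ≤ 1 - t ^ 2 := one_sub_sq_nonneg ⟨hx.1.trans ht.1.le, ht.2⟩
  have : 1 - t ^ 2 ≤ 1 - x ^ 2 := by nlinarith [hx.1, ht.1]
  gcongr

theorem integral_le_of_le_unit {g : ℝ → ℝ} (h : ContinuousOn g (Icc 0 1)) {x G : ℝ}
    (hx : x ∈ Icc (0 : ℝ) 1) (H : ∀ t ∈ Icc (0 : ℝ) 1, g t ≤ G) :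
    ∫ t in x..1, g t ≤ G * (1 - x) := by
  have := intervalIntegral.integral_mono_on hx.2 (intervalIntegrable_unit h hx one_mem_unit)
    (intervalIntegrable_unit (continuousOn_const (c := G)) hx one_mem_unit)
    (fun t ht => H t ⟨hx.1.trans ht.1, ht.2⟩)
  rw [intervalIntegral.integral_const, smul_eq_mul] at this
  linarith

namespace Solves

variable {W W' g g' : ℝ → ℝ}

theorem add (h : Solves W g) (h' : Solves W' g') :
    Solves (fun x => W x + W' x) (fun x => g x + g' x) where
  cont := h.cont.add h'.cont
  cont_rhs := h.cont_rhs.add h'.cont_rhs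
  hasDerivAt x hx := by
    rw [fluxInt_add h.cont_rhs h'.cont_rhs (Ioo_subset_Icc_self hx), add_div]
    exact (h.hasDerivAt x hx).add (h'.hasDerivAt x hx)

theorem const_mul (h : Solves W g) (k : ℝ) :
    Solves (fun x => k * W x) (fun x => k * g x) where
  cont := continuousOn_const.mul h.cont
  cont_rhs := continuousOn_const.mul h.cont_rhs
  hasDerivAt x hx := by
    rw [fluxInt_const_mul, mul_div_assoc]
    exact (h.hasDerivAt x hx).const_mul k

theorem congr (h : Solves W g) (hW : ∀ x ∈ Icc (0 : ℝ) 1, W' x = W x)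
    (hg : ∀ x ∈ Icc (0 : ℝ) 1, g' x = g x) : Solves W' g' where
  cont := h.cont.congr hW
  cont_rhs := h.cont_rhs.congr hg
  hasDerivAt x hx := by
    rw [fluxInt_congr (Ioo_subset_Icc_self hx) hg]
    refine (h.hasDerivAt x hx).congr_of_eventuallyEq ?_
    filter_upwards [Ioo_mem_nhds hx.1 hx.2] with y hy using hW y (Ioo_subset_Icc_self hy)

theorem congr_rhs (h : Solves W g) (hg : ∀ x ∈ Icc (0 : ℝ) 1, g' x = g x) : Solves W g' :=
  h.congr (fun _ _ => rfl) hg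

theorem sub (h : Solves W g) (h' : Solves W' g') :
    Solves (fun x => W x - W' x) (fun x => g x - g' x) :=
  (h.add (h'.const_mul (-1))).congr (fun _ _ => by ring) (fun _ _ => by ring)

theorem const (c : ℝ) : Solves (fun _ => c) (fun _ => 0) where
  cont := continuousOn_const
  cont_rhs := continuousOn_const
  hasDerivAt x hx := by simpa [fluxInt] using hasDerivAt_const x c

/-- By the mean value theorem `W(x) - W(1)` is `1 - x` times a slope, and a slope at `s` is at most
`(1 - s²) ∫ₛ¹ |g|` by `abs_fluxInt_le`. The singular coefficient has disappeared, so Picard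
iteration and Gronwall work as for a regular equation. -/
theorem abs_sub_le (h : Solves W g) {x : ℝ} (hx : x ∈ Icc (0 : ℝ) 1) :
    |W x - W 1| ≤ ∫ t in x..1, |g t| := by
  rcases hx.2.eq_or_lt with rfl | hx1
  · simp
  obtain ⟨s, hs, hs'⟩ := exists_hasDerivAt_eq_slope W _ hx1 (h.cont.mono (Icc_subset_Icc_left hx.1))
    (fun s hs => h.hasDerivAt s ⟨hx.1.trans_lt hs.1, hs.2⟩)
  have hs0 : s ∈ Ioo (0 : ℝ) 1 := ⟨hx.1.trans_lt hs.1, hs.2⟩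
  have hpos := one_sub_sq_pos (Ioo_subset_Ico_self hs0)
  have hle := abs_fluxInt_le h.cont_rhs (Ioo_subset_Icc_self hs0)
  have hmono : ∫ t in s..1, |g t| ≤ ∫ t in x..1, |g t| := by
    refine intervalIntegral.integral_mono_interval hs.1.le hs.2.le le_rfl ?_
      (intervalIntegrable_unit h.cont_rhs.abs hx one_mem_unit)
    exact Eventually.of_forall fun t => abs_nonneg _
  have hI : 0 ≤ ∫ t in s..1, |g t| :=
    intervalIntegral.integral_nonneg hs.2.le fun _ _ => abs_nonneg _
  have h1 : |fluxInt g s / (1 - s ^ 2)| ≤ ∫ t in s..1, |g t| := by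
    rw [abs_div, abs_of_pos hpos, div_le_iff₀ hpos]
    refine hle.trans ?_
    have : (1 - s ^ 2) ^ 2 ≤ 1 - s ^ 2 := by nlinarith [sq_nonneg s]
    nlinarith
  rw [hs', abs_div, abs_of_pos (sub_pos.2 hx1), div_le_iff₀ (sub_pos.2 hx1)] at h1
  rw [abs_sub_comm]
  nlinarith [hx.1]

/-- Green's identity on `[x, 1]`. -/
theorem green (h : Solves W g) (h' : Solves W' g') {x : ℝ} (hx : x ∈ Icc (0 : ℝ) 1) :
    ∫ t in x..1, (1 - t ^ 2) ^ 2 * (g t * W' t - W t * g' t)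
      = fluxInt g x * W' x - W x * fluxInt g' x := by
  have hsub : Icc x 1 ⊆ Icc (0 : ℝ) 1 := Icc_subset_Icc_left hx.1
  have hc : ContinuousOn (fun t => W t * fluxInt g' t - fluxInt g t * W' t) (Icc 0 1) :=
    (h.cont.mul (continuousOn_fluxInt h'.cont_rhs)).sub
      ((continuousOn_fluxInt h.cont_rhs).mul h'.cont)
  have := intervalIntegral.integral_eq_sub_of_hasDerivAt_of_le hx.2 (hc.mono hsub)
    (f' := fun t => (1 - t ^ 2) ^ 2 * (g t * W' t - W t * g' t)) ?_
    (intervalIntegrable_unit (continuousOn_weight_mul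
      ((h.cont_rhs.mul h'.cont).sub (h.cont.mul h'.cont_rhs))) hx one_mem_unit)
  · rw [this]; simp [fluxInt_one]
  · intro t ht
    have ht0 : t ∈ Ioo (0 : ℝ) 1 := ⟨hx.1.trans_lt ht.1, ht.2⟩
    refine (((h.hasDerivAt t ht0).mul (hasDerivAt_fluxInt h'.cont_rhs ht0)).sub
      ((hasDerivAt_fluxInt h.cont_rhs ht0).mul (h'.hasDerivAt t ht0))).congr_deriv ?_
    ring

theorem strictMonoOn (h : Solves W g) {a b : ℝ} (ha : 0 ≤ a) (hb : b ≤ 1)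
    (H : ∀ x ∈ Ioo a b, 0 < fluxInt g x) : StrictMonoOn W (Icc a b) := by
  refine strictMonoOn_of_deriv_pos (convex_Icc a b) (h.cont.mono (Icc_subset_Icc ha hb)) ?_
  rw [interior_Icc]
  intro x hx
  have hx0 : x ∈ Ioo (0 : ℝ) 1 := ⟨ha.trans_lt hx.1, hx.2.trans_le hb⟩
  rw [(h.hasDerivAt x hx0).deriv]
  exact div_pos (H x hx) (one_sub_sq_pos (Ioo_subset_Ico_self hx0))

theorem monotoneOn (h : Solves W g) {a b : ℝ} (ha : 0 ≤ a) (hb : b ≤ 1)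
    (H : ∀ x ∈ Ioo a b, 0 ≤ fluxInt g x) : MonotoneOn W (Icc a b) := by
  refine monotoneOn_of_deriv_nonneg (convex_Icc a b) (h.cont.mono (Icc_subset_Icc ha hb)) ?_ ?_
  · rw [interior_Icc]
    exact fun x hx => (h.hasDerivAt x ⟨ha.trans_lt hx.1, hx.2.trans_le
      hb⟩).differentiableAt.differentiableWithinAt
  rw [interior_Icc]
  intro x hx
  have hx0 : x ∈ Ioo (0 : ℝ) 1 := ⟨ha.trans_lt hx.1, hx.2.trans_le hb⟩
  rw [(h.hasDerivAt x hx0).deriv]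
  exact div_nonneg (H x hx) (one_sub_sq_pos (Ioo_subset_Ico_self hx0)).le

end Solves

/-! ### Gronwall and shooting from the singular endpoint -/

/-- A Gronwall inequality on `[0, 1]`, backwards from `1`. -/
theorem gronwall_unit {φ : ℝ → ℝ} (hφ : ContinuousOn φ (Icc 0 1)) {A M : ℝ} (hA : 0 ≤ A)
    (hM : 0 < M) (H : ∀ x ∈ Icc (0 : ℝ) 1, φ x ≤ A + M * ∫ t in x..1, φ t) :
    ∀ x ∈ Icc (0 : ℝ) 1, φ x ≤ 2 * A * exp (2 * M) := by
  -- The maximum is that of `φ` weighted by `exp(-2M(1 - x))`. With the rate `2M` the integral term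
  -- returns at most half of a positive maximum, which leaves `2A`.
  obtain ⟨m, hm, hmax⟩ := isCompact_Icc.exists_isMaxOn (nonempty_Icc.2 zero_le_one)
    (ContinuousOn.mul hφ (f := φ) (g := fun x => exp (-(2 * M * (1 - x)))) (s := Icc (0 : ℝ) 1)
      (by fun_prop))
  set S := φ m * exp (-(2 * M * (1 - m))) with hS
  have hle : ∀ t ∈ Icc (0 : ℝ) 1, φ t ≤ S * exp (2 * M * (1 - t)) := by
    intro t ht
    have h1 : φ t * exp (-(2 * M * (1 - t))) ≤ S := hmax ht
    have h2 : exp (-(2 * M * (1 - t))) * exp (2 * M * (1 - t)) = 1 := by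
      rw [← exp_add]; simp
    calc φ t = (φ t * exp (-(2 * M * (1 - t)))) * exp (2 * M * (1 - t)) := by
          rw [mul_assoc, h2, mul_one]
      _ ≤ _ := by gcongr
  have hint : ∫ t in m..1, φ t ≤ S * ((exp (2 * M * (1 - m)) - 1) / (2 * M)) := by
    have hprim : ∫ t in m..1, exp (2 * M * (1 - t)) = (exp (2 * M * (1 - m)) - 1) / (2 * M) := by
      rw [intervalIntegral.integral_eq_sub_of_hasDerivAt
        (f := fun t => -(exp (2 * M * (1 - t)) / (2 * M)))]
      · simp; ring
      · intro t _
        have : HasDerivAt (fun t : ℝ => 2 * M * (1 - t)) (2 * M * (-1)) t := by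
          simpa using ((hasDerivAt_id t).const_sub 1).const_mul (2 * M)
        refine (this.exp.div_const (2 * M)).neg.congr_deriv ?_
        field_simp
      · exact (by fun_prop : Continuous fun t => exp (2 * M * (1 - t))).intervalIntegrable _ _
    rw [← hprim, ← intervalIntegral.integral_const_mul]
    exact intervalIntegral.integral_mono_on hm.2 (intervalIntegrable_unit hφ hm one_mem_unit)
      (intervalIntegrable_unit (by fun_prop) hm one_mem_unit)
      (fun t ht => hle t ⟨hm.1.trans ht.1, ht.2⟩)
  have hS2 : S ≤ 2 * A := by
    by_contra hcon
    push Not at hcon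
    have hS0 : 0 < S := by linarith
    have h1 := H m hm
    have h2 : φ m = S * exp (2 * M * (1 - m)) := by
      rw [hS, mul_assoc, ← exp_add]; simp
    have h3 : 1 ≤ exp (2 * M * (1 - m)) :=
      one_le_exp (mul_nonneg (by linarith) (by linarith [hm.2]))
    have h4 : M * (S * ((exp (2 * M * (1 - m)) - 1) / (2 * M)))
        = S * (exp (2 * M * (1 - m)) - 1) / 2 := by field_simp
    have h5 := mul_le_mul_of_nonneg_left hint hM.le
    nlinarith
  intro x hx
  have h1 : exp (2 * M * (1 - x)) ≤ exp (2 * M) := by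
    apply exp_le_exp.2; nlinarith [hx.1]
  calc φ x ≤ S * exp (2 * M * (1 - x)) := hle x hx
    _ ≤ 2 * A * exp (2 * M * (1 - x)) := by gcongr
    _ ≤ _ := by gcongr

/-- At 1 the quotient is `0 / 0 = 0`, and this is also its limit by `abs_fluxInt_le`. -/
theorem continuousOn_fluxInt_div {g : ℝ → ℝ} (h : ContinuousOn g (Icc 0 1)) :
    ContinuousOn (fun s => fluxInt g s / (1 - s ^ 2)) (Icc 0 1) := by
  intro x hx
  rcases hx.2.eq_or_lt with rfl | hx1
  · have h0 : Tendsto (fun s : ℝ => (1 - s ^ 2) * ∫ t in (0 : ℝ)..1, |g t|)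
        (𝓝[Icc 0 1] 1) (𝓝 0) := by
      have : Continuous fun s : ℝ => (1 - s ^ 2) * ∫ t in (0 : ℝ)..1, |g t| := by fun_prop
      simpa using (this.tendsto 1).mono_left nhdsWithin_le_nhds
    have : Tendsto (fun s => fluxInt g s / (1 - s ^ 2)) (𝓝[Icc 0 1] 1) (𝓝 0) := by
      refine squeeze_zero_norm' ?_ h0
      filter_upwards [self_mem_nhdsWithin] with s hs
      have hI : 0 ≤ ∫ t in (0 : ℝ)..1, |g t| :=
        intervalIntegral.integral_nonneg zero_le_one fun _ _ => abs_nonneg _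
      have hp := one_sub_sq_nonneg hs
      rcases hp.eq_or_lt with h1 | h1
      · simp [← h1]
      have hle := abs_fluxInt_le h hs
      have hmono : ∫ t in s..1, |g t| ≤ ∫ t in (0 : ℝ)..1, |g t| := by
        refine intervalIntegral.integral_mono_interval hs.1 hs.2 le_rfl ?_
          (intervalIntegrable_unit h.abs zero_mem_unit one_mem_unit)
        exact Eventually.of_forall fun t => abs_nonneg _
      rw [norm_div, norm_of_nonneg hp, Real.norm_eq_abs, div_le_iff₀ h1]
      calc |fluxInt g s| ≤ (1 - s ^ 2) ^ 2 * ∫ t in s..1, |g t| := hle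
        _ ≤ (1 - s ^ 2) ^ 2 * ∫ t in (0 : ℝ)..1, |g t| := by gcongr
        _ = _ := by ring
    unfold ContinuousWithinAt
    simpa [fluxInt_one] using this
  · exact (continuousOn_fluxInt h x hx).div (by fun_prop) (one_sub_sq_pos ⟨hx.1, hx1⟩).ne'

/-- The solution of `-((1 - x²) W')' = (1 - x²)² g` with `W(1) = c` and vanishing flux at `1`. -/
noncomputable def endpointSolution (g : ℝ → ℝ) (c x : ℝ) : ℝ :=
  c - ∫ s in x..1, fluxInt g s / (1 - s ^ 2)

theorem endpointSolution_one (g : ℝ → ℝ) (c : ℝ) : endpointSolution g c 1 = c := by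
  simp [endpointSolution]

theorem solves_endpointSolution {g : ℝ → ℝ} (h : ContinuousOn g (Icc 0 1)) (c : ℝ) :
    Solves (endpointSolution g c) g where
  cont := by
    have := intervalIntegral.continuousOn_primitive_interval_left (a := (0 : ℝ)) (b := 1)
      (μ := volume) (f := fun s => fluxInt g s / (1 - s ^ 2))
      (by rw [uIcc_of_le zero_le_one]; exact (continuousOn_fluxInt_div h).integrableOn_Icc)
    rw [uIcc_of_le zero_le_one] at this
    exact continuousOn_const.sub this
  cont_rhs := h
  hasDerivAt x hx := by
    have hc := continuousOn_fluxInt_div h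
    have := intervalIntegral.integral_hasDerivAt_left
      (intervalIntegrable_unit hc (Ioo_subset_Icc_self hx) one_mem_unit)
      ((hc.mono Ioo_subset_Icc_self).stronglyMeasurableAtFilter isOpen_Ioo x hx)
      (hc.continuousAt (Icc_mem_nhds hx.1 hx.2))
    exact (this.const_sub c).congr_deriv (neg_neg _)

theorem integral_one_sub_pow (n : ℕ) (x : ℝ) :
    ∫ t in x..1, (1 - t) ^ n = (1 - x) ^ (n + 1) / (n + 1) := by
  rw [intervalIntegral.integral_comp_sub_left (fun t => t ^ n) 1]
  simp [integral_pow]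

/-- Shooting from the singular endpoint: for Lipschitz `f` there is a solution of
`-((1 - x²) W')' = k (1 - x²)² f(W)` on `(0, 1)` with `W(1) = c`. -/
theorem exists_solves {f : ℝ → ℝ} (hf : ∀ a b, |f a - f b| ≤ |a - b|) (k c : ℝ) :
    ∃ W : ℝ → ℝ, Solves W (fun x => k * f (W x)) ∧ W 1 = c := by
  have hfc : Continuous f := (LipschitzWith.of_dist_le_mul (K := 1) fun a b => by
    simpa [Real.dist_eq] using hf a b).continuous
  let ext : C(Icc (0 : ℝ) 1, ℝ) → ℝ → ℝ := fun Z => IccExtend zero_le_one Z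
  have hext : ∀ Z, Continuous (ext Z) := fun Z => Z.continuous.Icc_extend'
  have hext_eq : ∀ Z (x : Icc (0 : ℝ) 1), ext Z x = Z x := fun Z x => IccExtend_val _ _ _
  have hcont : ∀ Z, ContinuousOn (fun x => k * f (ext Z x)) (Icc 0 1) := fun Z =>
    (continuous_const.mul (hfc.comp (hext Z))).continuousOn
  let Φ : C(Icc (0 : ℝ) 1, ℝ) → C(Icc (0 : ℝ) 1, ℝ) := fun Z =>
    ⟨fun x => endpointSolution (fun x => k * f (ext Z x)) c x,
      (solves_endpointSolution (hcont Z) c).cont.domRestrict⟩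
  have hstep : ∀ Y Z (x : Icc (0 : ℝ) 1),
      |Φ Y x - Φ Z x| ≤ |k| * ∫ t in (x : ℝ)..1, |ext Y t - ext Z t| := by
    intro Y Z x
    have h := ((solves_endpointSolution (hcont Y) c).sub
      (solves_endpointSolution (hcont Z) c)).abs_sub_le x.2
    simp only [endpointSolution_one, sub_self, sub_zero] at h
    refine h.trans ?_
    rw [← intervalIntegral.integral_const_mul]
    refine intervalIntegral.integral_mono_on x.2.2
      (intervalIntegrable_unit ((hcont Y).sub (hcont Z)).abs x.2 one_mem_unit)
      (Continuous.intervalIntegrable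
        (continuous_const.mul ((hext Y).sub (hext Z)).abs) _ _) fun t _ => ?_
    rw [← mul_sub, abs_mul]
    exact mul_le_mul_of_nonneg_left (hf _ _) (abs_nonneg _)
  have hiter : ∀ (n : ℕ) Y Z (x : Icc (0 : ℝ) 1),
      |Φ^[n] Y x - Φ^[n] Z x| ≤ dist Y Z * (|k| ^ n * (1 - (x : ℝ)) ^ n / n.factorial) := by
    intro n Y Z
    induction n with
    | zero =>
      intro x
      simpa [Real.dist_eq] using ContinuousMap.dist_apply_le_dist (f := Y) (g := Z) x
    | succ n ih =>
      intro x
      rw [Function.iterate_succ_apply', Function.iterate_succ_apply']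
      refine (hstep _ _ x).trans ?_
      have hI : ∫ t in (x : ℝ)..1, |ext (Φ^[n] Y) t - ext (Φ^[n] Z) t|
          ≤ ∫ t in (x : ℝ)..1, dist Y Z * (|k| ^ n / n.factorial) * (1 - t) ^ n := by
        refine intervalIntegral.integral_mono_on x.2.2
          (((hext _).sub (hext _)).abs.intervalIntegrable _ _)
          (Continuous.intervalIntegrable (by fun_prop) _ _) fun t ht => ?_
        have ht0 : t ∈ Icc (0 : ℝ) 1 := ⟨x.2.1.trans ht.1, ht.2⟩
        have := ih ⟨t, ht0⟩
        rw [hext_eq _ ⟨t, ht0⟩, hext_eq _ ⟨t, ht0⟩]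
        refine this.trans_eq ?_
        ring
      rw [intervalIntegral.integral_const_mul, integral_one_sub_pow] at hI
      refine (mul_le_mul_of_nonneg_left hI (abs_nonneg k)).trans_eq ?_
      rw [Nat.factorial_succ]
      push_cast
      field_simp
      ring
  -- The Picard operator need not be a contraction, but its `n`-th iterate has factor at most
  -- `|k|ⁿ/n!`. The fixed point of the contracting iterate is also fixed by `Φ`.
  obtain ⟨n, hn⟩ := ((FloorSemiring.tendsto_pow_div_factorial_atTop |k|).eventually
    (gt_mem_nhds (show (0 : ℝ) < 1 / 2 by norm_num))).exists
  have hcontr : ContractingWith (1 / 2) (Φ^[n]) := by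
    refine ⟨by rw [← NNReal.coe_lt_coe]; norm_num, LipschitzWith.of_dist_le_mul fun Y Z => ?_⟩
    rw [ContinuousMap.dist_le (by positivity)]
    intro x
    rw [Real.dist_eq]
    refine (hiter n Y Z x).trans ?_
    have h1 : (1 - (x : ℝ)) ^ n ≤ 1 := pow_le_one₀ (by linarith [x.2.2]) (by linarith [x.2.1])
    have h2 : |k| ^ n * (1 - (x : ℝ)) ^ n / n.factorial ≤ 1 / 2 := by
      refine le_trans ?_ hn.le
      gcongr
      exact mul_le_of_le_one_right (by positivity) h1
    have : ((1 / 2 : NNReal) : ℝ) = 1 / 2 := by norm_num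
    rw [this, mul_comm]
    exact mul_le_mul_of_nonneg_right h2 dist_nonneg
  have hfix := hcontr.isFixedPt_fixedPoint_iterate
  set Z := ContractingWith.fixedPoint (Φ^[n]) hcontr with hZ
  refine ⟨endpointSolution (fun x => k * f (ext Z x)) c,
    (solves_endpointSolution (hcont Z) c).congr_rhs fun x hx => ?_, endpointSolution_one _ _⟩
  have h1 : Φ Z ⟨x, hx⟩ = Z ⟨x, hx⟩ := by rw [hfix]
  have h2 : ext Z x = Z ⟨x, hx⟩ := hext_eq Z ⟨x, hx⟩
  have h3 : Φ Z ⟨x, hx⟩ = endpointSolution (fun x => k * f (ext Z x)) c x := rfl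
  simp only [← h3, h1, h2]

/-- Continuous dependence of shooting solutions on the endpoint value and on the parameter. -/
theorem Solves.abs_sub_le_of_lipschitz {f : ℝ → ℝ} (hf : ∀ a b, |f a - f b| ≤ |a - b|)
    {W₁ W₂ : ℝ → ℝ} {k₁ k₂ B : ℝ} (h₁ : Solves W₁ (fun x => k₁ * f (W₁ x)))
    (h₂ : Solves W₂ (fun x => k₂ * f (W₂ x))) (hB : ∀ x ∈ Icc (0 : ℝ) 1, |f (W₁ x)| ≤ B) :
    ∀ x ∈ Icc (0 : ℝ) 1,
      |W₁ x - W₂ x| ≤ 2 * (|W₁ 1 - W₂ 1| + |k₁ - k₂| * B) * exp (2 * (|k₂| + 1)) := by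
  have hB0 : 0 ≤ B := (abs_nonneg _).trans (hB 0 zero_mem_unit)
  have hD := h₁.sub h₂
  -- The rate is `|k₂| + 1` and not `|k₂|` because `gronwall_unit` needs it positive.
  refine gronwall_unit hD.cont.abs (by positivity) (by positivity) fun x hx => ?_
  have h1 := hD.abs_sub_le hx
  have h2 : ∫ t in x..1, |k₁ * f (W₁ t) - k₂ * f (W₂ t)|
      ≤ ∫ t in x..1, (|k₁ - k₂| * B + (|k₂| + 1) * |W₁ t - W₂ t|) := by
    refine intervalIntegral.integral_mono_on hx.2
      (intervalIntegrable_unit hD.cont_rhs.abs hx one_mem_unit)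
      (intervalIntegrable_unit (continuousOn_const.add (continuousOn_const.mul hD.cont.abs))
        hx one_mem_unit) fun t ht => ?_
    have ht0 : t ∈ Icc (0 : ℝ) 1 := ⟨hx.1.trans ht.1, ht.2⟩
    have e : k₁ * f (W₁ t) - k₂ * f (W₂ t)
        = (k₁ - k₂) * f (W₁ t) + k₂ * (f (W₁ t) - f (W₂ t)) := by ring
    rw [e]
    refine (abs_add_le _ _).trans ?_
    rw [abs_mul, abs_mul]
    have := hB t ht0
    have := hf (W₁ t) (W₂ t)
    gcongr
    linarith
  rw [intervalIntegral.integral_add (intervalIntegrable_unit continuousOn_const hx one_mem_unit)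
    ((intervalIntegrable_unit hD.cont.abs hx one_mem_unit).const_mul _),
    intervalIntegral.integral_const, intervalIntegral.integral_const_mul, smul_eq_mul] at h2
  have h3 : |W₁ x - W₂ x| ≤ |W₁ x - W₂ x - (W₁ 1 - W₂ 1)| + |W₁ 1 - W₂ 1| := by
    have := abs_add_le (W₁ x - W₂ x - (W₁ 1 - W₂ 1)) (W₁ 1 - W₂ 1)
    simpa using this
  have h4 : (1 - x) * (|k₁ - k₂| * B) ≤ |k₁ - k₂| * B :=
    mul_le_of_le_one_left (by positivity) (by linarith [hx.1])
  linarith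

/-- The flux vanishes at 1, so `W(1)` is the only free constant there. The Lipschitz constant 1
covers both the linear problem (`f = id`) and `sinFour`. -/
theorem Solves.eqOn_of_lipschitz {f : ℝ → ℝ} (hf : ∀ a b, |f a - f b| ≤ |a - b|)
    {W₁ W₂ : ℝ → ℝ} {k : ℝ} (h₁ : Solves W₁ (fun x => k * f (W₁ x)))
    (h₂ : Solves W₂ (fun x => k * f (W₂ x))) (h : W₁ 1 = W₂ 1) : EqOn W₁ W₂ (Icc 0 1) := by
  obtain ⟨B, hB⟩ := isCompact_Icc.exists_bound_of_continuousOn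
    (Continuous.comp_continuousOn (g := f) (LipschitzWith.of_dist_le_mul (K := 1) fun a b => by
      simpa [Real.dist_eq] using hf a b).continuous h₁.cont)
  intro x hx
  have := h₁.abs_sub_le_of_lipschitz hf h₂ hB x hx
  simp only [h, sub_self, abs_zero, zero_mul, add_zero, mul_zero] at this
  exact sub_eq_zero.1 (abs_nonpos_iff.1 this)

/-! ### Last zeros and first contacts -/

/-- Sign changes inside `(0, 1)` cannot be excluded beforehand. Starting the comparison arguments at
the last zero gives a definite sign on the rest of the interval and removes one boundary term from
Green's identity. -/
theorem exists_last_zero {D : ℝ → ℝ} (hD : ContinuousOn D (Icc 0 1)) (h0 : D 0 = 0)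
    (h1 : 0 < D 1) : ∃ x ∈ Ico (0 : ℝ) 1, D x = 0 ∧ ∀ y ∈ Ioc x 1, 0 < D y := by
  obtain ⟨x, ⟨hx, hx0⟩, hmax⟩ := (isCompact_Icc.of_isClosed_subset
    (hD.preimage_isClosed_of_isClosed isClosed_Icc (isClosed_singleton (x := (0 : ℝ))))
    inter_subset_left).exists_isGreatest ⟨0, zero_mem_unit, h0⟩
  have hx0 : D x = 0 := hx0
  refine ⟨x, ⟨hx.1, hx.2.lt_of_ne fun h => by rw [h] at hx0; exact h1.ne' hx0⟩, hx0,
    fun y hy => ?_⟩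
  by_contra hcon
  push Not at hcon
  have hy0 : y ∈ Icc (0 : ℝ) 1 := ⟨hx.1.trans hy.1.le, hy.2⟩
  obtain ⟨z, hz, hz0⟩ := intermediate_value_Icc hy.2 (hD.mono (Icc_subset_Icc_left hy0.1))
    (show (0 : ℝ) ∈ Icc (D y) (D 1) from ⟨hcon, h1.le⟩)
  exact absurd (hmax ⟨⟨hy0.1.trans hz.1, hz.2⟩, hz0⟩) (not_le.2 (hy.1.trans_le hz.1))

/-- In a continuous family that starts positive on `[0, 1]` and does not stay so, there is a first
member that touches zero. -/
theorem exists_first_touching {H : ℝ → ℝ → ℝ} {T : ℝ} (hT : 0 ≤ T)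
    (hH : ContinuousOn (Function.uncurry H) (Icc 0 T ×ˢ Icc 0 1))
    (h0 : ∀ x ∈ Icc (0 : ℝ) 1, 0 < H 0 x) (hneg : ∃ x ∈ Icc (0 : ℝ) 1, H T x ≤ 0) :
    ∃ τ ∈ Ioc 0 T, (∀ x ∈ Icc (0 : ℝ) 1, 0 ≤ H τ x) ∧ (∃ x ∈ Icc (0 : ℝ) 1, H τ x = 0) ∧
      ∀ s ∈ Ico 0 τ, ∀ x ∈ Icc (0 : ℝ) 1, 0 < H s x := by
  obtain ⟨xT, hxT, hxT0⟩ := hneg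
  -- The times at which some value is `≤ 0` are the projection of a compact set, so there is a first
  -- one.
  have hK : IsCompact (Prod.fst '' ((Icc 0 T ×ˢ Icc (0 : ℝ) 1) ∩
      Function.uncurry H ⁻¹' Iic 0)) := by
    refine IsCompact.image (IsCompact.of_isClosed_subset (isCompact_Icc.prod isCompact_Icc)
      (hH.preimage_isClosed_of_isClosed (isClosed_Icc.prod isClosed_Icc) isClosed_Iic)
      inter_subset_left) continuous_fst
  obtain ⟨τ, ⟨⟨τ', x₀⟩, ⟨⟨hτ, hx₀⟩, hx₀'⟩, rfl⟩, hmin⟩ := hK.exists_isLeast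
    ⟨T, ⟨T, xT⟩, ⟨⟨⟨hT, le_rfl⟩, hxT⟩, hxT0⟩, rfl⟩
  have hx₀' : H τ' x₀ ≤ 0 := hx₀'
  simp only at hτ hx₀ hmin
  have hbefore : ∀ s ∈ Ico 0 τ', ∀ x ∈ Icc (0 : ℝ) 1, 0 < H s x := by
    intro s hs x hx
    by_contra hcon
    push Not at hcon
    exact absurd (hmin ⟨⟨s, x⟩, ⟨⟨⟨hs.1, hs.2.le.trans hτ.2⟩, hx⟩, hcon⟩, rfl⟩) (not_le.2 hs.2)
  have hτ0 : 0 < τ' := by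
    refine hτ.1.lt_of_ne fun h => ?_
    subst h
    exact absurd (h0 x₀ hx₀) (not_lt.2 hx₀')
  have hnonneg : ∀ x ∈ Icc (0 : ℝ) 1, 0 ≤ H τ' x := by
    intro x hx
    have hc : ContinuousOn (fun s => H s x) (Icc 0 T) :=
      hH.comp (f := fun s => (s, x)) (by fun_prop) fun s hs => ⟨hs, hx⟩
    have ht : Tendsto (fun s => H s x) (𝓝[Ico 0 τ'] τ') (𝓝 (H τ' x)) :=
      (hc τ' hτ).mono fun s hs => ⟨hs.1, hs.2.le.trans hτ.2⟩
    have : (𝓝[Ico 0 τ'] τ').NeBot := by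
      rw [← mem_closure_iff_nhdsWithin_neBot, closure_Ico hτ0.ne]
      exact ⟨hτ0.le, le_rfl⟩
    refine ge_of_tendsto ht ?_
    filter_upwards [self_mem_nhdsWithin] with s hs using (hbefore s hs x hx).le
  exact ⟨τ', ⟨hτ0, hτ.2⟩, hnonneg, ⟨x₀, hx₀, le_antisymm hx₀' (hnonneg x₀ hx₀)⟩, hbefore⟩

/-- A nonnegative supersolution can only vanish at `0`. -/
theorem Solves.eq_zero_of_nonneg {W g : ℝ → ℝ} (h : Solves W g)
    (hW : ∀ x ∈ Icc (0 : ℝ) 1, 0 ≤ W x) (hW1 : 0 < W 1)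
    (hg : ∀ x ∈ Icc (0 : ℝ) 1, 0 ≤ g x) (hg1 : 0 < g 1) {x : ℝ} (hx : x ∈ Icc (0 : ℝ) 1)
    (hx0 : W x = 0) : x = 0 := by
  by_contra hne
  have hxI : x ∈ Ioo (0 : ℝ) 1 :=
    ⟨hx.1.lt_of_ne (Ne.symm hne), hx.2.lt_of_ne fun h => by subst h; exact hW1.ne' hx0⟩
  -- An interior zero would be a minimum, hence a zero of the flux; but the flux there is the
  -- integral of a nonnegative function that is positive near 1.
  have hmin : IsLocalMin W x := by
    filter_upwards [Icc_mem_nhds hxI.1 hxI.2] with y hy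
    rw [hx0]; exact hW y hy
  have hd := hmin.hasDerivAt_eq_zero (h.hasDerivAt x hxI)
  have hpos : 0 < fluxInt g x := by
    unfold fluxInt
    have hcx := continuousOn_weight_mul h.cont_rhs
    obtain ⟨ε, hε, hball⟩ : ∃ y ∈ Ioo x 1, 0 < g y := by
      have h1 : ∀ᶠ y in 𝓝[Icc 0 1] (1 : ℝ), 0 < g y :=
        (h.cont_rhs 1 one_mem_unit).eventually (lt_mem_nhds hg1)
      have h2 : ∀ᶠ y in 𝓝[Ioo x 1] (1 : ℝ), 0 < g y :=
        h1.filter_mono (nhdsWithin_mono _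
          (Ioo_subset_Icc_self.trans (Icc_subset_Icc_left hxI.1.le)))
      have : (𝓝[Ioo x 1] (1 : ℝ)).NeBot := by
        rw [← mem_closure_iff_nhdsWithin_neBot, closure_Ioo hxI.2.ne]
        exact ⟨hxI.2.le, le_rfl⟩
      obtain ⟨y, hy, hyI⟩ := (h2.and self_mem_nhdsWithin).exists
      exact ⟨y, hyI, hy⟩
    have hεp : 0 < (1 - ε ^ 2) ^ 2 * g ε :=
      mul_pos (pow_pos (one_sub_sq_pos ⟨hxI.1.le.trans hε.1.le, hε.2⟩) 2) hball
    have := intervalIntegral.integral_lt_integral_of_continuousOn_of_le_of_exists_lt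
      (f := fun _ => (0 : ℝ)) (g := fun t => (1 - t ^ 2) ^ 2 * g t) hxI.2 continuousOn_const
      (hcx.mono (Icc_subset_Icc_left hxI.1.le))
      (fun t ht => mul_nonneg (sq_nonneg _) (hg t ⟨hxI.1.le.trans ht.1.le, ht.2⟩))
      ⟨ε, Ioo_subset_Icc_self hε, hεp⟩
    simpa using this
  exact (div_pos hpos (one_sub_sq_pos (Ioo_subset_Ico_self hxI))).ne' hd

/-! ### The principal eigenpair -/

/-- The principal eigenpair of the spectral problem, normalized at the singular endpoint. -/
structure IsPrincipal (ν : ℝ) (V : ℝ → ℝ) : Prop where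
  pos : 0 < ν
  solves : Solves V (fun x => ν * V x)
  zero : V 0 = 0
  one : V 1 = 1
  pos_of_pos : ∀ x ∈ Ioc (0 : ℝ) 1, 0 < V x

/-- Comparison with `φ(t) = t (1 - t²)`, which vanishes at 0 and 1 and satisfies `((1 - t²) φ')' +
216 (1 - t²)² φ ≥ 0`; with `s = 1 - t²` the left side is `t (4 - 12 s + 216 s³)`. For positive `V`,
Green's identity would equate a nonnegative integral with `-V(0) φ'(0) < 0`. The value 216 only has
to be large enough. -/
theorem not_pos_of_large {V : ℝ → ℝ} (hV : Solves V (fun x => 216 * V x)) :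
    ∃ x ∈ Icc (0 : ℝ) 1, V x ≤ 0 := by
  by_contra hcon
  push Not at hcon
  have hc : ContinuousOn (fun t => V t * ((1 - t ^ 2) * (1 - 3 * t ^ 2))
      - t * (1 - t ^ 2) * fluxInt (fun x => 216 * V x) t) (Icc 0 1) :=
    (hV.cont.mul (by fun_prop)).sub
      (ContinuousOn.mul (by fun_prop) (continuousOn_fluxInt hV.cont_rhs))
  have hint : ContinuousOn (fun t => V t * (4 * t * (3 * t ^ 2 - 2)
      + t * (1 - t ^ 2) * ((1 - t ^ 2) ^ 2 * 216))) (Icc 0 1) := hV.cont.mul (by fun_prop)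
  have h1 := intervalIntegral.integral_eq_sub_of_hasDerivAt_of_le zero_le_one hc
    (f' := fun t => V t * (4 * t * (3 * t ^ 2 - 2)
      + t * (1 - t ^ 2) * ((1 - t ^ 2) ^ 2 * 216))) ?_
    (intervalIntegrable_unit hint zero_mem_unit one_mem_unit)
  · have h2 : 0 ≤ ∫ t in (0 : ℝ)..1, V t * (4 * t * (3 * t ^ 2 - 2)
        + t * (1 - t ^ 2) * ((1 - t ^ 2) ^ 2 * 216)) := by
      refine intervalIntegral.integral_nonneg zero_le_one fun t ht => ?_
      refine mul_nonneg (hcon t ht).le ?_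
      have h3 : 0 ≤ 4 * (3 * t ^ 2 - 2) + 216 * (1 - t ^ 2) ^ 3 := by
        have h4 : 0 ≤ 1 - t ^ 2 := one_sub_sq_nonneg ht
        nlinarith [mul_nonneg h4 (sq_nonneg (3 * (1 - t ^ 2) - 1)), pow_nonneg h4 3]
      have : 4 * t * (3 * t ^ 2 - 2) + t * (1 - t ^ 2) * ((1 - t ^ 2) ^ 2 * 216)
        = t * (4 * (3 * t ^ 2 - 2) + 216 * (1 - t ^ 2) ^ 3) := by ring
      rw [this]
      exact mul_nonneg ht.1 h3
    have h5 := hcon 0 zero_mem_unit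
    rw [h1] at h2
    norm_num at h2
    linarith
  · intro t ht
    have hd1 : HasDerivAt (fun t : ℝ => (1 - t ^ 2) * (1 - 3 * t ^ 2)) (-8 * t + 12 * t ^ 3) t := by
      have a1 : HasDerivAt (fun t : ℝ => 1 - t ^ 2) (-(2 * t)) t := by
        simpa using (hasDerivAt_pow 2 t).const_sub 1
      have a2 : HasDerivAt (fun t : ℝ => 1 - 3 * t ^ 2) (-(3 * (2 * t))) t := by
        simpa using ((hasDerivAt_pow 2 t).const_mul 3).const_sub 1
      refine (a1.mul a2).congr_deriv ?_
      ring
    have hd2 : HasDerivAt (fun t : ℝ => t * (1 - t ^ 2)) (1 - 3 * t ^ 2) t := by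
      have a1 : HasDerivAt (fun t : ℝ => 1 - t ^ 2) (-(2 * t)) t := by
        simpa using (hasDerivAt_pow 2 t).const_sub 1
      refine ((hasDerivAt_id t).mul a1).congr_deriv ?_
      simp only [id]; ring
    refine (((hV.hasDerivAt t ht).mul hd1).sub
      (hd2.mul (hasDerivAt_fluxInt hV.cont_rhs ht))).congr_deriv ?_
    have := (one_sub_sq_pos (Ioo_subset_Ico_self ht)).ne'
    field_simp
    ring

/-- The solutions with `V(1) = 1` depend continuously on the spectral parameter; they are
identically 1 at parameter 0 and no longer positive at 216. Where positivity is first lost, the zero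
can only sit at `x = 0`, and this is the Dirichlet condition. -/
theorem exists_isPrincipal : ∃ ν V, IsPrincipal ν V := by
  have hid : ∀ a b : ℝ, |id a - id b| ≤ |a - b| := fun a b => le_rfl
  choose V hV hV1 using fun k => exists_solves hid k 1
  simp only [id] at hV
  have hdep : ∀ k₁, ∃ B, ∀ k₂, ∀ x ∈ Icc (0 : ℝ) 1,
      |V k₁ x - V k₂ x| ≤ |k₁ - k₂| * B * exp (2 * (|k₂| + 1)) := by
    intro k₁
    obtain ⟨B, hB⟩ := isCompact_Icc.exists_bound_of_continuousOn (hV k₁).cont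
    refine ⟨2 * B, fun k₂ x hx => ?_⟩
    have := Solves.abs_sub_le_of_lipschitz hid (hV k₁) (hV k₂) hB x hx
    simp only [hV1, sub_self, abs_zero, zero_add] at this
    linarith
  have hcont : ContinuousOn (Function.uncurry V) (Icc 0 216 ×ˢ Icc 0 1) := by
    rintro ⟨k, x⟩ ⟨hk, hx⟩
    obtain ⟨B, hB⟩ := hdep k
    have h1 : Tendsto (fun q : ℝ × ℝ => V k q.2) (𝓝[Icc 0 216 ×ˢ Icc 0 1] (k, x)) (𝓝 (V k x)) :=
      (hV k).cont.comp (f := Prod.snd) (s := Icc 0 216 ×ˢ Icc 0 1) continuous_snd.continuousOn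
        (fun q hq => hq.2) (k, x) ⟨hk, hx⟩
    have h2 : Tendsto (fun q : ℝ × ℝ => V k q.2 - V q.1 q.2)
        (𝓝[Icc 0 216 ×ˢ Icc 0 1] (k, x)) (𝓝 0) := by
      have h3 : Continuous fun q : ℝ × ℝ => |k - q.1| * B * exp (2 * (|q.1| + 1)) := by fun_prop
      have h4 := (h3.tendsto (k, x)).mono_left (nhdsWithin_le_nhds (s := Icc 0 216 ×ˢ Icc 0 1))
      simp only [sub_self, abs_zero, zero_mul] at h4
      refine squeeze_zero_norm' ?_ h4
      filter_upwards [self_mem_nhdsWithin] with q hq using hB q.1 q.2 hq.2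
    have := h1.sub h2
    simpa [ContinuousWithinAt, Function.uncurry_def] using this
  have hzero : ∀ x ∈ Icc (0 : ℝ) 1, V 0 x = 1 := by
    intro x hx
    have := (hV 0).abs_sub_le hx
    simp only [zero_mul, abs_zero, intervalIntegral.integral_zero, hV1] at this
    linarith [sub_eq_zero.1 (abs_nonpos_iff.1 this)]
  obtain ⟨ν, hν, hnonneg, ⟨x₀, hx₀, hx₀'⟩, -⟩ := exists_first_touching (by norm_num) hcont
    (fun x hx => by rw [hzero x hx]; exact one_pos) (not_pos_of_large (hV 216))
  have hz : ∀ x ∈ Icc (0 : ℝ) 1, V ν x = 0 → x = 0 := fun x hx h =>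
    (hV ν).eq_zero_of_nonneg hnonneg (by rw [hV1]; exact one_pos)
      (fun y hy => mul_nonneg hν.1.le (hnonneg y hy)) (by rw [hV1, mul_one]; exact hν.1) hx h
  refine ⟨ν, V ν, hν.1, hV ν, ?_, hV1 ν, fun x hx => ?_⟩
  · rwa [hz x₀ hx₀ hx₀'] at hx₀'
  · refine (hnonneg x ⟨hx.1.le, hx.2⟩).lt_of_ne fun h => ?_
    exact hx.1.ne' (hz x ⟨hx.1.le, hx.2⟩ h.symm)

/-! ### Estimates for the nonlinearity -/

/-- The nonlinearity of the state equation, `f(W) = sin (4 W) / 4`. -/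
noncomputable def sinFour (x : ℝ) : ℝ := sin (4 * x) / 4

@[fun_prop]
theorem continuous_sinFour : Continuous sinFour := by unfold sinFour; fun_prop

theorem sinFour_neg (x : ℝ) : sinFour (-x) = -sinFour x := by
  simp [sinFour, neg_div]

theorem sinFour_zero : sinFour 0 = 0 := by simp [sinFour]

theorem abs_sinFour_le_quarter (x : ℝ) : |sinFour x| ≤ 1 / 4 := by
  rw [sinFour, abs_div, abs_of_pos (by norm_num : (0 : ℝ) < 4)]
  linarith [abs_sin_le_one (4 * x)]

theorem abs_sinFour_sub_le (a b : ℝ) : |sinFour a - sinFour b| ≤ |a - b| := by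
  have := abs_sin_sub_sin_le (4 * a) (4 * b)
  rw [← mul_sub, abs_mul, abs_of_pos (by norm_num : (0 : ℝ) < 4)] at this
  rw [sinFour, sinFour, ← sub_div, abs_div, abs_of_pos (by norm_num : (0 : ℝ) < 4)]
  linarith

theorem abs_sinFour_le (a : ℝ) : |sinFour a| ≤ |a| := by
  simpa [sinFour_zero] using abs_sinFour_sub_le a 0

theorem sinFour_lt {x : ℝ} (hx : 0 < x) : sinFour x < x := by
  have := sin_lt (x := 4 * x) (by linarith)
  rw [sinFour]; linarith

theorem sinFour_pos {x : ℝ} (hx : 0 < x) (hx' : x < π / 4) : 0 < sinFour x :=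
  div_pos (sin_pos_of_pos_of_lt_pi (by linarith) (by linarith)) (by norm_num)

theorem hasDerivAt_sinFour (x : ℝ) : HasDerivAt sinFour (cos (4 * x)) x := by
  have h : HasDerivAt (fun x : ℝ => 4 * x) 4 x := by simpa using (hasDerivAt_id x).const_mul 4
  refine (h.sin.div_const 4).congr_deriv (by ring)

/-- Strict concavity of the sine on `[0, π]`: chord slopes from 0 decrease. -/
theorem sinFour_mul_lt {a b : ℝ} (ha : 0 < a) (hab : a < b) (hb : b ≤ π / 4) :
    sinFour b * a < sinFour a * b := by
  have h : (1 - a / b) • sin 0 + (a / b) • sin (4 * b)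
      < sin ((1 - a / b) • 0 + (a / b) • (4 * b)) :=
    strictConcaveOn_sin_Icc.2 ⟨le_rfl, pi_pos.le⟩
      ⟨by linarith, by linarith⟩ (by linarith)
      (by rw [sub_pos, div_lt_one (by linarith)]; exact hab) (div_pos ha (by linarith)) (by ring)
  have e : a / b * (4 * b) = 4 * a := by field_simp [(ha.trans hab).ne']
  simp only [smul_eq_mul, mul_zero, sin_zero, zero_add, e] at h
  have hb0 : 0 < b := ha.trans hab
  rw [div_mul_eq_mul_div, div_lt_iff₀ hb0] at h
  rw [sinFour, sinFour]
  linarith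

/-- The factor is far from sharp (near 0 the ratio tends to `8/3`), but it is valid up to `π/4`. For
`4x ≤ 1` this is the Taylor bound; beyond, `4x - sin(4x)` is at least its value at `4x = 1`. -/
theorem cube_le_sub_sinFour {x : ℝ} (hx : 0 ≤ x) (hx' : x ≤ π / 4) :
    1 / 20 * x ^ 3 ≤ x - sinFour x := by
  rcases le_total x (1 / 4) with h | h
  · have h1 := (abs_le.1 (sin_bound (x := 4 * x) (by rw [abs_of_nonneg] <;> linarith))).2
    rw [abs_of_nonneg (by linarith : 0 ≤ 4 * x)] at h1
    have h2 : x ^ 5 ≤ x ^ 3 := pow_le_pow_of_le_one hx (by linarith) (by norm_num)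
    have h3 : x ^ 5 ≤ x ^ 3 / 16 := by
      have : x ^ 2 ≤ 1 / 16 := by nlinarith
      have h4 := mul_le_mul_of_nonneg_left this (pow_nonneg hx 3)
      calc x ^ 5 = x ^ 3 * x ^ 2 := by ring
        _ ≤ _ := by linarith
    rw [sinFour]
    have h5 := pow_nonneg hx 3
    nlinarith
  · have h1 := (abs_le.1 (sin_bound (x := 1) (by norm_num))).2
    norm_num at h1
    have h1 : sin 1 ≤ 1 - 1 / 6 + 1 / 100 := by linarith
    have h2 : sin (4 * x) - sin 1 ≤ 4 * x - 1 := by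
      have := (le_abs_self _).trans (abs_sin_sub_sin_le (4 * x) 1)
      rwa [abs_of_nonneg (by linarith)] at this
    have h3 : x ≤ 0.8 := by linarith [pi_lt_d2]
    have h4 : x ^ 3 ≤ 0.8 ^ 3 := by gcongr
    rw [sinFour]
    norm_num at h4
    linarith

/-- The deviation of the nonlinearity from its linearization is locally cubic. -/
theorem abs_sinFour_sub_id_sub_le {a b c : ℝ} (ha : |a| ≤ c) (hb : |b| ≤ c) :
    |(sinFour a - a) - (sinFour b - b)| ≤ 8 * c ^ 2 * |a - b| := by
  have := Convex.norm_image_sub_le_of_norm_hasDerivWithin_le (f := fun x => sinFour x - x)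
    (f' := fun x => cos (4 * x) - 1) (s := Icc (-c) c) (C := 8 * c ^ 2) (x := b) (y := a)
    (fun x _ => ((hasDerivAt_sinFour x).sub (hasDerivAt_id x)).hasDerivWithinAt)
    (fun x hx => ?_) (convex_Icc _ _) (abs_le.1 hb) (abs_le.1 ha)
  · simpa using this
  · have h1 := one_sub_sq_div_two_le_cos (x := 4 * x)
    have h2 := cos_le_one (4 * x)
    rw [Real.norm_eq_abs, abs_of_nonpos (by linarith)]
    nlinarith [sq_le_sq' hx.1 hx.2]

theorem abs_sinFour_sub_id_le (a : ℝ) : |sinFour a - a| ≤ 8 * |a| ^ 3 := by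
  have := abs_sinFour_sub_id_sub_le (a := a) (b := 0) (c := |a|) le_rfl (by simp)
  simp only [sinFour_zero, sub_self, sub_zero] at this
  calc _ ≤ _ := this
    _ = _ := by ring

theorem abs_sinFour_taylor_le {a : ℝ} (ha : |a| ≤ 1 / 4) :
    |sinFour a - a + 8 / 3 * a ^ 3| ≤ 3 * |a| ^ 5 := by
  have h := sin_bound (x := 4 * a) (by rw [abs_mul, abs_of_pos (by norm_num : (0:ℝ) < 4)]; linarith)
  have e : sinFour a - a + 8 / 3 * a ^ 3 = (sin (4 * a) - (4 * a - (4 * a) ^ 3 / 6)) / 4 := by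
    rw [sinFour]; ring
  rw [e, abs_div, abs_of_pos (by norm_num : (0 : ℝ) < 4)]
  rw [abs_mul, abs_of_pos (by norm_num : (0 : ℝ) < 4), mul_pow] at h
  have := pow_nonneg (abs_nonneg a) 5
  have e2 : (4 * a) ^ 3 = 4 ^ 3 * a ^ 3 := by ring
  rw [e2]
  have e3 : (4 * |a|) ^ 5 = 1024 * |a| ^ 5 := by ring
  linarith

/-! ### A priori bounds from a monotone energy -/

/-- The energy `F = flux²/(2(1 - t²)³) + k sin²(2W)/8` has derivative `3t flux²/(1 - t²)⁴ ≥ 0`,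
since `sin²(2W)/8` is a primitive of `sinFour` along `W`. Its first term is nonnegative and tends to
0 at 1, which leaves the comparison of the sines. -/
theorem Solves.sq_sin_le {W : ℝ → ℝ} {k : ℝ} (hk : 0 < k)
    (h : Solves W (fun x => k * sinFour (W x))) {x : ℝ} (hx : x ∈ Icc (0 : ℝ) 1) :
    sin (2 * W x) ^ 2 ≤ sin (2 * W 1) ^ 2 := by
  set g : ℝ → ℝ := fun x => k * sinFour (W x) with hg
  set F : ℝ → ℝ := fun t => fluxInt g t ^ 2 / (2 * (1 - t ^ 2) ^ 3) + k * sin (2 * W t) ^ 2 / 8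
    with hF
  have hsin : ContinuousOn (fun t => k * sin (2 * W t) ^ 2 / 8) (Icc 0 1) := by
    have := h.cont
    fun_prop
  -- The value at 1 is `0 / 0 = 0`; the limit agrees because the square of the flux is `O((1 -
  -- t²)⁴)`.
  have hquot : ContinuousOn (fun t => fluxInt g t ^ 2 / (2 * (1 - t ^ 2) ^ 3)) (Icc 0 1) := by
    intro y hy
    rcases hy.2.eq_or_lt with rfl | hy1
    · have h0 : Tendsto (fun s : ℝ => (1 - s ^ 2) * (∫ t in s..1, |g t|) ^ 2)
          (𝓝[Icc 0 1] 1) (𝓝 0) := by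
        have hI := intervalIntegral.continuousOn_primitive_interval_left (a := (0 : ℝ)) (b := 1)
          (μ := volume) (f := fun t => |g t|)
          (by rw [uIcc_of_le zero_le_one]; exact h.cont_rhs.abs.integrableOn_Icc)
        rw [uIcc_of_le zero_le_one] at hI
        have : ContinuousOn (fun s : ℝ => (1 - s ^ 2) * (∫ t in s..1, |g t|) ^ 2) (Icc 0 1) :=
          ContinuousOn.mul (by fun_prop) (hI.pow 2)
        have h2 : Tendsto _ _ _ := this 1 one_mem_unit
        simpa only [one_pow, sub_self, zero_mul] using h2
      have : Tendsto (fun t => fluxInt g t ^ 2 / (2 * (1 - t ^ 2) ^ 3)) (𝓝[Icc 0 1] 1) (𝓝 0) := by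
        refine squeeze_zero' ?_ ?_ h0
        · filter_upwards [self_mem_nhdsWithin] with s hs
          have := one_sub_sq_nonneg hs
          positivity
        · filter_upwards [self_mem_nhdsWithin] with s hs
          rcases (one_sub_sq_nonneg hs).eq_or_lt with h1 | h1
          · simp [← h1]
          have hle := abs_fluxInt_le h.cont_rhs hs
          have h2 : fluxInt g s ^ 2 ≤ ((1 - s ^ 2) ^ 2 * ∫ t in s..1, |g t|) ^ 2 := by
            rw [← sq_abs (fluxInt g s)]
            gcongr
          rw [div_le_iff₀ (by positivity)]
          have h3 : 0 ≤ (1 - s ^ 2) ^ 4 * (∫ t in s..1, |g t|) ^ 2 := by positivity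
          nlinarith
      unfold ContinuousWithinAt
      simpa [fluxInt_one] using this
    · have := one_sub_sq_pos ⟨hy.1, hy1⟩
      exact ((continuousOn_fluxInt h.cont_rhs y hy).pow 2).div (by fun_prop) (by positivity)
  have hderiv : ∀ t ∈ Ioo (0 : ℝ) 1,
      HasDerivAt F (3 * t * fluxInt g t ^ 2 / (1 - t ^ 2) ^ 4) t := by
    intro t ht
    have hp := one_sub_sq_pos (Ioo_subset_Ico_self ht)
    have a1 : HasDerivAt (fun t : ℝ => 2 * (1 - t ^ 2) ^ 3) (2 * (3 * (1 - t ^ 2) ^ 2 * -(2 * t))) t := by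
      have : HasDerivAt (fun t : ℝ => 1 - t ^ 2) (-(2 * t)) t := by
        simpa using (hasDerivAt_pow 2 t).const_sub 1
      simpa using (this.pow 3).const_mul 2
    have a2 := (hasDerivAt_fluxInt h.cont_rhs ht).pow 2
    have a3 := ((h.hasDerivAt t ht).const_mul 2).sin.pow 2
    have a4 := (a2.div a1 (by positivity)).add ((a3.const_mul k).div_const 8)
    refine a4.congr_deriv ?_
    have e : g t = k * (sin (2 * W t) * cos (2 * W t) / 2) := by
      simp only [hg, sinFour]
      rw [show 4 * W t = 2 * (2 * W t) by ring, sin_two_mul]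
      ring
    rw [e]
    simp only [Nat.cast_ofNat, Nat.add_one_sub_one, pow_one, Pi.pow_apply]
    field_simp
    ring
  have hmono : MonotoneOn F (Icc 0 1) := by
    refine monotoneOn_of_deriv_nonneg (convex_Icc 0 1) (hquot.add hsin) ?_ ?_
    · rw [interior_Icc]
      exact fun t ht => (hderiv t ht).differentiableAt.differentiableWithinAt
    · rw [interior_Icc]
      intro t ht
      rw [(hderiv t ht).deriv]
      have := ht.1
      have := one_sub_sq_pos (Ioo_subset_Ico_self ht)
      positivity
  have hle := hmono hx one_mem_unit hx.2
  simp only [hF, fluxInt_one] at hle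
  have hq : 0 ≤ fluxInt g x ^ 2 / (2 * (1 - x ^ 2) ^ 3) := by
    have := one_sub_sq_nonneg hx
    positivity
  norm_num at hle
  have : k * sin (2 * W x) ^ 2 ≤ k * sin (2 * W 1) ^ 2 := by linarith
  exact le_of_mul_le_mul_left this hk

theorem sq_sin_two_mul_eq_one {a : ℝ} (ha : |a| = π / 4) : sin (2 * a) ^ 2 = 1 := by
  rcases (abs_eq (by positivity)).1 ha with rfl | rfl
  · rw [show 2 * (π / 4) = π / 2 by ring, sin_pi_div_two, one_pow]
  · rw [show 2 * -(π / 4) = -(π / 2) by ring, sin_neg, sin_pi_div_two]; norm_num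

/-- `Solves.sq_sin_le` alone bounds `W` only modulo periods. Since `|W(1)| < π/4`, the value `sin² =
1` is never reached, so by continuity `W` stays in the strip where `sin²(2W)` determines `|W|`. -/
theorem Solves.abs_le_of_lt {W : ℝ → ℝ} {k : ℝ} (hk : 0 < k)
    (h : Solves W (fun x => k * sinFour (W x))) (h1 : |W 1| < π / 4) {x : ℝ}
    (hx : x ∈ Icc (0 : ℝ) 1) : |W x| ≤ |W 1| := by
  have hcos : 0 < cos (2 * W 1) := by
    have := abs_lt.1 h1
    exact cos_pos_of_mem_Ioo ⟨by linarith, by linarith⟩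
  have hlt : |W x| < π / 4 := by
    by_contra hcon
    push Not at hcon
    obtain ⟨y, hy, hy'⟩ := intermediate_value_Icc' hx.2
      (h.cont.mono (Icc_subset_Icc_left hx.1)).abs (show π / 4 ∈ Icc |W 1| |W x| from ⟨h1.le, hcon⟩)
    have h2 := h.sq_sin_le hk ⟨hx.1.trans hy.1, hy.2⟩
    rw [sq_sin_two_mul_eq_one hy'] at h2
    nlinarith [sin_sq_add_cos_sq (2 * W 1)]
  have h2 := h.sq_sin_le hk hx
  by_contra hcon
  push Not at hcon
  have h3 : sin (2 * |W 1|) < sin (2 * |W x|) :=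
    strictMonoOn_sin ⟨by linarith [abs_nonneg (W 1), pi_pos], by linarith⟩
      ⟨by linarith [abs_nonneg (W x), pi_pos], by linarith⟩ (by linarith)
  have h4 : 0 ≤ sin (2 * |W 1|) := sin_nonneg_of_nonneg_of_le_pi (by positivity)
    (by linarith [pi_pos])
  have h5 : ∀ a : ℝ, sin (2 * |a|) ^ 2 = sin (2 * a) ^ 2 := by
    intro a
    rcases abs_choice a with h | h <;> rw [h]
    rw [mul_neg, sin_neg, neg_sq]
  rw [← h5 (W x), ← h5 (W 1)] at h2
  nlinarith

/-! ### Half states and their comparison with the principal eigenfunction -/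

/-- `W = u - π/4` for a state `u` at `μ = k^(-1/2)`, on half of the interval and in the variable
`x = μ y`. -/
structure IsHalfState (k : ℝ) (W : ℝ → ℝ) : Prop where
  solves : Solves W (fun x => k * sinFour (W x))
  zero : W 0 = 0

namespace IsHalfState

variable {k : ℝ} {W : ℝ → ℝ}

theorem neg (h : IsHalfState k W) : IsHalfState k (fun x => -W x) where
  solves := (h.solves.const_mul (-1)).congr (fun _ _ => by ring)
    (fun _ _ => by rw [sinFour_neg]; ring)
  zero := by rw [h.zero, neg_zero]

theorem eq_const (h : IsHalfState k W) (h1 : sinFour (W 1) = 0) {x : ℝ}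
    (hx : x ∈ Icc (0 : ℝ) 1) : W x = 0 := by
  have hc : Solves (fun _ => W 1) (fun _ => k * sinFour (W 1)) :=
    (Solves.const (W 1)).congr_rhs fun _ _ => by rw [h1, mul_zero]
  have := h.solves.eqOn_of_lipschitz abs_sinFour_sub_le hc rfl
  rw [this hx, ← this zero_mem_unit, h.zero]

theorem eq_zero (h : IsHalfState k W) (h1 : W 1 = 0) {x : ℝ}
    (hx : x ∈ Icc (0 : ℝ) 1) : W x = 0 :=
  h.eq_const (by rw [h1, sinFour_zero]) hx

/-- Otherwise `|W|`, which starts at 0, takes the value `π/4` somewhere. By the energy bound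
`sin²(2W(1)) = 1`, so `W(1)` is an equilibrium and `W` is constant, against `W(0) = 0`. -/
theorem abs_one_lt (hk : 0 < k) (h : IsHalfState k W) : |W 1| < π / 4 := by
  by_contra hcon
  push Not at hcon
  obtain ⟨y, hy, hy'⟩ := intermediate_value_Icc zero_le_one h.solves.cont.abs
    (show π / 4 ∈ Icc |W 0| |W 1| from ⟨by rw [h.zero, abs_zero]; positivity, hcon⟩)
  have h2 := h.solves.sq_sin_le hk hy
  rw [sq_sin_two_mul_eq_one hy'] at h2
  have h3 : cos (2 * W 1) = 0 := by nlinarith [sin_sq_add_cos_sq (2 * W 1)]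
  have h4 := h.eq_const (x := 1) (by
    rw [sinFour, show 4 * W 1 = 2 * (2 * W 1) by ring, sin_two_mul, h3]; simp) one_mem_unit
  rw [h4, abs_zero] at hcon
  linarith [pi_pos]

theorem abs_le (hk : 0 < k) (h : IsHalfState k W) {x : ℝ} (hx : x ∈ Icc (0 : ℝ) 1) :
    |W x| ≤ |W 1| :=
  h.solves.abs_le_of_lt hk (h.abs_one_lt hk) hx

theorem lt_pi_div_four (hk : 0 < k) (h : IsHalfState k W) {x : ℝ} (hx : x ∈ Icc (0 : ℝ) 1) :
    W x < π / 4 :=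
  (le_abs_self _).trans_lt ((h.abs_le hk hx).trans_lt (h.abs_one_lt hk))

/-- Green's identity against the principal eigenfunction, from the last zero of `W` on. -/
theorem exists_last_zero_green (hk : 0 < k) (h : IsHalfState k W) (h1 : 0 < W 1) {ν : ℝ}
    {V : ℝ → ℝ} (hV : IsPrincipal ν V) :
    ∃ x ∈ Ico (0 : ℝ) 1, W x = 0 ∧ (∀ y ∈ Ioc x 1, 0 < W y) ∧
      0 ≤ V x ∧ 0 < fluxInt (fun x => k * sinFour (W x)) x ∧
      fluxInt (fun x => k * sinFour (W x)) x * V x =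
        ∫ t in x..1, (1 - t ^ 2) ^ 2 * (V t * (k * sinFour (W t) - ν * W t)) := by
  obtain ⟨x, hx, hx0, hpos⟩ := exists_last_zero h.solves.cont h.zero h1
  refine ⟨x, hx, hx0, hpos, ?_, ?_, ?_⟩
  · rcases hx.1.eq_or_lt with h0 | h0
    · rw [← h0, hV.zero]
    · exact (hV.pos_of_pos x ⟨h0, hx.2.le⟩).le
  · exact fluxInt_pos h.solves.cont_rhs hx fun t ht => mul_pos hk
      (sinFour_pos (hpos t ⟨ht.1, ht.2.le⟩) (h.lt_pi_div_four hk ⟨hx.1.trans ht.1.le, ht.2.le⟩))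
  · have := h.solves.green hV.solves (Ico_subset_Icc_self hx)
    rw [hx0, zero_mul, sub_zero] at this
    rw [← this]
    refine intervalIntegral.integral_congr fun t _ => ?_
    ring

/-- If `W(1) > 0`, the identity of `exists_last_zero_green` has a nonnegative left side, while its
right side is negative because `k sinFour W < ν W`. The case `W(1) < 0` follows by oddness. -/
theorem eq_zero_of_le (hk : 0 < k) (h : IsHalfState k W) {ν : ℝ} {V : ℝ → ℝ}
    (hV : IsPrincipal ν V) (hkν : k ≤ ν) {x : ℝ} (hx : x ∈ Icc (0 : ℝ) 1) : W x = 0 := by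
  have key : ∀ {W : ℝ → ℝ}, IsHalfState k W → ¬ 0 < W 1 := by
    intro W h h1
    obtain ⟨x, hx, -, hpos, hVx, hfl, hgr⟩ := h.exists_last_zero_green hk h1 hV
    have hc : ContinuousOn (fun t => (1 - t ^ 2) ^ 2 * (V t * (ν * W t - k * sinFour (W t))))
        (Icc 0 1) := continuousOn_weight_mul
      (hV.solves.cont.mul ((continuousOn_const.mul h.solves.cont).sub h.solves.cont_rhs))
    have hlt : 0 < ∫ t in x..1, (1 - t ^ 2) ^ 2 * (V t * (ν * W t - k * sinFour (W t))) := by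
      refine intervalIntegral.intervalIntegral_pos_of_pos_on
        (intervalIntegrable_unit hc (Ico_subset_Icc_self hx) one_mem_unit) (fun t ht => ?_) hx.2
      have ht0 : t ∈ Ico (0 : ℝ) 1 := ⟨hx.1.trans ht.1.le, ht.2⟩
      have hW := hpos t ⟨ht.1, ht.2.le⟩
      refine mul_pos (pow_pos (one_sub_sq_pos ht0) 2) (mul_pos
        (hV.pos_of_pos t ⟨hx.1.trans_lt ht.1, ht.2.le⟩) ?_)
      have h2 := sinFour_lt hW
      have h3 := sinFour_pos hW (h.lt_pi_div_four hk (Ico_subset_Icc_self ht0))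
      nlinarith
    have e : ∫ t in x..1, (1 - t ^ 2) ^ 2 * (V t * (ν * W t - k * sinFour (W t)))
        = -∫ t in x..1, (1 - t ^ 2) ^ 2 * (V t * (k * sinFour (W t) - ν * W t)) := by
      rw [← intervalIntegral.integral_neg]
      refine intervalIntegral.integral_congr fun t _ => ?_
      ring
    rw [e, ← hgr] at hlt
    nlinarith
  rcases lt_trichotomy (W 1) 0 with h1 | h1 | h1
  · exact absurd (neg_pos.2 h1) (key h.neg)
  · exact h.eq_zero h1 hx
  · exact absurd h1 (key h)

end IsHalfState

/-- The principal eigenvalue is the smallest one. -/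
theorem IsPrincipal.le_of_solves {ν κ : ℝ} {V v : ℝ → ℝ} (hV : IsPrincipal ν V)
    (hv : Solves v (fun x => κ * v x)) (h0 : v 0 = 0) (h1 : v 1 ≠ 0) : ν ≤ κ := by
  have key : ∀ {v : ℝ → ℝ}, Solves v (fun x => κ * v x) → v 0 = 0 → 0 < v 1 → ν ≤ κ := by
    intro v hv h0 h1
    by_contra hlt
    push Not at hlt
    obtain ⟨x, hx, hx0, hpos⟩ := exists_last_zero hv.cont h0 h1
    have hxI := Ico_subset_Icc_self hx
    have hgr := hv.green hV.solves hxI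
    rw [hx0, zero_mul, sub_zero] at hgr
    have hVx : 0 ≤ V x := by
      rcases hx.1.eq_or_lt with h0 | h0
      · rw [← h0, hV.zero]
      · exact (hV.pos_of_pos x ⟨h0, hx.2.le⟩).le
    -- For `κ > 0` the flux is positive. For `κ ≤ 0`, `v` would not increase from its zero `x` to 1,
    -- against `v(1) > 0`.
    have hfl : 0 ≤ fluxInt (fun x => κ * v x) x := by
      by_contra hneg
      push Not at hneg
      have hκ : κ ≤ 0 := by
        by_contra hκ
        push Not at hκ
        exact absurd (fluxInt_pos hv.cont_rhs hx fun t ht =>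
          mul_pos hκ (hpos t ⟨ht.1, ht.2.le⟩)) hneg.not_gt
      have hmono := (hv.const_mul (-1)).monotoneOn (a := x) (b := 1) hx.1 le_rfl fun t ht => ?_
      · have := hmono ⟨le_rfl, hx.2.le⟩ ⟨hx.2.le, le_rfl⟩ hx.2.le
        simp only [hx0] at this
        linarith
      · refine fluxInt_nonneg ht.2.le fun s hs => ?_
        have := hpos s ⟨ht.1.trans_le hs.1, hs.2⟩
        nlinarith
    have hc : ContinuousOn (fun t => (1 - t ^ 2) ^ 2 * (κ * v t * V t - v t * (ν * V t)))
        (Icc 0 1) := continuousOn_weight_mul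
      ((hv.cont_rhs.mul hV.solves.cont).sub (hv.cont.mul hV.solves.cont_rhs))
    have hlt : 0 < ∫ t in x..1, -((1 - t ^ 2) ^ 2 * (κ * v t * V t - v t * (ν * V t))) := by
      refine intervalIntegral.intervalIntegral_pos_of_pos_on
        (intervalIntegrable_unit hc.neg hxI one_mem_unit) (fun t ht => ?_) hx.2
      have ht0 : t ∈ Ico (0 : ℝ) 1 := ⟨hx.1.trans ht.1.le, ht.2⟩
      have e : -((1 - t ^ 2) ^ 2 * (κ * v t * V t - v t * (ν * V t)))
        = (1 - t ^ 2) ^ 2 * ((ν - κ) * (v t * V t)) := by ring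
      rw [e]
      exact mul_pos (pow_pos (one_sub_sq_pos ht0) 2) (mul_pos (sub_pos.2 hlt)
        (mul_pos (hpos t ⟨ht.1, ht.2.le⟩) (hV.pos_of_pos t ⟨hx.1.trans_lt ht.1, ht.2.le⟩)))
    rw [intervalIntegral.integral_neg, hgr] at hlt
    nlinarith
  rcases h1.lt_or_gt with h1 | h1
  · exact key ((hv.const_mul (-1)).congr_rhs fun _ _ => by ring) (by rw [h0, mul_zero])
      (by linarith)
  · exact key hv h0 h1

theorem IsPrincipal.strictMonoOn {ν : ℝ} {V : ℝ → ℝ} (hV : IsPrincipal ν V) :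
    StrictMonoOn V (Icc 0 1) :=
  hV.solves.strictMonoOn le_rfl le_rfl fun _ hx =>
    fluxInt_pos hV.solves.cont_rhs (Ioo_subset_Ico_self hx) fun t ht =>
      mul_pos hV.pos (hV.pos_of_pos t ⟨hx.1.trans ht.1, ht.2.le⟩)

theorem IsPrincipal.nonneg {ν : ℝ} {V : ℝ → ℝ} (hV : IsPrincipal ν V) {x : ℝ}
    (hx : x ∈ Icc (0 : ℝ) 1) : 0 ≤ V x := by
  rcases hx.1.eq_or_lt with h0 | h0
  · rw [← h0, hV.zero]
  · exact (hV.pos_of_pos x ⟨h0, hx.2⟩).le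

theorem IsPrincipal.integral_pos {ν : ℝ} {V : ℝ → ℝ} (hV : IsPrincipal ν V) {x : ℝ}
    (hx : x ∈ Ico (0 : ℝ) 1) : 0 < ∫ t in x..1, (1 - t ^ 2) ^ 2 * V t :=
  intervalIntegral.intervalIntegral_pos_of_pos_on
    (intervalIntegrable_unit (continuousOn_weight_mul hV.solves.cont) (Ico_subset_Icc_self hx)
      one_mem_unit)
    (fun t ht => mul_pos (pow_pos (one_sub_sq_pos ⟨hx.1.trans ht.1.le, ht.2⟩) 2)
      (hV.pos_of_pos t ⟨hx.1.trans_lt ht.1, ht.2.le⟩)) hx.2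

/-! ### Amplitude and sign of half states just above the principal eigenvalue -/

namespace IsHalfState

variable {k : ℝ} {W : ℝ → ℝ}

/-- A state is close to its endpoint value on a neighbourhood of `1` of fixed size. -/
theorem half_le (hk : 0 < k) (h : IsHalfState k W) (h1 : 0 < W 1) {ν : ℝ} (hν : 0 < ν)
    (hkν : k ≤ 2 * ν) {x : ℝ} (hx : x ∈ Icc (1 - 1 / (4 * (ν + 1))) 1) : W 1 / 2 ≤ W x := by
  have hx0 : x ∈ Icc (0 : ℝ) 1 := by
    refine ⟨le_trans ?_ hx.1, hx.2⟩
    rw [sub_nonneg, div_le_one (by positivity)]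
    linarith
  have h2 := h.solves.abs_sub_le hx0
  have h3 := integral_le_of_le_unit h.solves.cont_rhs.abs hx0 (G := 2 * ν * W 1) fun t ht => by
    rw [abs_mul, abs_of_pos hk]
    have h4 := (abs_sinFour_le (W t)).trans (h.abs_le hk ht)
    rw [abs_of_pos h1] at h4
    gcongr
  have h5 : 1 - x ≤ 1 / (4 * (ν + 1)) := by linarith [hx.1]
  have h6 : 2 * ν * W 1 * (1 - x) ≤ W 1 / 2 := by
    calc 2 * ν * W 1 * (1 - x) ≤ 2 * ν * W 1 * (1 / (4 * (ν + 1))) := by gcongr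
      _ = W 1 / 2 * (ν / (ν + 1)) := by field_simp; ring
      _ ≤ W 1 / 2 * 1 := by
        gcongr
        rw [div_le_one (by positivity)]
        linarith
      _ = _ := mul_one _
  linarith [(_root_.abs_le.1 (h2.trans (h3.trans h6))).1]

end IsHalfState

theorem IsPrincipal.window {ν : ℝ} {V : ℝ → ℝ} (hV : IsPrincipal ν V) :
    1 - 1 / (4 * (ν + 1)) ∈ Ioo (0 : ℝ) 1 := by
  have := hV.pos
  constructor
  · rw [sub_pos, div_lt_one (by positivity)]
    linarith
  · have : 0 < 1 / (4 * (ν + 1)) := by positivity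
    linarith

/-- In Green's identity from the last zero on, the linear gain is at most `(k - ν) W(1) M`, while
the cubic gap costs `ν/20 ∫ V W³`. Since `W ≥ W(1)/2` on a window of fixed size at 1, the cost is at
least a multiple of `W(1)³`; the constant 160 is `20 · 2³`. -/
theorem IsPrincipal.exists_amplitude_bound {ν : ℝ} {V : ℝ → ℝ} (hV : IsPrincipal ν V) :
    ∃ C, 0 < C ∧ ∀ k ∈ Ioc ν (2 * ν), ∀ W, IsHalfState k W → W 1 ^ 2 ≤ C * (k - ν) := by
  have hν := hV.pos
  set b := 1 - 1 / (4 * (ν + 1)) with hb_def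
  have hb : b ∈ Ioo (0 : ℝ) 1 := hV.window
  set M := ∫ t in (0 : ℝ)..1, (1 - t ^ 2) ^ 2 * V t with hM_def
  set m := ∫ t in b..1, (1 - t ^ 2) ^ 2 * V t with hm_def
  have hM : 0 < M := hV.integral_pos ⟨le_rfl, one_pos⟩
  have hm : 0 < m := hV.integral_pos (Ioo_subset_Ico_self hb)
  have key : ∀ k ∈ Ioc ν (2 * ν), ∀ W, IsHalfState k W → 0 < W 1 →
      W 1 ^ 2 ≤ 160 * M / (ν * m) * (k - ν) := by
    intro k hkI W h h1
    have hk : 0 < k := hν.trans hkI.1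
    obtain ⟨x, hx, hx0, hpos, hVx, hfl, hgr⟩ := h.exists_last_zero_green hk h1 hV
    have hxI := Ico_subset_Icc_self hx
    have hxb : x < b := by
      by_contra hcon
      push Not at hcon
      have := h.half_le hk h1 hν hkI.2 ⟨hcon, hx.2.le⟩
      linarith
    have hWc := h.solves.cont
    have hVc := hV.solves.cont
    have hi1 : ContinuousOn (fun t => (1 - t ^ 2) ^ 2 * V t) (Icc 0 1) := continuousOn_weight_mul hVc
    have hi2 : ContinuousOn (fun t => (1 - t ^ 2) ^ 2 * V t * W t ^ 3) (Icc 0 1) :=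
      hi1.mul (hWc.pow 3)
    have hle : ∫ t in x..1, (1 - t ^ 2) ^ 2 * (V t * (k * sinFour (W t) - ν * W t))
        ≤ ∫ t in x..1, ((k - ν) * W 1 * ((1 - t ^ 2) ^ 2 * V t)
          - ν / 20 * ((1 - t ^ 2) ^ 2 * V t * W t ^ 3)) := by
      refine intervalIntegral.integral_mono_on hx.2.le
        (intervalIntegrable_unit (continuousOn_weight_mul
          (hVc.mul (h.solves.cont_rhs.sub (continuousOn_const.mul hWc)))) hxI one_mem_unit)
        (intervalIntegrable_unit ((continuousOn_const.mul hi1).sub (continuousOn_const.mul hi2))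
          hxI one_mem_unit) fun t ht => ?_
      have ht0 : t ∈ Icc (0 : ℝ) 1 := ⟨hx.1.trans ht.1, ht.2⟩
      have hW0 : 0 ≤ W t := by
        rcases ht.1.eq_or_lt with h' | h'
        · rw [← h', hx0]
        · exact (hpos t ⟨h', ht.2⟩).le
      have hle1 := (le_abs_self _).trans (h.abs_le hk ht0)
      rw [abs_of_pos h1] at hle1
      have hle2 := (le_abs_self _).trans (abs_sinFour_le (W t))
      rw [abs_of_nonneg hW0] at hle2
      have hle3 := cube_le_sub_sinFour hW0 (h.lt_pi_div_four hk ht0).le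
      have hk' := sub_pos.2 hkI.1
      have hfin : k * sinFour (W t) - ν * W t ≤ (k - ν) * W 1 - ν / 20 * W t ^ 3 := by
        nlinarith [mul_le_mul_of_nonneg_left (hle2.trans hle1) hk'.le]
      have := mul_le_mul_of_nonneg_left hfin (mul_nonneg (sq_nonneg (1 - t ^ 2)) (hV.nonneg ht0))
      nlinarith
    rw [intervalIntegral.integral_sub
      ((intervalIntegrable_unit hi1 hxI one_mem_unit).const_mul _)
      ((intervalIntegrable_unit hi2 hxI one_mem_unit).const_mul _),
      intervalIntegral.integral_const_mul, intervalIntegral.integral_const_mul, ← hgr] at hle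
    have hA : ∫ t in x..1, (1 - t ^ 2) ^ 2 * V t ≤ M := by
      refine intervalIntegral.integral_mono_interval hx.1 hx.2.le le_rfl ?_
        (intervalIntegrable_unit hi1 zero_mem_unit one_mem_unit)
      filter_upwards [ae_restrict_mem measurableSet_Ioc] with t ht
      exact mul_nonneg (sq_nonneg _) (hV.nonneg (Ioc_subset_Icc_self ht))
    have hB : (W 1 / 2) ^ 3 * m ≤ ∫ t in x..1, (1 - t ^ 2) ^ 2 * V t * W t ^ 3 := by
      have hbI := Ioo_subset_Icc_self hb
      calc (W 1 / 2) ^ 3 * m = ∫ t in b..1, (W 1 / 2) ^ 3 * ((1 - t ^ 2) ^ 2 * V t) := by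
            rw [intervalIntegral.integral_const_mul]
        _ ≤ ∫ t in b..1, (1 - t ^ 2) ^ 2 * V t * W t ^ 3 := by
          refine intervalIntegral.integral_mono_on hb.2.le
            ((intervalIntegrable_unit hi1 hbI one_mem_unit).const_mul _)
            (intervalIntegrable_unit hi2 hbI one_mem_unit) fun t ht => ?_
          have h2 := h.half_le hk h1 hν hkI.2 ht
          have h3 : (W 1 / 2) ^ 3 ≤ W t ^ 3 := by gcongr
          rw [mul_comm]
          exact mul_le_mul_of_nonneg_left h3
            (mul_nonneg (sq_nonneg _) (hV.nonneg ⟨hb.1.le.trans ht.1, ht.2⟩))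
        _ ≤ _ := by
          refine intervalIntegral.integral_mono_interval hxb.le hb.2.le le_rfl ?_
            (intervalIntegrable_unit hi2 hxI one_mem_unit)
          filter_upwards [ae_restrict_mem measurableSet_Ioc] with t ht
          exact mul_nonneg (mul_nonneg (sq_nonneg _) (hV.nonneg ⟨hx.1.trans ht.1.le, ht.2⟩))
            (pow_nonneg (hpos t ht).le 3)
    have hC := mul_le_mul_of_nonneg_left hA (mul_pos (sub_pos.2 hkI.1) h1).le
    have hD := mul_le_mul_of_nonneg_left hB (by positivity : 0 ≤ ν / 20)
    have hE := mul_nonneg hfl.le hVx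
    have hF : W 1 * (W 1 ^ 2 * (ν * m)) ≤ W 1 * (160 * M * (k - ν)) := by nlinarith
    have hG := le_of_mul_le_mul_left hF h1
    rw [div_mul_eq_mul_div, le_div_iff₀ (by positivity)]
    exact hG
  refine ⟨160 * M / (ν * m), by positivity, fun k hk W h => ?_⟩
  rcases lt_trichotomy (W 1) 0 with h1 | h1 | h1
  · simpa using key k hk _ h.neg (by linarith)
  · have h2 := sub_pos.2 hk.1
    have h3 : 0 ≤ 160 * M / (ν * m) * (k - ν) := by positivity
    rw [h1]
    linarith
  · exact key k hk W h h1

/-- Just beyond the principal eigenvalue the half states do not change sign. -/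
theorem IsPrincipal.exists_pos {ν : ℝ} {V : ℝ → ℝ} (hV : IsPrincipal ν V) :
    ∃ r, 0 < r ∧ r ≤ ν ∧ ∀ k ∈ Ioo ν (ν + r), ∀ W, IsHalfState k W → 0 < W 1 →
      ∀ x ∈ Ioc (0 : ℝ) 1, 0 < W x := by
  have hν := hV.pos
  obtain ⟨C, hC, hamp⟩ := hV.exists_amplitude_bound
  set b := 1 - 1 / (4 * (ν + 1)) with hb_def
  have hb : b ∈ Ioo (0 : ℝ) 1 := hV.window
  set M := ∫ t in (0 : ℝ)..1, (1 - t ^ 2) ^ 2 * V t with hM_def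
  have hM : 0 < M := hV.integral_pos ⟨le_rfl, one_pos⟩
  set m := ∫ t in b..1, (1 - t ^ 2) ^ 2 with hm_def
  have hm : 0 < m := by
    refine intervalIntegral.intervalIntegral_pos_of_pos_on
      (Continuous.intervalIntegrable (by fun_prop) _ _) (fun t ht => ?_) hb.2
    exact pow_pos (one_sub_sq_pos ⟨hb.1.le.trans ht.1.le, ht.2⟩) 2
  -- The flux at the last zero will be at least `k W(1) m/4`, and on an interval of length below
  -- `m/8` it varies by less than half of this. The choice of `r` gives `W(1)² ≤ 1/16` and places
  -- the last zero below `s`.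
  set s := min (m / 8) 1 with hs_def
  have hs : s ∈ Ioc (0 : ℝ) 1 := ⟨lt_min (by positivity) one_pos, min_le_right _ _⟩
  have hVs := hV.pos_of_pos s hs
  set r := min ν (min (1 / (16 * C)) (V s * (ν * m) / (8 * M))) with hr_def
  have hr : 0 < r := by positivity
  refine ⟨r, hr, min_le_left _ _, fun k hkI W h h1 => ?_⟩
  have hk : 0 < k := hν.trans hkI.1
  have hkν := sub_pos.2 hkI.1
  have hkr : k - ν < r := by linarith [hkI.2]
  have hk2 : k ≤ 2 * ν := by linarith [min_le_left ν (min (1 / (16 * C)) (V s * (ν * m) / (8 * M)))]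
  have hc2 : W 1 ^ 2 ≤ 1 / 16 := by
    have h3 : k - ν ≤ 1 / (16 * C) :=
      hkr.le.trans ((min_le_right _ _).trans (min_le_left _ _))
    calc W 1 ^ 2 ≤ C * (k - ν) := hamp k ⟨hkI.1, hk2⟩ W h
      _ ≤ C * (1 / (16 * C)) := by gcongr
      _ = 1 / 16 := by field_simp
  obtain ⟨x, hx, hx0, hpos, hVx, hfl, hgr⟩ := h.exists_last_zero_green hk h1 hV
  have hxI := Ico_subset_Icc_self hx
  have hxb : x < b := by
    by_contra hcon
    push Not at hcon
    have := h.half_le hk h1 hν hk2 ⟨hcon, hx.2.le⟩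
    linarith
  have hWc := h.solves.cont
  have hVc := hV.solves.cont
  have hi1 : ContinuousOn (fun t => (1 - t ^ 2) ^ 2 * V t) (Icc 0 1) := continuousOn_weight_mul hVc
  have hrange : ∀ t ∈ Icc x 1, 0 ≤ W t ∧ W t ≤ W 1 := by
    intro t ht
    constructor
    · rcases ht.1.eq_or_lt with h' | h'
      · rw [← h', hx0]
      · exact (hpos t ⟨h', ht.2⟩).le
    · have := (le_abs_self _).trans (h.abs_le hk ⟨hx.1.trans ht.1, ht.2⟩)
      rwa [abs_of_pos h1] at this
  have hA : fluxInt (fun x => k * sinFour (W x)) x * V x ≤ (k - ν) * W 1 * M := by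
    rw [hgr]
    calc _ ≤ ∫ t in x..1, (k - ν) * W 1 * ((1 - t ^ 2) ^ 2 * V t) := by
          refine intervalIntegral.integral_mono_on hx.2.le
            (intervalIntegrable_unit (continuousOn_weight_mul
              (hVc.mul (h.solves.cont_rhs.sub (continuousOn_const.mul hWc)))) hxI one_mem_unit)
            ((intervalIntegrable_unit hi1 hxI one_mem_unit).const_mul _) fun t ht => ?_
          obtain ⟨hW0, hW1⟩ := hrange t ht
          have hle2 := (le_abs_self _).trans (abs_sinFour_le (W t))
          rw [abs_of_nonneg hW0] at hle2
          have hfin : k * sinFour (W t) - ν * W t ≤ (k - ν) * W 1 := by nlinarith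
          have := mul_le_mul_of_nonneg_left hfin (mul_nonneg (sq_nonneg (1 - t ^ 2))
            (hV.nonneg ⟨hx.1.trans ht.1, ht.2⟩))
          nlinarith
      _ ≤ _ := by
          rw [intervalIntegral.integral_const_mul]
          refine mul_le_mul_of_nonneg_left ?_ (mul_pos hkν h1).le
          refine intervalIntegral.integral_mono_interval hx.1 hx.2.le le_rfl ?_
            (intervalIntegrable_unit hi1 zero_mem_unit one_mem_unit)
          filter_upwards [ae_restrict_mem measurableSet_Ioc] with t ht
          exact mul_nonneg (sq_nonneg _) (hV.nonneg (Ioc_subset_Icc_self ht))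
  -- For `0 ≤ W ≤ 1/4` one has `sinFour W ≥ W/2`, which is at least `W(1)/4` on the window.
  have hB : k * (W 1 / 4) * m ≤ fluxInt (fun x => k * sinFour (W x)) x := by
    have hbI := Ioo_subset_Icc_self hb
    rw [← intervalIntegral.integral_const_mul]
    calc ∫ t in b..1, k * (W 1 / 4) * (1 - t ^ 2) ^ 2
        ≤ ∫ t in b..1, (1 - t ^ 2) ^ 2 * (k * sinFour (W t)) := by
          refine intervalIntegral.integral_mono_on hb.2.le
            (Continuous.intervalIntegrable (by fun_prop) _ _)
            (intervalIntegrable_unit (continuousOn_weight_mul h.solves.cont_rhs) hbI one_mem_unit)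
            fun t ht => ?_
          obtain ⟨hW0, hW1⟩ := hrange t ⟨hxb.le.trans ht.1, ht.2⟩
          have h2 := h.half_le hk h1 hν hk2 ht
          have h3 := (abs_le.1 (abs_sinFour_sub_id_le (W t))).1
          rw [abs_of_nonneg hW0] at h3
          have h4 : W t ^ 2 ≤ 1 / 16 := by nlinarith
          have h5 : W 1 / 4 ≤ sinFour (W t) := by nlinarith [mul_le_mul_of_nonneg_left h4 hW0]
          rw [mul_comm]
          gcongr
      _ ≤ _ := by
          refine intervalIntegral.integral_mono_interval hxb.le hb.2.le le_rfl ?_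
            (intervalIntegrable_unit (continuousOn_weight_mul h.solves.cont_rhs) hxI one_mem_unit)
          filter_upwards [ae_restrict_mem measurableSet_Ioc] with t ht
          exact mul_nonneg (sq_nonneg _) (mul_nonneg hk.le (sinFour_pos (hpos t ht)
            (h.lt_pi_div_four hk ⟨hx.1.trans ht.1.le, ht.2⟩)).le)
  have hxs : x < s := by
    have h2 : V x < V s := by
      have h3 : k * (W 1 / 4) * m * V x ≤ (k - ν) * W 1 * M :=
        (mul_le_mul_of_nonneg_right hB hVx).trans hA
      have h4 : (k - ν) * (8 * M) ≤ V s * (ν * m) := by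
        rw [← le_div_iff₀ (by positivity)]
        exact hkr.le.trans ((min_le_right _ _).trans (min_le_right _ _))
      have h5 : W 1 * (2 * (k * m * V x)) ≤ W 1 * (V s * (ν * m)) := by nlinarith
      have h6 := le_of_mul_le_mul_left h5 h1
      by_contra hcon
      push Not at hcon
      have h7 : k * m * V s ≤ k * m * V x := by gcongr
      have h8 : ν * m * V s ≤ k * m * V s := by gcongr; exact hkI.1.le
      have h9 : 0 < ν * m * V s := by positivity
      nlinarith
    exact (hV.strictMonoOn.lt_iff_lt hxI (Ioc_subset_Icc_self hs)).1 h2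
  -- If `x > 0`, the flux is positive on all of `(0, x)`, so `W` would increase strictly between two
  -- of its zeros.
  have hxz : x = 0 := by
    by_contra hne
    have hx0' : 0 < x := hx.1.lt_of_ne (Ne.symm hne)
    have hmono := h.solves.strictMonoOn (a := 0) (b := x) le_rfl hx.2.le fun y hy => ?_
    · have := hmono ⟨le_rfl, hx.1⟩ ⟨hx.1, le_rfl⟩ hx0'
      rw [h.zero, hx0] at this
      exact lt_irrefl _ this
    · have hyI : y ∈ Icc (0 : ℝ) 1 := ⟨hy.1.le, hy.2.le.trans hx.2.le⟩
      rw [fluxInt_split h.solves.cont_rhs hyI hxI]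
      have h2 : ‖∫ t in y..x, (1 - t ^ 2) ^ 2 * (k * sinFour (W t))‖ ≤ k * W 1 * |x - y| := by
        refine intervalIntegral.norm_integral_le_of_norm_le_const fun t ht => ?_
        rw [uIoc_of_le hy.2.le] at ht
        have ht0 : t ∈ Icc (0 : ℝ) 1 := ⟨hy.1.le.trans ht.1.le, ht.2.trans hx.2.le⟩
        have h3 := (abs_sinFour_le (W t)).trans (h.abs_le hk ht0)
        rw [abs_of_pos h1] at h3
        rw [norm_mul, norm_mul, norm_of_nonneg (sq_nonneg _), Real.norm_eq_abs, Real.norm_eq_abs,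
          abs_of_pos hk]
        have h4 : (1 - t ^ 2) ^ 2 ≤ 1 := by
          have := one_sub_sq_nonneg ht0
          nlinarith [sq_nonneg t]
        calc (1 - t ^ 2) ^ 2 * (k * |sinFour (W t)|) ≤ 1 * (k * W 1) := by gcongr
          _ = _ := one_mul _
      rw [Real.norm_eq_abs, abs_of_pos (sub_pos.2 hy.2)] at h2
      have h3 := (abs_le.1 h2).1
      have h4 : x < m / 8 := hxs.trans_le (min_le_left _ _)
      have h5 : k * W 1 * (x - y) ≤ k * W 1 * (m / 8) := by
        have := hy.1
        gcongr
        linarith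
      have h6 : 0 < k * W 1 * m := by positivity
      nlinarith
  subst hxz
  exact hpos

/-! ### Uniqueness and existence of positive half states -/

theorem fluxInt_sub {g h : ℝ → ℝ} (hg : ContinuousOn g (Icc 0 1)) (hh : ContinuousOn h (Icc 0 1))
    {x : ℝ} (hx : x ∈ Icc (0 : ℝ) 1) :
    fluxInt (fun t => g t - h t) x = fluxInt g x - fluxInt h x := by
  have := fluxInt_add (g := fun t => g t - h t) (hg.sub hh) hh hx
  simp only [sub_add_cancel] at this
  linarith

namespace IsHalfState

variable {k : ℝ} {W W' : ℝ → ℝ}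

theorem fluxInt_zero_pos (hk : 0 < k) (h : IsHalfState k W) (hpos : ∀ x ∈ Ioc (0 : ℝ) 1, 0 < W x) :
    0 < fluxInt (fun x => k * sinFour (W x)) 0 :=
  fluxInt_pos h.solves.cont_rhs ⟨le_rfl, one_pos⟩ fun t ht => mul_pos hk
    (sinFour_pos (hpos t ⟨ht.1, ht.2.le⟩) (h.lt_pi_div_four hk (Ioo_subset_Icc_self ht)))

/-- Positive half states are unique. -/
theorem eqOn_of_pos (hk : 0 < k) (h : IsHalfState k W) (h' : IsHalfState k W')
    (hpos : ∀ x ∈ Ioc (0 : ℝ) 1, 0 < W x) (hpos' : ∀ x ∈ Ioc (0 : ℝ) 1, 0 < W' x) :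
    EqOn W W' (Icc 0 1) := by
  have key : ∀ {W W' : ℝ → ℝ}, IsHalfState k W → IsHalfState k W' →
      (∀ x ∈ Ioc (0 : ℝ) 1, 0 < W x) → (∀ x ∈ Ioc (0 : ℝ) 1, 0 < W' x) → ¬ W 1 < W' 1 := by
    intro W W' h h' hpos hpos' hlt
    obtain ⟨x, hx, hx0, hD⟩ := exists_last_zero (h'.solves.sub h.solves).cont
      (by rw [h.zero, h'.zero, sub_zero]) (sub_pos.2 hlt)
    have hxI := Ico_subset_Icc_self hx
    have hWx : W' x = W x := sub_eq_zero.1 hx0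
    have hgr := h.solves.green h'.solves hxI
    have hWx0 : 0 ≤ W x := by
      rcases hx.1.eq_or_lt with h0 | h0
      · rw [← h0, h.zero]
      · exact (hpos x ⟨h0, hx.2.le⟩).le
    -- Just after `x` the second half state lies above the first, so at `x` its flux cannot be
    -- smaller. At `x = 0` the factor `W x` vanishes and no comparison is needed.
    have hfl : W x * (fluxInt (fun x => k * sinFour (W x)) x
        - fluxInt (fun x => k * sinFour (W' x)) x) ≤ 0 := by
      rcases hx.1.eq_or_lt with h0 | h0
      · rw [← h0, h.zero, zero_mul]
      refine mul_nonpos_of_nonneg_of_nonpos hWx0 ?_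
      by_contra hcon
      push Not at hcon
      have hxO : x ∈ Ioo (0 : ℝ) 1 := ⟨h0, hx.2⟩
      have hd := ((h'.solves.sub h.solves).hasDerivAt x hxO)
      have hneg : fluxInt (fun x => k * sinFour (W' x) - k * sinFour (W x)) x / (1 - x ^ 2) < 0 := by
        refine div_neg_of_neg_of_pos ?_ (one_sub_sq_pos hx)
        rw [fluxInt_sub h'.solves.cont_rhs h.solves.cont_rhs hxI]
        linarith
      have hev := hd.tendsto_slope.mono_left (nhdsWithin_mono x fun y (hy : y ∈ Ioi x) => hy.ne')
      have hev2 := hev.eventually (gt_mem_nhds hneg)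
      obtain ⟨y, hy, hyI⟩ := (hev2.and (Ioo_mem_nhdsGT hx.2)).exists
      rw [slope_def_field, hx0, sub_zero, div_neg_iff] at hy
      have h1 := hD y ⟨hyI.1, hyI.2.le⟩
      have h2 := hyI.1
      rcases hy with hy | hy <;> linarith
    have hc : ContinuousOn (fun t => (1 - t ^ 2) ^ 2 *
        (k * sinFour (W t) * W' t - W t * (k * sinFour (W' t)))) (Icc 0 1) :=
      continuousOn_weight_mul ((h.solves.cont_rhs.mul h'.solves.cont).sub
        (h.solves.cont.mul h'.solves.cont_rhs))
    have hI := intervalIntegral.intervalIntegral_pos_of_pos_on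
      (intervalIntegrable_unit hc hxI one_mem_unit) (fun t ht => ?_) hx.2
    · rw [hgr, hWx] at hI
      linarith
    · have ht0 : t ∈ Ioc (0 : ℝ) 1 := ⟨hx.1.trans_lt ht.1, ht.2.le⟩
      have h3 := sinFour_mul_lt (hpos t ht0) (sub_pos.1 (hD t ⟨ht.1, ht.2.le⟩))
        (h'.lt_pi_div_four hk (Ioc_subset_Icc_self ht0)).le
      refine mul_pos (pow_pos (one_sub_sq_pos ⟨ht0.1.le, ht.2⟩) 2) ?_
      nlinarith
  refine h.solves.eqOn_of_lipschitz abs_sinFour_sub_le h'.solves ?_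
  exact le_antisymm (not_lt.1 (key h' h hpos' hpos)) (not_lt.1 (key h h' hpos hpos'))

end IsHalfState

theorem abs_sub_le_of_solves_sinFour {W₁ W₂ : ℝ → ℝ} {k₁ k₂ : ℝ}
    (h₁ : Solves W₁ (fun x => k₁ * sinFour (W₁ x))) (h₂ : Solves W₂ (fun x => k₂ * sinFour (W₂ x)))
    {x : ℝ} (hx : x ∈ Icc (0 : ℝ) 1) :
    |W₁ x - W₂ x| ≤ 2 * (|W₁ 1 - W₂ 1| + |k₁ - k₂| * (1 / 4)) * exp (2 * (|k₂| + 1)) :=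
  h₁.abs_sub_le_of_lipschitz abs_sinFour_sub_le h₂ (fun _ _ => abs_sinFour_le_quarter _) x hx

/-- Beyond the principal eigenvalue there is a positive half state. -/
theorem IsPrincipal.exists_halfState {ν k : ℝ} {V : ℝ → ℝ} (hV : IsPrincipal ν V) (hk : ν < k) :
    ∃ W, IsHalfState k W ∧ ∀ x ∈ Ioc (0 : ℝ) 1, 0 < W x := by
  have hk0 : 0 < k := hV.pos.trans hk
  choose S hS hS1 using fun c => exists_solves abs_sinFour_sub_le k c
  have hratio : 0 < 1 - ν / k := by rw [sub_pos, div_lt_one hk0]; exact hk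
  -- For `0 < W ≤ c` this makes `k sinFour W > ν W`, since `sinFour W ≥ W - 8 W³`.
  obtain ⟨c, hc0, hc1, hc2⟩ : ∃ c, 0 < c ∧ c < π / 4 ∧ 8 * c ^ 2 < 1 - ν / k := by
    have h1 : ∀ᶠ c in 𝓝[>] (0 : ℝ), 8 * c ^ 2 < 1 - ν / k := by
      have : Tendsto (fun c : ℝ => 8 * c ^ 2) (𝓝 0) (𝓝 0) :=
        (by fun_prop : Continuous fun c : ℝ => 8 * c ^ 2).tendsto' _ _ (by simp)
      exact (this.eventually (gt_mem_nhds hratio)).filter_mono nhdsWithin_le_nhds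
    obtain ⟨c, h2, h3⟩ := (h1.and (Ioo_mem_nhdsGT (show (0 : ℝ) < π / 4 by positivity))).exists
    exact ⟨c, h3.1, h3.2, h2⟩
  -- The endpoint value is lowered from the equilibrium `π/4` to `c`.
  have hcont : ContinuousOn (Function.uncurry fun τ => S (π / 4 - τ))
      (Icc 0 (π / 4 - c) ×ˢ Icc 0 1) := by
    rintro ⟨τ, x⟩ ⟨hτ, hx⟩
    have h1 : Tendsto (fun q : ℝ × ℝ => S (π / 4 - τ) q.2)
        (𝓝[Icc 0 (π / 4 - c) ×ˢ Icc 0 1] (τ, x)) (𝓝 (S (π / 4 - τ) x)) :=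
      (hS _).cont.comp (f := Prod.snd) (s := Icc 0 (π / 4 - c) ×ˢ Icc 0 1)
        continuous_snd.continuousOn (fun q hq => hq.2) (τ, x) ⟨hτ, hx⟩
    have h2 : Tendsto (fun q : ℝ × ℝ => S (π / 4 - τ) q.2 - S (π / 4 - q.1) q.2)
        (𝓝[Icc 0 (π / 4 - c) ×ˢ Icc 0 1] (τ, x)) (𝓝 0) := by
      have h3 : Continuous fun q : ℝ × ℝ => 2 * |π / 4 - τ - (π / 4 - q.1)| *
          exp (2 * (|k| + 1)) := by fun_prop
      have h4 := (h3.tendsto (τ, x)).mono_left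
        (nhdsWithin_le_nhds (s := Icc 0 (π / 4 - c) ×ˢ Icc 0 1))
      simp only [sub_self, abs_zero, mul_zero, zero_mul] at h4
      refine squeeze_zero_norm' ?_ h4
      filter_upwards [self_mem_nhdsWithin] with q hq
      simpa [hS1] using abs_sub_le_of_solves_sinFour (hS (π / 4 - τ)) (hS (π / 4 - q.1)) hq.2
    have := h1.sub h2
    simpa [ContinuousWithinAt, Function.uncurry_def] using this
  have hstart : ∀ x ∈ Icc (0 : ℝ) 1, 0 < S (π / 4 - 0) x := by
    intro x hx
    have hconst : Solves (fun _ => π / 4) (fun _ => k * sinFour (π / 4)) :=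
      (Solves.const (π / 4)).congr_rhs fun _ _ => by
        rw [sinFour, show 4 * (π / 4) = π by ring, sin_pi]; simp
    have := (hS (π / 4 - 0)).eqOn_of_lipschitz abs_sinFour_sub_le hconst (by rw [hS1, sub_zero]) hx
    rw [this]
    positivity
  -- If `S c` stayed positive, Green's identity on `[0, 1]` would equate a positive integral with
  -- `-S(0)` times the positive flux of `V` at 0.
  have hend : ∃ x ∈ Icc (0 : ℝ) 1, S (π / 4 - (π / 4 - c)) x ≤ 0 := by
    rw [sub_sub_cancel]
    by_contra hcon
    push Not at hcon
    have hle : ∀ x ∈ Icc (0 : ℝ) 1, S c x ≤ c := by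
      intro x hx
      have := (le_abs_self _).trans ((hS c).abs_le_of_lt hk0
        (by rw [hS1, abs_of_pos hc0]; exact hc1) hx)
      rwa [hS1, abs_of_pos hc0] at this
    have hgr := (hS c).green hV.solves zero_mem_unit
    have hpos : 0 < ∫ t in (0 : ℝ)..1, (1 - t ^ 2) ^ 2 *
        (k * sinFour (S c t) * V t - S c t * (ν * V t)) := by
      refine intervalIntegral.intervalIntegral_pos_of_pos_on (intervalIntegrable_unit
        (continuousOn_weight_mul (((hS c).cont_rhs.mul hV.solves.cont).sub
          ((hS c).cont.mul hV.solves.cont_rhs))) zero_mem_unit one_mem_unit)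
        (fun t ht => mul_pos (pow_pos (one_sub_sq_pos (Ioo_subset_Ico_self ht)) 2) ?_) one_pos
      have htI := Ioo_subset_Icc_self ht
      have h1 := hcon t htI
      have h2 := hle t htI
      have h3 := (abs_le.1 (abs_sinFour_sub_id_le (S c t))).1
      rw [abs_of_pos h1] at h3
      have h4 : 8 * S c t ^ 2 < 1 - ν / k := by nlinarith
      have h5 : k * (8 * S c t ^ 2) < k - ν := by
        calc k * (8 * S c t ^ 2) < k * (1 - ν / k) := by gcongr
          _ = _ := by field_simp
      have h6 : 0 < k * sinFour (S c t) - ν * S c t := by nlinarith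
      have h7 := mul_pos h6 (hV.pos_of_pos t ⟨ht.1, ht.2.le⟩)
      nlinarith
    rw [hgr, hV.zero, mul_zero, zero_sub] at hpos
    have h1 := fluxInt_pos hV.solves.cont_rhs ⟨le_rfl, one_pos⟩ (x := 0) fun t ht =>
      mul_pos hV.pos (hV.pos_of_pos t ⟨ht.1, ht.2.le⟩)
    nlinarith [hcon 0 zero_mem_unit]
  obtain ⟨τ, hτ, hnonneg, ⟨x₀, hx₀, hx₀'⟩, -⟩ :=
    exists_first_touching (by linarith) hcont hstart hend
  set a := π / 4 - τ with ha
  have ha0 : 0 < a := by linarith [hτ.2]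
  have ha1 : a < π / 4 := by linarith [hτ.1]
  have hlt : ∀ x ∈ Icc (0 : ℝ) 1, S a x ≤ a := by
    intro x hx
    have := (le_abs_self _).trans ((hS a).abs_le_of_lt hk0
      (by rw [hS1, abs_of_pos ha0]; exact ha1) hx)
    rwa [hS1, abs_of_pos ha0] at this
  have hz : ∀ x ∈ Icc (0 : ℝ) 1, S a x = 0 → x = 0 := fun x hx h =>
    (hS a).eq_zero_of_nonneg hnonneg (by rw [hS1]; exact ha0)
      (fun y hy => by
        rcases (hnonneg y hy).eq_or_lt with h0 | h0
        · rw [← h0, sinFour_zero, mul_zero]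
        · exact mul_nonneg hk0.le (sinFour_pos h0 ((hlt y hy).trans_lt ha1)).le)
      (by rw [hS1]; exact mul_pos hk0 (sinFour_pos ha0 ha1)) hx h
  refine ⟨S a, ⟨hS a, ?_⟩, fun x hx => ?_⟩
  · rwa [hz x₀ hx₀ hx₀'] at hx₀'
  · exact (hnonneg x ⟨hx.1.le, hx.2⟩).lt_of_ne fun h => hx.1.ne' (hz x ⟨hx.1.le, hx.2⟩ h.symm)

/-- Half states in a parameter interval where they do not change sign: the positive one, its
negative, and zero. -/
theorem IsHalfState.eqOn_of_flux {k : ℝ} (hk : 0 < k)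
    (hsign : ∀ W, IsHalfState k W → 0 < W 1 → ∀ x ∈ Ioc (0 : ℝ) 1, 0 < W x) {W W' : ℝ → ℝ}
    (h : IsHalfState k W) (h' : IsHalfState k W')
    (hfl : 0 < fluxInt (fun x => k * sinFour (W x)) 0 ↔ 0 < fluxInt (fun x => k * sinFour (W' x)) 0)
    (hfl' : fluxInt (fun x => k * sinFour (W x)) 0 < 0 ↔
      fluxInt (fun x => k * sinFour (W' x)) 0 < 0) : EqOn W W' (Icc 0 1) := by
  have hposflux : ∀ {W : ℝ → ℝ}, IsHalfState k W → 0 < W 1 →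
      0 < fluxInt (fun x => k * sinFour (W x)) 0 := fun h h1 => h.fluxInt_zero_pos hk (hsign _ h h1)
  have hneg_eq : ∀ W : ℝ → ℝ, fluxInt (fun x => k * sinFour (-W x)) 0
      = -fluxInt (fun x => k * sinFour (W x)) 0 := by
    intro W
    have e : (fun x => k * sinFour (-W x)) = fun x => (-1) * (k * sinFour (W x)) := by
      ext x; rw [sinFour_neg]; ring
    rw [e, fluxInt_const_mul]; ring
  have hnegflux : ∀ {W : ℝ → ℝ}, IsHalfState k W → W 1 < 0 →
      fluxInt (fun x => k * sinFour (W x)) 0 < 0 := by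
    intro W h h1
    have := hposflux h.neg (neg_pos.2 h1)
    rw [hneg_eq] at this
    linarith
  have hzeroflux : ∀ {W : ℝ → ℝ}, IsHalfState k W → W 1 = 0 →
      fluxInt (fun x => k * sinFour (W x)) 0 = 0 := by
    intro W h h1
    rw [fluxInt_congr (h := fun _ => 0) zero_mem_unit fun t ht => by
      rw [h.eq_zero h1 ht, sinFour_zero, mul_zero]]
    simp [fluxInt]
  -- The sign of the flux at 0 is that of `W(1)`, so equal signs of the fluxes put both half states
  -- in the same one of the three classes.
  have htri : ∀ {W : ℝ → ℝ}, IsHalfState k W →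
      (0 < W 1 ∧ 0 < fluxInt (fun x => k * sinFour (W x)) 0) ∨
      (W 1 = 0 ∧ fluxInt (fun x => k * sinFour (W x)) 0 = 0) ∨
      (W 1 < 0 ∧ fluxInt (fun x => k * sinFour (W x)) 0 < 0) := by
    intro W h
    rcases lt_trichotomy (W 1) 0 with h1 | h1 | h1
    · exact Or.inr (Or.inr ⟨h1, hnegflux h h1⟩)
    · exact Or.inr (Or.inl ⟨h1, hzeroflux h h1⟩)
    · exact Or.inl ⟨h1, hposflux h h1⟩
  rcases htri h with ⟨a, b⟩ | ⟨a, b⟩ | ⟨a, b⟩ <;> rcases htri h' with ⟨c, d⟩ | ⟨c, d⟩ | ⟨c, d⟩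
  · exact h.eqOn_of_pos hk h' (hsign W h a) (hsign W' h' c)
  · exact absurd (hfl.1 b) (by rw [d]; exact lt_irrefl _)
  · exact absurd (hfl.1 b) d.not_gt
  · exact absurd (hfl.2 d) (by rw [b]; exact lt_irrefl _)
  · exact fun x hx => by rw [h.eq_zero a hx, h'.eq_zero c hx]
  · exact absurd (hfl'.2 d) (by rw [b]; exact lt_irrefl _)
  · exact absurd (hfl.2 d) b.not_gt
  · exact absurd (hfl'.1 b) (by rw [d]; exact lt_irrefl _)
  · have := h.neg.eqOn_of_pos hk h'.neg (hsign _ h.neg (neg_pos.2 a)) (hsign _ h'.neg (neg_pos.2 c))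
    exact fun x hx => neg_injective (this hx)

/-! ### Lyapunov–Schmidt reduction -/

theorem abs_fluxInt_zero_le {h : ℝ → ℝ} {G : ℝ} (hh : ContinuousOn h (Icc 0 1))
    (H : ∀ x ∈ Icc (0 : ℝ) 1, |h x| ≤ G) : |fluxInt h 0| ≤ G := by
  have h1 := abs_fluxInt_le hh zero_mem_unit
  have h2 := integral_le_of_le_unit hh.abs zero_mem_unit H
  norm_num at h1 h2
  exact h1.trans h2

/-- The amplitude of `W` along `v`: the coefficient of `v` in its orthogonal decomposition for the
weight `(1 - x²)²`. -/
noncomputable def amplitude (v W : ℝ → ℝ) : ℝ :=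
  fluxInt (fun x => v x * W x) 0 / fluxInt (fun x => v x ^ 2) 0

/-- An eigenfunction, extended continuously to `[0, 1]`, for a positive eigenvalue `ν`. -/
structure IsMode (ν : ℝ) (v : ℝ → ℝ) : Prop where
  pos : 0 < ν
  solves : Solves v (fun x => ν * v x)
  zero : v 0 = 0
  ne_zero : v 1 ≠ 0

/-- Half states of amplitude at most `ε` on the bifurcating branch, the bifurcation point
included. -/
structure IsSmall (ν ε k : ℝ) (W : ℝ → ℝ) : Prop where
  half : IsHalfState k W
  le : ν ≤ k
  param : k - ν ≤ 16 * ν * W 1 ^ 2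
  small : |W 1| ≤ ε

/-- The last bound serves to absorb terms of relative size `K ε²` into the left-hand side. -/
theorem exists_small (K : ℝ) (hK : 0 ≤ K) {ε₀ : ℝ} (h : 0 < ε₀) :
    ∃ ε, 0 < ε ∧ ε ≤ 1 / 4 ∧ ε ≤ ε₀ ∧ K * ε ^ 2 ≤ 1 / 2 := by
  refine ⟨min (1 / 4) (min ε₀ (1 / (2 * (K + 1)))), by positivity, min_le_left _ _,
    (min_le_right _ _).trans (min_le_left _ _), ?_⟩
  set ε := min (1 / 4) (min ε₀ (1 / (2 * (K + 1)))) with hε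
  have h0 : 0 < ε := by positivity
  have h1 : ε ≤ 1 / 4 := min_le_left _ _
  have h2 : ε ≤ 1 / (2 * (K + 1)) := (min_le_right _ _).trans (min_le_right _ _)
  rw [le_div_iff₀ (by positivity)] at h2
  nlinarith [mul_nonneg hK h0.le]

namespace IsMode

variable {ν : ℝ} {v : ℝ → ℝ}

theorem fluxInt_pow_pos (hv : IsMode ν v) {n : ℕ} (hn : Even n) :
    0 < fluxInt (fun x => v x ^ n) 0 := by
  have hc : ContinuousOn (fun x => v x ^ n) (Icc 0 1) := hv.solves.cont.pow n
  refine (fluxInt_nonneg zero_le_one fun t _ => hn.pow_nonneg _).lt_of_ne' fun h0 => ?_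
  have hev : ∀ᶠ y in 𝓝[Icc 0 1] (1 : ℝ), 0 < v y ^ n :=
    (hc 1 one_mem_unit).eventually (lt_mem_nhds (hn.pow_pos hv.ne_zero))
  have : (𝓝[Ioo 0 1] (1 : ℝ)).NeBot := by
    rw [← mem_closure_iff_nhdsWithin_neBot, closure_Ioo zero_ne_one]
    exact one_mem_unit
  obtain ⟨y, hy, hyI⟩ :=
    ((hev.filter_mono (nhdsWithin_mono _ Ioo_subset_Icc_self)).and self_mem_nhdsWithin).exists
  have hy' : 0 < (1 - y ^ 2) ^ 2 * v y ^ n :=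
    mul_pos (pow_pos (one_sub_sq_pos (Ioo_subset_Ico_self hyI)) 2) hy
  have := intervalIntegral.integral_lt_integral_of_continuousOn_of_le_of_exists_lt
    (f := fun _ => (0 : ℝ)) (g := fun t => (1 - t ^ 2) ^ 2 * v t ^ n) zero_lt_one continuousOn_const
    (continuousOn_weight_mul hc)
    (fun t _ => mul_nonneg (sq_nonneg _) (hn.pow_nonneg _))
    ⟨y, Ioo_subset_Icc_self hyI, hy'⟩
  rw [intervalIntegral.integral_zero] at this
  exact this.ne' h0

theorem norm_pos (hv : IsMode ν v) : 0 < fluxInt (fun x => v x ^ 2) 0 :=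
  hv.fluxInt_pow_pos even_two

theorem fluxInt_mul_eq (hv : IsMode ν v) (W : ℝ → ℝ) :
    fluxInt (fun x => v x * W x) 0 = amplitude v W * fluxInt (fun x => v x ^ 2) 0 :=
  (div_mul_cancel₀ _ hv.norm_pos.ne').symm

theorem fluxInt_orthogonal (hv : IsMode ν v) {W : ℝ → ℝ} (hW : ContinuousOn W (Icc 0 1)) {a : ℝ}
    (ha : a = amplitude v W) : fluxInt (fun x => v x * (W x - a * v x)) 0 = 0 := by
  have hc := hv.solves.cont
  have e : (fun x => v x * (W x - a * v x)) = fun x => v x * W x - a * v x ^ 2 := by ext; ring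
  rw [e, fluxInt_sub ?_ ?_ zero_mem_unit, fluxInt_const_mul, hv.fluxInt_mul_eq, ha, sub_self]
  all_goals fun_prop

theorem amplitude_sub (hv : IsMode ν v) {W W' : ℝ → ℝ} (hW : ContinuousOn W (Icc 0 1))
    (hW' : ContinuousOn W' (Icc 0 1)) :
    amplitude v (fun x => W x - W' x) = amplitude v W - amplitude v W' := by
  have hc := hv.solves.cont
  unfold amplitude
  simp only [mul_sub]
  rw [← sub_div, fluxInt_sub ?_ ?_ zero_mem_unit]
  all_goals fun_prop

theorem exists_bound (hv : IsMode ν v) : ∃ B, 0 < B ∧ ∀ x ∈ Icc (0 : ℝ) 1, |v x| ≤ B := by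
  obtain ⟨B, hB⟩ := isCompact_Icc.exists_bound_of_continuousOn hv.solves.cont
  exact ⟨B, (abs_pos.2 hv.ne_zero).trans_le (hB 1 one_mem_unit), hB⟩

/-- Bounded invertibility of the linearization on the orthogonal complement of the kernel. -/
theorem exists_inverse_bound (hv : IsMode ν v) : ∃ C, 0 < C ∧ ∀ (D g : ℝ → ℝ) (G : ℝ),
    Solves D (fun x => ν * D x + g x) → ContinuousOn g (Icc 0 1) →
    (∀ x ∈ Icc (0 : ℝ) 1, |g x| ≤ G) → fluxInt (fun x => v x * D x) 0 = 0 →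
    ∀ x ∈ Icc (0 : ℝ) 1, |D x| ≤ C * G := by
  obtain ⟨B, hB0, hB⟩ := hv.exists_bound
  have hN := hv.norm_pos
  set N := fluxInt (fun x => v x ^ 2) 0 with hN_def
  refine ⟨(B ^ 2 / N + 1) * (2 * exp (2 * ν)), by positivity, fun D g G hD hg hG horth => ?_⟩
  have hG0 : 0 ≤ G := (abs_nonneg _).trans (hG 0 zero_mem_unit)
  -- With this `q` the difference `D - q v` vanishes at 1, so Gronwall from the endpoint bounds it
  -- by `g` alone. Orthogonality to `v` then bounds `q`.
  set q := D 1 / v 1 with hq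
  have hE : Solves (fun x => D x - q * v x) (fun x => ν * (D x - q * v x) + g x) :=
    (hD.sub (hv.solves.const_mul q)).congr_rhs fun x _ => by ring
  have hE1 : D 1 - q * v 1 = 0 := by rw [hq, div_mul_cancel₀ _ hv.ne_zero, sub_self]
  have hEb : ∀ x ∈ Icc (0 : ℝ) 1, |D x - q * v x| ≤ 2 * G * exp (2 * ν) := by
    refine gronwall_unit hE.cont.abs hG0 hv.pos fun x hx => ?_
    have h1 := hE.abs_sub_le hx
    rw [hE1, sub_zero] at h1
    have h2 : ∫ t in x..1, |ν * (D t - q * v t) + g t|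
        ≤ ∫ t in x..1, (G + ν * |D t - q * v t|) := by
      refine intervalIntegral.integral_mono_on hx.2
        (intervalIntegrable_unit hE.cont_rhs.abs hx one_mem_unit)
        (intervalIntegrable_unit (continuousOn_const.add (continuousOn_const.mul hE.cont.abs))
          hx one_mem_unit) fun t ht => ?_
      have := hG t ⟨hx.1.trans ht.1, ht.2⟩
      refine (abs_add_le _ _).trans ?_
      rw [abs_mul, abs_of_pos hv.pos]
      linarith
    rw [intervalIntegral.integral_add (intervalIntegrable_unit continuousOn_const hx one_mem_unit)
      ((intervalIntegrable_unit hE.cont.abs hx one_mem_unit).const_mul _),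
      intervalIntegral.integral_const, intervalIntegral.integral_const_mul, smul_eq_mul] at h2
    have h3 : (1 - x) * G ≤ G := mul_le_of_le_one_left hG0 (by linarith [hx.1])
    linarith
  have hvE : ContinuousOn (fun x => v x * (D x - q * v x)) (Icc 0 1) := hv.solves.cont.mul hE.cont
  have hqN : q * N = -fluxInt (fun x => v x * (D x - q * v x)) 0 := by
    have e : (fun x => v x * D x) = fun x => q * v x ^ 2 + v x * (D x - q * v x) := by
      ext; ring
    have hvc := hv.solves.cont
    rw [e, fluxInt_add (by fun_prop) hvE zero_mem_unit, fluxInt_const_mul] at horth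
    linarith
  have hqb : |q| * N ≤ B * (2 * G * exp (2 * ν)) := by
    rw [← abs_of_pos hN, ← abs_mul, hqN, abs_neg]
    refine abs_fluxInt_zero_le hvE fun x hx => ?_
    rw [abs_mul]
    exact mul_le_mul (hB x hx) (hEb x hx) (abs_nonneg _) hB0.le
  rw [← le_div_iff₀ hN] at hqb
  intro x hx
  have h1 : |D x| ≤ |q| * |v x| + |D x - q * v x| := by
    have := abs_add_le (q * v x) (D x - q * v x)
    rwa [add_sub_cancel, abs_mul] at this
  calc |D x| ≤ |q| * |v x| + |D x - q * v x| := h1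
    _ ≤ B * (2 * G * exp (2 * ν)) / N * B + 2 * G * exp (2 * ν) := by
      gcongr
      exacts [hB x hx, hEb x hx]
    _ = _ := by field_simp

/-- The solvability condition for half states. -/
theorem solvability (hv : IsMode ν v) {k : ℝ} {W : ℝ → ℝ} (h : IsHalfState k W) :
    k * fluxInt (fun x => v x * sinFour (W x)) 0
      = ν * (amplitude v W * fluxInt (fun x => v x ^ 2) 0) := by
  have hgr := h.solves.green hv.solves zero_mem_unit
  rw [h.zero, hv.zero, mul_zero, zero_mul, sub_zero] at hgr
  have hWc := h.solves.cont
  have hvc := hv.solves.cont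
  rw [← hv.fluxInt_mul_eq, ← fluxInt_const_mul, ← fluxInt_const_mul, ← sub_eq_zero,
    ← fluxInt_sub ?_ ?_ zero_mem_unit, ← hgr, fluxInt]
  · congr 1
    ext t
    ring
  all_goals fun_prop

end IsMode

namespace IsSmall

variable {ν ε k : ℝ} {W : ℝ → ℝ}

theorem mono (h : IsSmall ν ε k W) {ε' : ℝ} (hε : ε ≤ ε') : IsSmall ν ε' k W :=
  ⟨h.half, h.le, h.param, h.small.trans hε⟩

theorem neg (h : IsSmall ν ε k W) : IsSmall ν ε k (fun x => -W x) :=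
  ⟨h.half.neg, h.le, by simpa using h.param, by simpa using h.small⟩

theorem sq_le (h : IsSmall ν ε k W) (hε : ε ≤ 1 / 4) : W 1 ^ 2 ≤ 1 / 16 := by
  have := h.small.trans hε
  rw [← sq_abs]
  nlinarith [abs_nonneg (W 1)]

theorem le_two_mul (h : IsSmall ν ε k W) (hν : 0 < ν) (hε : ε ≤ 1 / 4) : k ≤ 2 * ν := by
  have := h.param
  nlinarith [h.sq_le hε]

theorem abs_le (h : IsSmall ν ε k W) (hν : 0 < ν) {x : ℝ} (hx : x ∈ Icc (0 : ℝ) 1) :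
    |W x| ≤ |W 1| :=
  h.half.abs_le (hν.trans_le h.le) hx

end IsSmall

namespace IsMode

variable {ν : ℝ} {v : ℝ → ℝ}

/-- The remainder solves the linearized equation with right-hand side `(k - ν) sinFour W + ν
(sinFour W - W)` and is orthogonal to `v`. Both terms are cubic in `W(1)`, the first because `k - ν
≤ 16 ν W(1)²`; hence `24 = 16 + 8`. -/
theorem exists_remainder_bound (hv : IsMode ν v) : ∃ C, 0 < C ∧ ∀ k W, IsSmall ν (1 / 4) k W →
    ∀ x ∈ Icc (0 : ℝ) 1, |W x - amplitude v W * v x| ≤ C * |W 1| ^ 3 := by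
  obtain ⟨C, hC, hinv⟩ := hv.exists_inverse_bound
  have hν := hv.pos
  refine ⟨C * (24 * ν), by positivity, fun k W h x hx => ?_⟩
  have hWc := h.half.solves.cont
  have := hinv (fun x => W x - amplitude v W * v x) (fun x => k * sinFour (W x) - ν * W x)
    (24 * ν * |W 1| ^ 3)
    ((h.half.solves.sub (hv.solves.const_mul (amplitude v W))).congr_rhs fun x _ => by ring)
    (h.half.solves.cont_rhs.sub (continuousOn_const.mul hWc)) (fun y hy => ?_)
    (hv.fluxInt_orthogonal hWc rfl) x hx
  · linarith
  · have e : k * sinFour (W y) - ν * W y = (k - ν) * sinFour (W y) + ν * (sinFour (W y) - W y) := by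
      ring
    have h1 := h.abs_le hν hy
    have h2 := (abs_sinFour_le (W y)).trans h1
    have h3 := abs_sinFour_sub_id_le (W y)
    have h4 : |W y| ^ 3 ≤ |W 1| ^ 3 := by gcongr
    have h5 := sub_nonneg.2 h.le
    have h6 := h.param
    rw [e]
    calc _ ≤ |(k - ν) * sinFour (W y)| + |ν * (sinFour (W y) - W y)| := abs_add_le _ _
      _ = (k - ν) * |sinFour (W y)| + ν * |sinFour (W y) - W y| := by
        rw [abs_mul, abs_mul, abs_of_nonneg h5, abs_of_pos hν]
      _ ≤ 16 * ν * W 1 ^ 2 * |W 1| + ν * (8 * |W 1| ^ 3) := by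
        gcongr
        linarith
      _ = _ := by rw [← sq_abs]; ring

/-- At `x = 1` the remainder is cubic and is absorbed for small `W(1)`. The endpoint value and the
amplitude thus become interchangeable measures of size. -/
theorem exists_le_amplitude (hv : IsMode ν v) : ∃ ε C, 0 < ε ∧ ε ≤ 1 / 4 ∧ 0 < C ∧
    ∀ k W, IsSmall ν ε k W → |W 1| ≤ C * |amplitude v W| := by
  obtain ⟨K, hK, hrem⟩ := hv.exists_remainder_bound
  obtain ⟨ε, hε, hε4, -, hKε⟩ := exists_small K hK.le one_pos
  refine ⟨ε, 2 * |v 1|, hε, hε4, by have := abs_pos.2 hv.ne_zero; positivity, fun k W h => ?_⟩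
  have h1 := hrem k W (h.mono hε4) 1 one_mem_unit
  have h2 : |W 1| ≤ |amplitude v W| * |v 1| + |W 1 - amplitude v W * v 1| := by
    have := abs_add_le (amplitude v W * v 1) (W 1 - amplitude v W * v 1)
    rwa [add_sub_cancel, abs_mul] at this
  have h3 : K * |W 1| ^ 3 ≤ 1 / 2 * |W 1| := by
    have h4 : |W 1| ^ 2 ≤ ε ^ 2 := by have := h.small; gcongr
    calc K * |W 1| ^ 3 = K * |W 1| ^ 2 * |W 1| := by ring
      _ ≤ K * ε ^ 2 * |W 1| := by gcongr
      _ ≤ _ := by gcongr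
  linarith

theorem abs_amplitude_le (hv : IsMode ν v) : ∃ C, 0 < C ∧ ∀ (W : ℝ → ℝ) (c : ℝ),
    ContinuousOn W (Icc 0 1) → (∀ x ∈ Icc (0 : ℝ) 1, |W x| ≤ c) → |amplitude v W| ≤ C * c := by
  obtain ⟨B, hB0, hB⟩ := hv.exists_bound
  have hN := hv.norm_pos
  refine ⟨B / fluxInt (fun x => v x ^ 2) 0, by positivity, fun W c hW hc => ?_⟩
  rw [amplitude, abs_div, abs_of_pos hN, div_mul_eq_mul_div]
  gcongr
  refine abs_fluxInt_zero_le (hv.solves.cont.mul hW) fun x hx => ?_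
  rw [abs_mul]
  exact mul_le_mul (hB x hx) (hc x hx) (abs_nonneg _) hB0.le

/-- The quadratic expansion of `μ² - μ₀²` along the branch. -/
theorem exists_normal_form (hv : IsMode ν v) : ∃ ε C, 0 < ε ∧ ε ≤ 1 / 4 ∧ 0 < C ∧
    ∀ k W, IsSmall ν ε k W →
      |1 / k - 1 / ν - -(8 / 3) * (1 / ν) * (fluxInt (fun x => v x ^ 4) 0
        / fluxInt (fun x => v x ^ 2) 0) * amplitude v W ^ 2| ≤ C * amplitude v W ^ 4 ∧
      ∀ x ∈ Icc (0 : ℝ) 1, |W x - amplitude v W * v x| ≤ C * |amplitude v W| ^ 3 := by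
  obtain ⟨K, hK, hrem⟩ := hv.exists_remainder_bound
  obtain ⟨ε, A, hε, hε4, hA, hamp⟩ := hv.exists_le_amplitude
  obtain ⟨B, hB0, hB⟩ := hv.exists_bound
  have hν := hv.pos
  have hN := hv.norm_pos
  set N := fluxInt (fun x => v x ^ 2) 0 with hN_def
  set P := B * (3 + 8 / 3 * (3 * K * (1 + K) ^ 2)) with hP_def
  have hP : 0 < P := by positivity
  refine ⟨ε, P * A ^ 5 / (N * ν) + K * A ^ 3, hε, hε4, by positivity, fun k W h => ?_⟩
  have hWc := h.half.solves.cont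
  have hvc := hv.solves.cont
  have hfc : ContinuousOn (fun x => sinFour (W x)) (Icc 0 1) :=
    continuous_sinFour.comp_continuousOn hWc
  have hk : 0 < k := hν.trans_le h.le
  have hs := hv.solvability h.half
  set a := amplitude v W with ha_def
  have hcA : |W 1| ≤ A * |a| := hamp k W h
  have hW14 : |W 1| ≤ 1 / 4 := h.small.trans hε4
  have hr := hrem k W (h.mono hε4)
  refine ⟨?_, fun x hx => ?_⟩
  -- The argument below divides by `a`. If `a = 0`, then `W(1) = 0` and so `k = ν`.
  · rcases eq_or_ne a 0 with ha | ha
    · have h1 : W 1 = 0 := by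
        rw [ha, abs_zero, mul_zero] at hcA
        exact abs_nonpos_iff.1 hcA
      have h2 : k = ν := le_antisymm (by have := h.param; rw [h1] at this; linarith) h.le
      simp [ha, h2]
    -- This is the solvability condition divided by `k`, with the leading cubic term added to both
    -- sides. The right-hand side is of fifth order, and dividing by `a` leaves fourth order.
    have hmain : (1 / k - 1 / ν - -(8 / 3) * (1 / ν) * (fluxInt (fun x => v x ^ 4) 0 / N) * a ^ 2)
        * (a * N * ν) = fluxInt (fun x => v x * (sinFour (W x) - W x + 8 / 3 * (a * v x) ^ 3)) 0 := by
      have e : (fun x => v x * (sinFour (W x) - W x + 8 / 3 * (a * v x) ^ 3))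
          = fun x => (v x * sinFour (W x) - v x * W x) + 8 / 3 * a ^ 3 * v x ^ 4 := by ext; ring
      have e2 : fluxInt (fun x => v x * sinFour (W x)) 0 = ν * (a * N) / k := by
        rw [eq_div_iff hk.ne', ← hs]; ring
      rw [e, fluxInt_add ?_ ?_ zero_mem_unit, fluxInt_sub ?_ ?_ zero_mem_unit, fluxInt_const_mul,
        e2, hv.fluxInt_mul_eq W, ← hN_def, ← ha_def]
      · field_simp
        ring
      all_goals fun_prop
    have hbound : |fluxInt (fun x => v x * (sinFour (W x) - W x + 8 / 3 * (a * v x) ^ 3)) 0|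
        ≤ P * |W 1| ^ 5 := by
      refine abs_fluxInt_zero_le (hvc.mul ((hfc.sub hWc).add (continuousOn_const.mul
        ((continuousOn_const.mul hvc).pow 3)))) fun x hx => ?_
      have h1 := h.abs_le hν hx
      have h2 := abs_sinFour_taylor_le (h1.trans hW14)
      have h3 := hr x hx
      have h4 : |a * v x| ≤ (1 + K) * |W 1| := by
        have h5 : |a * v x| ≤ |W x| + |W x - a * v x| := by
          have := abs_sub (W x) (W x - a * v x)
          rwa [sub_sub_cancel] at this
        have h6 : |W 1| ^ 3 ≤ |W 1| := by
          have : |W 1| ^ 2 ≤ 1 := pow_le_one₀ (abs_nonneg _) (by linarith)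
          nlinarith [abs_nonneg (W 1)]
        nlinarith
      have h7 : |(a * v x) ^ 3 - W x ^ 3| ≤ 3 * K * (1 + K) ^ 2 * |W 1| ^ 5 := by
        have e : (a * v x) ^ 3 - W x ^ 3
            = -((W x - a * v x) * ((a * v x) ^ 2 + a * v x * W x + W x ^ 2)) := by ring
        have h8 : |W x| ≤ (1 + K) * |W 1| := h1.trans (by nlinarith [abs_nonneg (W 1)])
        rw [e, abs_neg, abs_mul]
        have h9 : |(a * v x) ^ 2 + a * v x * W x + W x ^ 2|
            ≤ ((1 + K) * |W 1|) ^ 2 + (1 + K) * |W 1| * ((1 + K) * |W 1|)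
              + ((1 + K) * |W 1|) ^ 2 := by
          refine (abs_add_le _ _).trans (add_le_add ((abs_add_le _ _).trans
            (add_le_add ?_ ?_)) ?_)
          · rw [abs_pow]; gcongr
          · rw [abs_mul]; gcongr
          · rw [abs_pow]; gcongr
        calc _ ≤ K * |W 1| ^ 3 * (((1 + K) * |W 1|) ^ 2 + (1 + K) * |W 1| * ((1 + K) * |W 1|)
              + ((1 + K) * |W 1|) ^ 2) := by gcongr
          _ = _ := by ring
      have e : sinFour (W x) - W x + 8 / 3 * (a * v x) ^ 3
          = (sinFour (W x) - W x + 8 / 3 * W x ^ 3) + 8 / 3 * ((a * v x) ^ 3 - W x ^ 3) := by ring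
      rw [e, abs_mul]
      have h10 : |W x| ^ 5 ≤ |W 1| ^ 5 := by gcongr
      have h11 : |(sinFour (W x) - W x + 8 / 3 * W x ^ 3) + 8 / 3 * ((a * v x) ^ 3 - W x ^ 3)|
          ≤ (3 + 8 / 3 * (3 * K * (1 + K) ^ 2)) * |W 1| ^ 5 := by
        refine (abs_add_le _ _).trans ?_
        rw [abs_mul (8 / 3), abs_of_pos (by norm_num : (0 : ℝ) < 8 / 3)]
        linarith
      calc _ ≤ B * ((3 + 8 / 3 * (3 * K * (1 + K) ^ 2)) * |W 1| ^ 5) := by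
            gcongr
            exact hB x hx
        _ = _ := by rw [hP_def]; ring
    rw [← hmain, abs_mul, abs_mul, abs_mul, abs_of_pos hN, abs_of_pos hν] at hbound
    have ha' : 0 < |a| := abs_pos.2 ha
    have h12 : P * |W 1| ^ 5 ≤ P * (A * |a|) ^ 5 := by gcongr
    have h13 := hbound.trans h12
    have e4 : a ^ 4 = |a| ^ 4 := by rw [← abs_pow, abs_of_nonneg (by positivity)]
    have h14 : |1 / k - 1 / ν - -(8 / 3) * (1 / ν) * (fluxInt (fun x => v x ^ 4) 0 / N) * a ^ 2|
        ≤ P * A ^ 5 / (N * ν) * |a| ^ 4 := by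
      rw [← mul_le_mul_iff_left₀ (show 0 < |a| * N * ν by positivity)]
      refine h13.trans_eq ?_
      field_simp
    rw [e4]
    refine h14.trans ?_
    gcongr
    have : 0 < K * A ^ 3 := by positivity
    linarith
  · calc _ ≤ K * |W 1| ^ 3 := hr x hx
      _ ≤ K * (A * |a|) ^ 3 := by gcongr
      _ = K * A ^ 3 * |a| ^ 3 := by ring
      _ ≤ _ := by
        gcongr
        have : 0 < P * A ^ 5 / (N * ν) := by positivity
        linarith

set_option maxHeartbeats 1000000 in
/-- Small half states depend in a Lipschitz way on their amplitude. -/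
theorem exists_lipschitz (hv : IsMode ν v) : ∃ ε C, 0 < ε ∧ ε ≤ 1 / 4 ∧ 0 < C ∧
    ∀ k₁ W₁ k₂ W₂, IsSmall ν ε k₁ W₁ → IsSmall ν ε k₂ W₂ →
      |k₁ - k₂| ≤ C * |amplitude v W₁ - amplitude v W₂| ∧
      ∀ x ∈ Icc (0 : ℝ) 1, |W₁ x - W₂ x| ≤ C * |amplitude v W₁ - amplitude v W₂| := by
  obtain ⟨K, hK, hinv⟩ := hv.exists_inverse_bound
  obtain ⟨ε₀, A, hε₀, hε₀4, hA, hamp⟩ := hv.exists_le_amplitude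
  obtain ⟨B, hB0, hB⟩ := hv.exists_bound
  have hν := hv.pos
  have hN := hv.norm_pos
  set N := fluxInt (fun x => v x ^ 2) 0 with hN_def
  set Q := 2 * A / N * (16 * ν) with hQ_def
  have hQ : 0 < Q := by positivity
  obtain ⟨ε, hε, hε4, hεε₀, hεK⟩ := exists_small (K * (Q * B + 32 * ν)) (by positivity) hε₀
  set L := 2 * (B + K * (Q * N)) with hL_def
  have hL : 0 < L := by positivity
  refine ⟨ε, L + Q * (N + B * L), hε, hε4, by positivity, ?_⟩
  -- Here `W₁` has the larger amplitude, so the common bound `c` of both half states is at most `A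
  -- |a₁|`. This keeps the coefficient `F` of `k₁ - k₂` at least of order `c`.
  have key : ∀ k₁ W₁ k₂ W₂, IsSmall ν ε k₁ W₁ → IsSmall ν ε k₂ W₂ →
      |amplitude v W₂| ≤ |amplitude v W₁| →
      |k₁ - k₂| ≤ (L + Q * (N + B * L)) * |amplitude v W₁ - amplitude v W₂| ∧
      ∀ x ∈ Icc (0 : ℝ) 1,
        |W₁ x - W₂ x| ≤ (L + Q * (N + B * L)) * |amplitude v W₁ - amplitude v W₂| := by
    intro k₁ W₁ k₂ W₂ h₁ h₂ hle
    have hc1 := h₁.half.solves.cont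
    have hc2 := h₂.half.solves.cont
    have hvc := hv.solves.cont
    have hf1 : ContinuousOn (fun x => sinFour (W₁ x)) (Icc 0 1) :=
      continuous_sinFour.comp_continuousOn hc1
    have hf2 : ContinuousOn (fun x => sinFour (W₂ x)) (Icc 0 1) :=
      continuous_sinFour.comp_continuousOn hc2
    have hs1 := hv.solvability h₁.half
    have hs2 := hv.solvability h₂.half
    have hA1 := hamp k₁ W₁ (h₁.mono hεε₀)
    have hA2 := hamp k₂ W₂ (h₂.mono hεε₀)
    have hk1 : 0 < k₁ := hν.trans_le h₁.le
    have hk2 : 0 < k₂ := hν.trans_le h₂.le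
    have hk1' := h₁.le_two_mul hν hε4
    have hk2' := h₂.le_two_mul hν hε4
    set a₁ := amplitude v W₁ with ha₁
    set a₂ := amplitude v W₂ with ha₂
    set c := max |W₁ 1| |W₂ 1| with hc_def
    have hc0 : 0 ≤ c := (abs_nonneg _).trans (le_max_left _ _)
    have hcε : c ≤ ε := max_le h₁.small h₂.small
    have hcA : c ≤ A * |a₁| := max_le hA1 (hA2.trans (by gcongr))
    have hp2 : k₂ - ν ≤ 16 * ν * c ^ 2 := by
      refine h₂.param.trans ?_
      rw [← sq_abs]
      gcongr
      exact le_max_right _ _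
    have hW1 : ∀ x ∈ Icc (0 : ℝ) 1, |W₁ x| ≤ c := fun x hx =>
      (h₁.abs_le hν hx).trans (le_max_left _ _)
    have hW2 : ∀ x ∈ Icc (0 : ℝ) 1, |W₂ x| ≤ c := fun x hx =>
      (h₂.abs_le hν hx).trans (le_max_right _ _)
    obtain ⟨m, hm, hmax⟩ := isCompact_Icc.exists_isMaxOn (nonempty_Icc.2 zero_le_one)
      (hc1.sub hc2).abs
    set Δ := |W₁ m - W₂ m| with hΔ_def
    have hΔ : ∀ x ∈ Icc (0 : ℝ) 1, |W₁ x - W₂ x| ≤ Δ := fun x hx => hmax hx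
    have hΔ0 : 0 ≤ Δ := abs_nonneg _
    set d := |a₁ - a₂| with hd_def
    have hd0 : 0 ≤ d := abs_nonneg _
    have hh : ∀ x ∈ Icc (0 : ℝ) 1,
        |(sinFour (W₁ x) - W₁ x) - (sinFour (W₂ x) - W₂ x)| ≤ 8 * c ^ 2 * Δ := fun x hx =>
      (abs_sinFour_sub_id_sub_le (hW1 x hx) (hW2 x hx)).trans
        (mul_le_mul_of_nonneg_left (hΔ x hx) (by positivity))
    -- Subtracting the two solvability conditions isolates `(k₁ - k₂) F`. All other terms carry a
    -- factor `c²`: one through `k₂ - ν`, the other through the cubic nature of `sinFour W - W`.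
    have hkc : |k₁ - k₂| * c ≤ c ^ 2 * (Q * (N * d + B * Δ)) := by
      set F := fluxInt (fun x => v x * sinFour (W₁ x)) 0 with hF_def
      have hR : (k₁ - k₂) * F = (ν - k₂) * ((a₁ - a₂) * N) - k₂ * fluxInt (fun x => v x *
          ((sinFour (W₁ x) - W₁ x) - (sinFour (W₂ x) - W₂ x))) 0 := by
        have e : (fun x => v x * ((sinFour (W₁ x) - W₁ x) - (sinFour (W₂ x) - W₂ x)))
          = fun x => (v x * sinFour (W₁ x) - v x * W₁ x)
            - (v x * sinFour (W₂ x) - v x * W₂ x) := by ext; ring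
        rw [e, fluxInt_sub ?_ ?_ zero_mem_unit, fluxInt_sub ?_ ?_ zero_mem_unit,
          fluxInt_sub ?_ ?_ zero_mem_unit, hv.fluxInt_mul_eq W₁, hv.fluxInt_mul_eq W₂, ← ha₁, ← ha₂]
        · linear_combination hs1 - hs2
        all_goals fun_prop
      have hR2 : |fluxInt (fun x => v x *
          ((sinFour (W₁ x) - W₁ x) - (sinFour (W₂ x) - W₂ x))) 0| ≤ B * (8 * c ^ 2 * Δ) := by
        refine abs_fluxInt_zero_le (hvc.mul ((hf1.sub hc1).sub (hf2.sub hc2))) fun x hx => ?_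
        rw [abs_mul]
        exact mul_le_mul (hB x hx) (hh x hx) (abs_nonneg _) hB0.le
      have hR3 : |k₁ - k₂| * |F| ≤ 16 * ν * c ^ 2 * (d * N) + 2 * ν * (B * (8 * c ^ 2 * Δ)) := by
        rw [← abs_mul, hR]
        refine (abs_sub _ _).trans ?_
        rw [abs_mul, abs_mul, abs_mul, abs_of_pos hN, abs_of_pos hk2, abs_sub_comm ν,
          abs_of_nonneg (sub_nonneg.2 h₂.le)]
        gcongr
      have hF : |a₁| * N ≤ 2 * |F| := by
        have h3 : k₁ * |F| = ν * (|a₁| * N) := by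
          have := congrArg abs hs1
          rwa [abs_mul, abs_mul, abs_mul, abs_of_pos hk1, abs_of_pos hν, abs_of_pos hN] at this
        have h4 : ν * (|a₁| * N) ≤ ν * (2 * |F|) := by
          rw [← h3]
          nlinarith [abs_nonneg F]
        exact le_of_mul_le_mul_left h4 hν
      have hcF : c ≤ 2 * A / N * |F| := by
        rw [div_mul_eq_mul_div, le_div_iff₀ hN]
        nlinarith
      calc |k₁ - k₂| * c ≤ |k₁ - k₂| * (2 * A / N * |F|) := by gcongr
        _ = 2 * A / N * (|k₁ - k₂| * |F|) := by ring
        _ ≤ 2 * A / N * (16 * ν * c ^ 2 * (d * N) + 2 * ν * (B * (8 * c ^ 2 * Δ))) := by gcongr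
        _ = _ := by rw [hQ_def]; ring
    have hD : ∀ x ∈ Icc (0 : ℝ) 1, |W₁ x - W₂ x - (a₁ - a₂) * v x|
        ≤ K * (|k₁ - k₂| * c + 32 * ν * c ^ 2 * Δ) := by
      refine hinv _ (fun x => k₁ * sinFour (W₁ x) - k₂ * sinFour (W₂ x) - ν * (W₁ x - W₂ x)) _
        (((h₁.half.solves.sub h₂.half.solves).sub (hv.solves.const_mul (a₁ - a₂))).congr_rhs
          fun x _ => by ring)
        ((h₁.half.solves.cont_rhs.sub h₂.half.solves.cont_rhs).sub
          (continuousOn_const.mul (hc1.sub hc2))) (fun x hx => ?_)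
        (hv.fluxInt_orthogonal (hc1.sub hc2) (hv.amplitude_sub hc1 hc2).symm)
      have e : k₁ * sinFour (W₁ x) - k₂ * sinFour (W₂ x) - ν * (W₁ x - W₂ x)
          = (k₁ - k₂) * sinFour (W₁ x)
            + k₂ * ((sinFour (W₁ x) - W₁ x) - (sinFour (W₂ x) - W₂ x))
            + (k₂ - ν) * (W₁ x - W₂ x) := by ring
      rw [e]
      calc _ ≤ |(k₁ - k₂) * sinFour (W₁ x)|
            + |k₂ * ((sinFour (W₁ x) - W₁ x) - (sinFour (W₂ x) - W₂ x))|
            + |(k₂ - ν) * (W₁ x - W₂ x)| :=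
          (abs_add_le _ _).trans (by gcongr; exact abs_add_le _ _)
        _ = |k₁ - k₂| * |sinFour (W₁ x)|
            + k₂ * |(sinFour (W₁ x) - W₁ x) - (sinFour (W₂ x) - W₂ x)|
            + (k₂ - ν) * |W₁ x - W₂ x| := by
          rw [abs_mul, abs_mul, abs_mul, abs_of_pos hk2, abs_of_nonneg (sub_nonneg.2 h₂.le)]
        _ ≤ |k₁ - k₂| * c + 2 * ν * (8 * c ^ 2 * Δ) + 16 * ν * c ^ 2 * Δ := by
          have h3 := (abs_sinFour_le (W₁ x)).trans (hW1 x hx)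
          have h4 := hh x hx
          have h5 := hΔ x hx
          gcongr
        _ = _ := by ring
    have hc2ε : c ^ 2 ≤ ε ^ 2 := by gcongr
    have hc21 : c ^ 2 ≤ 1 := hc2ε.trans (pow_le_one₀ hε.le (by linarith))
    -- By `hkc`, the terms in `Δ` on the right have total coefficient at most `K (Q B + 32 ν) ε² ≤
    -- 1/2` and are absorbed.
    have hΔL : Δ ≤ L * d := by
      have h3 : Δ ≤ d * B + |W₁ m - W₂ m - (a₁ - a₂) * v m| := by
        have h4 := abs_add_le ((a₁ - a₂) * v m) (W₁ m - W₂ m - (a₁ - a₂) * v m)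
        rw [add_sub_cancel, abs_mul] at h4
        refine h4.trans ?_
        gcongr
        exact hB m hm
      have h4 := hD m hm
      have h5 : K * (|k₁ - k₂| * c + 32 * ν * c ^ 2 * Δ)
          ≤ K * (Q * N) * d + 1 / 2 * Δ := by
        calc _ ≤ K * (c ^ 2 * (Q * (N * d + B * Δ)) + 32 * ν * c ^ 2 * Δ) := by gcongr
          _ = c ^ 2 * (K * (Q * N) * d) + K * (Q * B + 32 * ν) * c ^ 2 * Δ := by ring
          _ ≤ 1 * (K * (Q * N) * d) + K * (Q * B + 32 * ν) * ε ^ 2 * Δ := by gcongr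
          _ ≤ _ := by
            rw [one_mul]
            gcongr
      rw [hL_def]
      linarith
    have hQL : 0 ≤ Q * (N + B * L) * d := by positivity
    refine ⟨?_, fun x hx => ?_⟩
    -- If `c = 0`, both parameters equal `ν`; otherwise one factor `c` cancels in `hkc`.
    · rcases hc0.eq_or_lt with hc | hc
      · have h3 : ∀ {k W}, IsSmall ν ε k W → |W 1| ≤ c → k = ν := by
          intro k W h h4
          rw [← hc] at h4
          refine le_antisymm ?_ h.le
          have := h.param
          rw [abs_nonpos_iff.1 h4] at this
          linarith
        rw [h3 h₁ (le_max_left _ _), h3 h₂ (le_max_right _ _), sub_self, abs_zero]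
        positivity
      · have h3 : |k₁ - k₂| * c ≤ c * (Q * (N * d + B * Δ)) * c := hkc.trans_eq (by ring)
        have h4 := le_of_mul_le_mul_right h3 hc
        have h5 : c * (Q * (N * d + B * Δ)) ≤ 1 * (Q * (N * d + B * (L * d))) := by
          gcongr
          linarith
        have h6 : 0 ≤ L * d := by positivity
        linarith
    · have := hΔ x hx
      linarith
  intro k₁ W₁ k₂ W₂ h₁ h₂
  rcases le_total |amplitude v W₂| |amplitude v W₁| with h | h
  · exact key k₁ W₁ k₂ W₂ h₁ h₂ h
  · have := key k₂ W₂ k₁ W₁ h₂ h₁ h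
    simpa only [abs_sub_comm k₂, abs_sub_comm (W₂ _), abs_sub_comm (amplitude v W₂)] using this

end IsMode

/-! ### Continuation in `k`: every small amplitude occurs -/

/-- The supercritical direction of the bifurcation, quantitatively. -/
theorem IsHalfState.param_le {k ν : ℝ} {W V : ℝ → ℝ} (h : IsHalfState k W) (hV : IsPrincipal ν V)
    (hk : ν < k) (hk' : k ≤ 2 * ν) (hpos : ∀ x ∈ Ioc (0 : ℝ) 1, 0 < W x) :
    k - ν ≤ 16 * ν * W 1 ^ 2 := by
  have hν := hV.pos
  have hk0 : 0 < k := hν.trans hk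
  by_contra hcon
  push Not at hcon
  have hgr := h.solves.green hV.solves zero_mem_unit
  rw [h.zero, hV.zero, mul_zero, zero_mul, sub_zero] at hgr
  have hI : 0 < ∫ t in (0 : ℝ)..1, (1 - t ^ 2) ^ 2 *
      (k * sinFour (W t) * V t - W t * (ν * V t)) := by
    refine intervalIntegral.intervalIntegral_pos_of_pos_on (intervalIntegrable_unit
      (continuousOn_weight_mul ((h.solves.cont_rhs.mul hV.solves.cont).sub
        (h.solves.cont.mul hV.solves.cont_rhs))) zero_mem_unit one_mem_unit)
      (fun t ht => mul_pos (pow_pos (one_sub_sq_pos (Ioo_subset_Ico_self ht)) 2) ?_) one_pos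
    have h1 := hpos t ⟨ht.1, ht.2.le⟩
    have h2 := h.abs_le hk0 (Ioo_subset_Icc_self ht)
    rw [abs_of_pos h1, abs_of_pos (hpos 1 ⟨one_pos, le_rfl⟩)] at h2
    have h3 := (_root_.abs_le.1 (abs_sinFour_sub_id_le (W t))).1
    rw [abs_of_pos h1] at h3
    have h4 : W t ^ 2 ≤ W 1 ^ 2 := by gcongr
    -- The constant 16 arises here: `8 k W² ≤ 16 ν W(1)²` because `k ≤ 2ν`.
    have h5 : k * (8 * W t ^ 2) < k - ν := by nlinarith [sq_nonneg (W t)]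
    have h6 : 0 < k * sinFour (W t) - ν * W t := by nlinarith
    have h7 := mul_pos h6 (hV.pos_of_pos t ⟨ht.1, ht.2.le⟩)
    nlinarith
  rw [hgr] at hI
  exact lt_irrefl _ hI

theorem IsPrincipal.exists_region {ν : ℝ} {V : ℝ → ℝ} (hV : IsPrincipal ν V) {ε : ℝ} (hε : 0 < ε) :
    ∃ r, 0 < r ∧ r ≤ ν ∧
      (∀ k ∈ Ioo ν (ν + r), ∀ W, IsHalfState k W → 0 < W 1 → ∀ x ∈ Ioc (0 : ℝ) 1, 0 < W x) ∧
      ∀ k ∈ Ioo ν (ν + r), ∀ W, IsHalfState k W → W 1 ≠ 0 → IsSmall ν ε k W := by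
  obtain ⟨r₀, hr₀, hr₀ν, hpos⟩ := hV.exists_pos
  obtain ⟨C, hC, hamp⟩ := hV.exists_amplitude_bound
  refine ⟨min r₀ (ε ^ 2 / C), by positivity, (min_le_left _ _).trans hr₀ν, fun k hk =>
    hpos k ⟨hk.1, hk.2.trans_le (by gcongr; exact min_le_left _ _)⟩, fun k hk W h h1 => ?_⟩
  have hk1 : k < ν + r₀ := hk.2.trans_le (by gcongr; exact min_le_left _ _)
  have hk2 : k - ν < ε ^ 2 / C := by linarith [hk.2, min_le_right r₀ (ε ^ 2 / C)]
  have hk2ν : k ≤ 2 * ν := by linarith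
  rw [lt_div_iff₀ hC] at hk2
  refine ⟨h, hk.1.le, ?_, ?_⟩
  · rcases h1.lt_or_gt with h1 | h1
    · simpa using h.neg.param_le hV hk.1 hk2ν (hpos k ⟨hk.1, hk1⟩ _ h.neg (neg_pos.2 h1))
    · exact h.param_le hV hk.1 hk2ν (hpos k ⟨hk.1, hk1⟩ _ h h1)
  · refine abs_le_of_sq_le_sq ?_ hε.le
    linarith [hamp k ⟨hk.1, hk2ν⟩ W h]

/-- Every small amplitude is attained on the branch. -/
theorem IsMode.exists_of_amplitude {ν : ℝ} {V v : ℝ → ℝ} (hv : IsMode ν v) (hV : IsPrincipal ν V)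
    {ε r : ℝ} (hε : 0 < ε) (hr : 0 < r) :
    ∃ a₀, 0 < a₀ ∧ ∀ a, |a| < a₀ → ∃ k W, IsSmall ν ε k W ∧ k < ν + r ∧ amplitude v W = a := by
  obtain ⟨ε₁, A, hε₁, -, hA, hampA⟩ := hv.exists_le_amplitude
  obtain ⟨r₁, hr₁, hr₁ν, hsign, hsmall⟩ := hV.exists_region (lt_min hε hε₁)
  obtain ⟨C, hC, hamp⟩ := hV.exists_amplitude_bound
  obtain ⟨B, hB, hBamp⟩ := hv.abs_amplitude_le
  have hν := hV.pos
  set R := min r r₁ with hR_def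
  have hR : 0 < R := lt_min hr hr₁
  have hRr : ∀ k ∈ Ioo ν (ν + R), k ∈ Ioo ν (ν + r₁) := fun k hk =>
    ⟨hk.1, hk.2.trans_le (by gcongr; exact min_le_right _ _)⟩
  have hex : ∀ k, ∃ W, ν < k → IsHalfState k W ∧ ∀ x ∈ Ioc (0 : ℝ) 1, 0 < W x := by
    intro k
    by_cases hk : ν < k
    · obtain ⟨W, hW⟩ := hV.exists_halfState hk
      exact ⟨W, fun _ => hW⟩
    · exact ⟨0, fun h => absurd h hk⟩
  choose W hW using hex
  have hW1 : ∀ k, ν < k → 0 < W k 1 := fun k hk => (hW k hk).2 1 ⟨one_pos, le_rfl⟩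
  have hWs : ∀ k ∈ Ioo ν (ν + R), IsSmall ν (min ε ε₁) k (W k) := fun k hk =>
    hsmall k (hRr k hk) _ (hW k hk.1).1 (hW1 k hk.1).ne'
  -- Continuity of the endpoint value by compactness. Near `k₀` the values stay in a compact
  -- interval away from 0 (by `param`); a cluster value shoots to a half state at `k₀` with positive
  -- endpoint value, which is positive by `hsign` and therefore unique.
  have hend : ∀ k ∈ Ioo ν (ν + R), Tendsto (fun k => W k 1) (𝓝 k) (𝓝 (W k 1)) := by
    intro k₀ hk₀
    have hk₀ν := sub_pos.2 hk₀.1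
    have hκ : 0 < (k₀ - ν) / (32 * ν) := by positivity
    refine (isCompact_Icc (a := √((k₀ - ν) / (32 * ν))) (b := π / 4)
      ).tendsto_nhds_of_unique_mapClusterPt ?_ fun y hy hcl => ?_
    · filter_upwards [Ioo_mem_nhds (show (ν + k₀) / 2 < k₀ by linarith) hk₀.2] with k hk
      have hkν : ν < k := by linarith [hk.1]
      have h1 := (hWs k ⟨hkν, hk.2⟩).param
      refine ⟨Real.sqrt_le_iff.2 ⟨(hW1 k hkν).le, ?_⟩, ?_⟩
      · rw [div_le_iff₀ (by positivity)]
        linarith [hk.1]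
      · exact ((hW k hkν).1.lt_pi_div_four (hν.trans hkν) one_mem_unit).le
    · obtain ⟨S, hS, hS1⟩ := exists_solves abs_sinFour_sub_le k₀ y
      have hy0 : 0 < y := (Real.sqrt_pos.2 hκ).trans_le hy.1
      have hS0 : S 0 = 0 := by
        by_contra hne
        have hpos : 0 < |S 0| / (4 * exp (2 * (k₀ + 2))) := by
          have := abs_pos.2 hne
          positivity
        set η := |S 0| / (4 * exp (2 * (k₀ + 2))) with hη
        have hfr : ∃ᶠ k in 𝓝 k₀, W k 1 ∈ Metric.ball y η :=
          hcl.frequently (Metric.ball_mem_nhds y hpos)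
        have hev : ∀ᶠ k in 𝓝 k₀, k ∈ Metric.ball k₀ (min η 1) ∧ ν < k :=
          Filter.Eventually.and (Metric.ball_mem_nhds k₀ (lt_min hpos one_pos))
            (lt_mem_nhds hk₀.1)
        obtain ⟨k, hk1, hk2, hk3⟩ := (hfr.and_eventually hev).exists
        rw [Metric.mem_ball, Real.dist_eq] at hk1 hk2
        have h1 := abs_sub_le_of_solves_sinFour hS (hW k hk3).1.solves zero_mem_unit
        rw [(hW k hk3).1.zero, sub_zero, hS1] at h1
        have h2 : |k| ≤ k₀ + 1 := by
          have := (abs_lt.1 (hk2.trans_le (min_le_right _ _))).2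
          rw [abs_of_pos (hν.trans hk3)]
          linarith
        have h3 : |k₀ - k| < η := by
          rw [abs_sub_comm]
          exact hk2.trans_le (min_le_left _ _)
        rw [abs_sub_comm] at hk1
        have h4 : |S 0| < 2 * (η + η * (1 / 4)) * exp (2 * (k₀ + 2)) := by
          refine h1.trans_lt ?_
          have h5 : exp (2 * (|k| + 1)) ≤ exp (2 * (k₀ + 2)) := exp_le_exp.2 (by linarith)
          calc _ ≤ 2 * (|y - W k 1| + |k₀ - k| * (1 / 4)) * exp (2 * (k₀ + 2)) := by gcongr
            _ < _ := by gcongr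
        have h6 : η * exp (2 * (k₀ + 2)) = |S 0| / 4 := by rw [hη]; field_simp
        have h7 := abs_pos.2 hne
        nlinarith
      have hSh : IsHalfState k₀ S := ⟨hS, hS0⟩
      have := hSh.eqOn_of_pos (hν.trans hk₀.1) (hW k₀ hk₀.1).1
        (hsign k₀ (hRr k₀ hk₀) S hSh (by rw [hS1]; exact hy0)) (hW k₀ hk₀.1).2 one_mem_unit
      rw [← hS1, this]
  have hαc : ContinuousOn (fun k => amplitude v (W k)) (Ioo ν (ν + R)) := by
    intro k₀ hk₀
    refine ContinuousAt.continuousWithinAt ?_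
    have h0 : Tendsto (fun k => B * (2 * (|W k₀ 1 - W k 1| + |k₀ - k| * (1 / 4)) *
        exp (2 * (|k| + 1)))) (𝓝 k₀) (𝓝 0) := by
      have h1 : Tendsto (fun k => |W k₀ 1 - W k 1|) (𝓝 k₀) (𝓝 0) := by
        simpa using ((hend k₀ hk₀).const_sub (W k₀ 1)).abs
      have h2 : Tendsto (fun k : ℝ => |k₀ - k| * (1 / 4)) (𝓝 k₀) (𝓝 0) :=
        (by fun_prop : Continuous fun k : ℝ => |k₀ - k| * (1 / 4)).tendsto' _ _ (by simp)
      have h3 : Tendsto (fun k : ℝ => exp (2 * (|k| + 1))) (𝓝 k₀) (𝓝 (exp (2 * (|k₀| + 1)))) :=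
        (by fun_prop : Continuous fun k : ℝ => exp (2 * (|k| + 1))).tendsto k₀
      simpa using (((h1.add h2).const_mul 2).mul h3).const_mul B
    have h1 : Tendsto (fun k => amplitude v (W k) - amplitude v (W k₀)) (𝓝 k₀) (𝓝 0) := by
      refine squeeze_zero_norm' ?_ h0
      filter_upwards [lt_mem_nhds hk₀.1] with k hk
      have hc := (hW k hk).1.solves.cont
      have hc₀ := (hW k₀ hk₀.1).1.solves.cont
      rw [Real.norm_eq_abs, abs_sub_comm, ← hv.amplitude_sub hc₀ hc]
      exact hBamp _ _ (hc₀.sub hc) fun x hx =>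
        abs_sub_le_of_solves_sinFour (hW k₀ hk₀.1).1.solves (hW k hk).1.solves hx
    exact tendsto_sub_nhds_zero_iff.1 h1
  set k₁ := ν + R / 2 with hk₁_def
  have hk₁ : k₁ ∈ Ioo ν (ν + R) := ⟨by linarith, by linarith⟩
  have hα : ∀ k ∈ Ioo ν (ν + R), 0 < |amplitude v (W k)| := by
    intro k hk
    have h1 := hampA k (W k) ((hWs k hk).mono (min_le_right _ _))
    have h2 := abs_pos.2 (hW1 k hk.1).ne'
    by_contra hcon
    push Not at hcon
    nlinarith
  refine ⟨|amplitude v (W k₁)|, hα k₁ hk₁, fun a ha => ?_⟩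
  rcases eq_or_ne a 0 with rfl | ha0
  · refine ⟨ν, fun _ => 0, ⟨⟨(Solves.const 0).congr_rhs fun _ _ => by
      rw [sinFour_zero, mul_zero], rfl⟩, le_rfl, by simp, by simpa using hε.le⟩, by linarith, ?_⟩
    simp [amplitude, fluxInt]
  have ha0' := abs_pos.2 ha0
  -- By the amplitude bound the amplitudes tend to 0 as `k → ν`, which supplies the lower end for
  -- the intermediate value theorem. Absolute values are used because the sign of `v` is arbitrary;
  -- negating the half state then adjusts the sign.
  obtain ⟨k₂, hk₂, hk₂a⟩ : ∃ k₂ ∈ Ioo ν k₁, |amplitude v (W k₂)| < |a| := by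
    have h0 : Tendsto (fun k : ℝ => B * √(C * (k - ν))) (𝓝[>] ν) (𝓝 0) :=
      ((by fun_prop : Continuous fun k : ℝ => B * √(C * (k - ν))).tendsto' ν 0
        (by simp)).mono_left nhdsWithin_le_nhds
    obtain ⟨k, hka, hk⟩ := ((h0.eventually (gt_mem_nhds ha0')).and
      (Ioo_mem_nhdsGT hk₁.1)).exists
    refine ⟨k, hk, lt_of_le_of_lt ?_ hka⟩
    have hkR : k ∈ Ioo ν (ν + R) := ⟨hk.1, hk.2.trans hk₁.2⟩
    have h1 := (hW k hk.1).1
    refine (hBamp _ _ h1.solves.cont fun x hx => h1.abs_le (hν.trans hk.1) hx).trans ?_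
    have h2 := hamp k ⟨hk.1, by linarith [(hRr k hkR).2]⟩ _ h1
    gcongr
    exact Real.abs_le_sqrt h2
  have hsub : Icc k₂ k₁ ⊆ Ioo ν (ν + R) := fun k hk =>
    ⟨hk₂.1.trans_le hk.1, hk.2.trans_lt hk₁.2⟩
  obtain ⟨k, hk, hka⟩ := intermediate_value_Icc hk₂.2.le (hαc.mono hsub).abs
    (show |a| ∈ Icc |amplitude v (W k₂)| |amplitude v (W k₁)| from ⟨hk₂a.le, ha.le⟩)
  have hkR := hsub hk
  have hks := (hWs k hkR).mono (min_le_left ε ε₁)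
  have hkr : k < ν + r := hkR.2.trans_le (by gcongr; exact min_le_left _ _)
  rcases abs_eq_abs.1 hka with h | h
  · exact ⟨k, W k, hks, hkr, h⟩
  · refine ⟨k, fun x => -W k x, hks.neg, hkr, ?_⟩
    have := hv.amplitude_sub (W := fun _ => 0) continuousOn_const (hW k hkR.1).1.solves.cont
    simp only [zero_sub] at this
    rw [this, h]
    simp [amplitude, fluxInt]

/-! ### Finite energy at the singular endpoint -/

/-- At the singular endpoint finite energy forces the natural boundary condition, and the solution
extends continuously. -/
theorem exists_solves_of_finite_energy {W g : ℝ → ℝ} (hg : Continuous g)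
    (hW : ContinuousOn W (Ico 0 1)) (hd : ∀ x ∈ Ioo (0 : ℝ) 1, DifferentiableAt ℝ W x)
    (hflux : ∀ x ∈ Ioo (0 : ℝ) 1, HasDerivAt (fun z => (1 - z ^ 2) * deriv W z)
      (-((1 - x ^ 2) ^ 2 * g (W x))) x)
    (hE : IntegrableOn (fun x => (1 - x ^ 2) * deriv W x ^ 2) (Ioo 0 1))
    (hE' : IntegrableOn (fun x => (1 - x ^ 2) ^ 2 * g (W x) ^ 2) (Ioo 0 1)) :
    ∃ W', (∀ x ∈ Ico (0 : ℝ) 1, W' x = W x) ∧ Solves W' (fun x => g (W' x)) := by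
  set q : ℝ → ℝ := fun x => (1 - x ^ 2) ^ 2 * g (W x) with hq
  set P : ℝ → ℝ := fun z => (1 - z ^ 2) * deriv W z with hP
  have hgW : ContinuousOn (fun x => g (W x)) (Ioo 0 1) :=
    hg.comp_continuousOn (hW.mono Ioo_subset_Ico_self)
  have hqc : ContinuousOn q (Ioo 0 1) := continuousOn_weight_mul hgW
  have hqi : IntegrableOn q (Ioo 0 1) := by
    have h1 : IntegrableOn (fun x => (1 - x ^ 2) ^ 2 + (1 - x ^ 2) ^ 2 * g (W x) ^ 2)
        (Ioo (0 : ℝ) 1) := by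
      refine IntegrableOn.add ?_ hE'
      exact (Continuous.integrableOn_Icc (by fun_prop)).mono_set Ioo_subset_Icc_self
    refine Integrable.mono' h1 (hqc.aestronglyMeasurable measurableSet_Ioo) ?_
    refine Eventually.of_forall fun x => ?_
    rw [hq, Real.norm_eq_abs, abs_mul, abs_of_nonneg (sq_nonneg _)]
    nlinarith [sq_nonneg (1 - x ^ 2), sq_nonneg (|g (W x)| - 1), sq_abs (g (W x)),
      mul_nonneg (sq_nonneg (1 - x ^ 2)) (sq_nonneg (|g (W x)| - 1))]
  have hqI : IntervalIntegrable q volume 0 1 :=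
    (intervalIntegrable_iff_integrableOn_Ioo_of_le zero_le_one).2 hqi
  have hqII : ∀ {x y : ℝ}, x ∈ Icc (0 : ℝ) 1 → y ∈ Icc (0 : ℝ) 1 → IntervalIntegrable q volume x y :=
    fun hx hy => hqI.mono_set (by
      rw [uIcc_of_le (zero_le_one' ℝ)]
      exact uIcc_subset_Icc hx hy)
  have hh : (1 / 2 : ℝ) ∈ Ioo (0 : ℝ) 1 := by norm_num
  have hFTC : ∀ x ∈ Ioo (0 : ℝ) 1, P (1 / 2) - P x = -∫ t in x..(1 / 2), q t := by
    intro x hx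
    rw [← intervalIntegral.integral_neg]
    refine (intervalIntegral.integral_eq_sub_of_hasDerivAt (fun t ht => hflux t ?_)
      (hqII (Ioo_subset_Icc_self hx) (Ioo_subset_Icc_self hh)).neg).symm
    exact (ordConnected_Ioo.uIcc_subset hx hh) ht
  set p := P (1 / 2) - ∫ t in (1 / 2 : ℝ)..1, q t with hp
  have hPx : ∀ x ∈ Ioo (0 : ℝ) 1, P x = p + ∫ t in x..1, q t := by
    intro x hx
    have h1 := hFTC x hx
    have h2 := intervalIntegral.integral_add_adjacent_intervals
      (hqII (Ioo_subset_Icc_self hx) (Ioo_subset_Icc_self hh))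
      (hqII (Ioo_subset_Icc_self hh) one_mem_unit)
    rw [hp, ← h2]
    linarith
  -- If the limit `p` of the flux were not 0, then `|P| ≥ |p|/2` near 1, and `(1 - x²) W'² = P²/(1 -
  -- x²)` would dominate a multiple of `1/(1 - x)`, which is not integrable.
  have hp0 : p = 0 := by
    by_contra hne
    have hlim : Tendsto (fun x => ∫ t in x..1, q t) (𝓝[<] 1) (𝓝 0) := by
      have h1 := intervalIntegral.continuousOn_primitive_interval_left (a := (0 : ℝ)) (b := 1)
        (μ := volume) (f := q) (by
          rw [uIcc_of_le zero_le_one]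
          exact (integrableOn_Icc_iff_integrableOn_Ioo (by finiteness) (by finiteness)).2 hqi)
      rw [uIcc_of_le zero_le_one] at h1
      have h2 : Tendsto _ _ _ := h1 1 one_mem_unit
      simp only [intervalIntegral.integral_same] at h2
      rw [← nhdsWithin_Ioo_eq_nhdsLT (zero_lt_one' ℝ)]
      exact h2.mono_left (nhdsWithin_mono _ Ioo_subset_Icc_self)
    have hev : ∀ᶠ x in 𝓝[<] (1 : ℝ), |∫ t in x..1, q t| < |p| / 2 :=
      (by simpa using hlim.abs : Tendsto (fun x => |∫ t in x..1, q t|) _ (𝓝 0)).eventually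
        (gt_mem_nhds (by have := abs_pos.2 hne; positivity))
    obtain ⟨b, hb, hbI⟩ := (mem_nhdsLT_iff_exists_mem_Ico_Ioo_subset (zero_lt_one' ℝ)).1 hev
    have hnot : ¬ IntervalIntegrable (fun x : ℝ => (x - 1)⁻¹) volume b 1 := by
      rw [intervalIntegrable_sub_inv_iff]
      push Not
      exact ⟨hb.2.ne, right_mem_uIcc⟩
    refine hnot ((intervalIntegrable_iff_integrableOn_Ioo_of_le hb.2.le).2 ?_)
    have hEb := hE.mono_set (Ioo_subset_Ioo_left hb.1 : Ioo b 1 ⊆ Ioo 0 1)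
    refine Integrable.mono' (hEb.const_mul (8 / p ^ 2))
      (measurable_id.sub_const 1).inv.aestronglyMeasurable ?_
    filter_upwards [ae_restrict_mem measurableSet_Ioo] with x hx
    have hx0 : x ∈ Ioo (0 : ℝ) 1 := ⟨hb.1.trans_lt hx.1, hx.2⟩
    have h1 : |∫ t in x..1, q t| < |p| / 2 := hbI hx
    have h2 : |p| / 2 ≤ |P x| := by
      rw [hPx x hx0]
      have h3 := abs_sub (p + ∫ t in x..1, q t) (∫ t in x..1, q t)
      rw [add_sub_cancel_right] at h3
      linarith
    have h3 : p ^ 2 / 4 ≤ P x ^ 2 := by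
      rw [← sq_abs p, ← sq_abs (P x)]
      nlinarith [abs_nonneg p]
    have h4 := one_sub_sq_pos (Ioo_subset_Ico_self hx0)
    have h5 : P x ^ 2 = (1 - x ^ 2) * ((1 - x ^ 2) * deriv W x ^ 2) := by
      simp only [hP]; ring
    have h6 : 1 - x ^ 2 ≤ 2 * (1 - x) := by nlinarith [sq_nonneg (1 - x)]
    have hp2 : 0 < p ^ 2 := by positivity
    have h7 : 0 < 1 - x := by linarith [hx.2]
    have h8 : 0 ≤ (1 - x ^ 2) * deriv W x ^ 2 := by positivity
    rw [Real.norm_eq_abs, abs_inv, abs_sub_comm, abs_of_pos h7, inv_le_iff_one_le_mul₀ h7,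
      div_mul_eq_mul_div, div_mul_eq_mul_div, le_div_iff₀ hp2]
    rw [h5] at h3
    nlinarith
  have hPq : ∀ x ∈ Ioo (0 : ℝ) 1, P x = ∫ t in x..1, q t := fun x hx => by
    rw [hPx x hx, hp0, zero_add]
  set M := ∫ t in (0 : ℝ)..1, (1 - t ^ 2) ^ 2 * g (W t) ^ 2 with hM
  have hE'I : IntervalIntegrable (fun t => (1 - t ^ 2) ^ 2 * g (W t) ^ 2) volume 0 1 :=
    (intervalIntegrable_iff_integrableOn_Ioo_of_le zero_le_one).2 hE'
  have hM0 : 0 ≤ M := intervalIntegral.integral_nonneg zero_le_one fun t _ => by positivity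
  have hderiv : ∀ x ∈ Ioo (0 : ℝ) 1, |deriv W x| ≤ 2 + M := by
    intro x hx
    have hx1 : 0 < 1 - x := by linarith [hx.2]
    have hxI := Ioo_subset_Icc_self hx
    have hE'x : IntervalIntegrable (fun t => (1 - t ^ 2) ^ 2 * g (W t) ^ 2) volume x 1 :=
      hE'I.mono_set (by
        rw [uIcc_of_le (zero_le_one' ℝ)]
        exact uIcc_subset_Icc hxI one_mem_unit)
    have h1 : |P x| ≤ ∫ t in x..1, (2 * (1 - x)
        + (1 - x) / 2 * ((1 - t ^ 2) ^ 2 * g (W t) ^ 2)) := by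
      rw [hPq x hx, ← Real.norm_eq_abs]
      refine intervalIntegral.norm_integral_le_of_norm_le hx.2.le (Eventually.of_forall
        fun t ht => ?_) (intervalIntegrable_const.add (hE'x.const_mul _))
      have ht0 : 0 ≤ t := hx.1.le.trans ht.1.le
      have h2 : 0 ≤ 1 - t ^ 2 := one_sub_sq_nonneg ⟨ht0, ht.2⟩
      have h3 : 1 - t ^ 2 ≤ 2 * (1 - x) := by nlinarith [ht.1, ht.2]
      have h4 : (1 - t ^ 2) ^ 2 ≤ 4 * (1 - x) ^ 2 := by nlinarith
      rw [hq, Real.norm_eq_abs, abs_mul, abs_of_nonneg (sq_nonneg _)]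
      -- Young's inequality with weight `1 - x`. Together with `(1 - t²)² ≤ 4 (1 - x)²` it makes the
      -- flux `O(1 - x)` from the weighted square integral alone, so that `W'` is bounded and `W`
      -- extends to 1.
      have h5 : |g (W t)| ≤ (1 / (1 - x) + (1 - x) * g (W t) ^ 2) / 2 := by
        have h6 : 0 ≤ (1 - (1 - x) * |g (W t)|) ^ 2 / (2 * (1 - x)) := by positivity
        have h7 : (1 - (1 - x) * |g (W t)|) ^ 2 / (2 * (1 - x))
            = (1 / (1 - x) + (1 - x) * |g (W t)| ^ 2) / 2 - |g (W t)| := by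
          field_simp
          ring
        rw [h7, sq_abs] at h6
        linarith
      calc (1 - t ^ 2) ^ 2 * |g (W t)|
          ≤ (1 - t ^ 2) ^ 2 * ((1 / (1 - x) + (1 - x) * g (W t) ^ 2) / 2) := by gcongr
        _ = (1 - t ^ 2) ^ 2 * (1 / (2 * (1 - x)))
            + (1 - x) / 2 * ((1 - t ^ 2) ^ 2 * g (W t) ^ 2) := by field_simp
        _ ≤ 4 * (1 - x) ^ 2 * (1 / (2 * (1 - x)))
            + (1 - x) / 2 * ((1 - t ^ 2) ^ 2 * g (W t) ^ 2) := by gcongr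
        _ = _ := by field_simp; ring
    rw [intervalIntegral.integral_add intervalIntegrable_const (hE'x.const_mul _),
      intervalIntegral.integral_const, intervalIntegral.integral_const_mul, smul_eq_mul] at h1
    have h2 : ∫ t in x..1, (1 - t ^ 2) ^ 2 * g (W t) ^ 2 ≤ M :=
      intervalIntegral.integral_mono_interval hx.1.le hx.2.le le_rfl
        (Eventually.of_forall fun t => by simp only [Pi.zero_apply]; positivity) hE'I
    have h3 : 1 - x ≤ 1 - x ^ 2 := by nlinarith [hx.1, hx.2]
    have h4 : |P x| = (1 - x ^ 2) * |deriv W x| := by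
      simp only [hP]
      rw [abs_mul, abs_of_pos (by linarith)]
    have h5 : (1 - x) * |deriv W x| ≤ (1 - x) * (2 + M) := by
      calc (1 - x) * |deriv W x| ≤ (1 - x ^ 2) * |deriv W x| := by gcongr
        _ ≤ _ := h4.symm.le.trans h1
        _ ≤ (1 - x) * (2 * (1 - x)) + (1 - x) / 2 * M := by gcongr
        _ ≤ (1 - x) * (2 * 1) + (1 - x) * M := by
          gcongr
          · linarith [hx.1]
          · linarith
        _ = _ := by ring
    exact le_of_mul_le_mul_left h5 hx1
  have hLip : LipschitzOnWith (2 + M).toNNReal W (Ioo 0 1) := by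
    refine Convex.lipschitzOnWith_of_nnnorm_deriv_le hd (fun x hx => ?_) (convex_Ioo 0 1)
    rw [← NNReal.coe_le_coe, coe_nnnorm, Real.coe_toNNReal _ (by positivity)]
    exact hderiv x hx
  obtain ⟨W', hW', heq⟩ := hLip.extend_real
  have hW'c := hW'.continuous
  have heq0 : W' 0 = W 0 := by
    have : (𝓝[Ioo 0 1] (0 : ℝ)).NeBot := by
      rw [← mem_closure_iff_nhdsWithin_neBot, closure_Ioo zero_ne_one]
      exact zero_mem_unit
    refine tendsto_nhds_unique (f := W) (l := 𝓝[Ioo 0 1] 0) ?_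
      ((hW 0 ⟨le_rfl, one_pos⟩).mono Ioo_subset_Ico_self)
    refine ((hW'c.tendsto 0).mono_left nhdsWithin_le_nhds).congr' ?_
    filter_upwards [self_mem_nhdsWithin] with x hx using (heq hx).symm
  refine ⟨W', fun x hx => ?_, hW'c.continuousOn, (hg.comp hW'c).continuousOn, fun x hx => ?_⟩
  · rcases hx.1.eq_or_lt with h | h
    · rw [← h, heq0]
    · exact (heq ⟨h, hx.2⟩).symm
  · have h1 : fluxInt (fun x => g (W' x)) x = P x := by
      rw [hPq x hx]
      refine intervalIntegral.integral_congr_Ioo_of_le hx.2.le fun t ht => ?_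
      simp only [hq]
      rw [heq ⟨hx.1.trans ht.1, ht.2⟩]
    have h2 : HasDerivAt W' (deriv W x) x := by
      refine (hd x hx).hasDerivAt.congr_of_eventuallyEq ?_
      filter_upwards [Ioo_mem_nhds hx.1 hx.2] with y hy using (heq hy).symm
    refine h2.congr_deriv ?_
    rw [h1, eq_div_iff (one_sub_sq_pos (Ioo_subset_Ico_self hx)).ne', mul_comm]

/-- The endpoint value is nonzero because a solution is determined by it, and the value 0 belongs to
the zero solution. -/
theorem IsEigenfunction.exists_solves {κ : ℝ} {v : ℝ → ℝ} (h : IsEigenfunction κ v) :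
    ∃ v', (∀ x ∈ Ico (0 : ℝ) 1, v' x = v x) ∧ Solves v' (fun x => κ * v' x) ∧ v' 0 = 0 ∧
      v' 1 ≠ 0 := by
  obtain ⟨v', heq, hs⟩ := exists_solves_of_finite_energy (W := v) (g := fun y => κ * y)
    (by fun_prop) h.continuous h.differentiable (fun x hx => by
      refine (h.differentiable_flux x hx).hasDerivAt.congr_deriv ?_
      linarith [h.equation x hx]) h.finite_gradient (by
      have := h.finite_weighted.const_mul (κ ^ 2)
      refine this.congr (Eventually.of_forall fun x => ?_)
      simp only
      ring)
  have h0 : v' 0 = 0 := by rw [heq 0 ⟨le_rfl, one_pos⟩, h.dirichlet]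
  refine ⟨v', heq, hs, h0, fun h1 => ?_⟩
  have hz : Solves (fun _ => 0) (fun _ => κ * 0) := (Solves.const 0).congr_rhs fun _ _ => mul_zero κ
  have := Solves.eqOn_of_lipschitz (f := id) (fun a b => le_rfl) hs hz h1
  obtain ⟨x, hx, hne⟩ := h.nonzero
  rw [← heq x (Ioo_subset_Ico_self hx)] at hne
  exact hne (this (Ioo_subset_Icc_self hx))

theorem IsPrincipal.isEigenfunction {ν : ℝ} {V : ℝ → ℝ} (hV : IsPrincipal ν V) :
    IsEigenfunction ν V := by
  have hd := hV.solves.hasDerivAt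
  have hc := hV.solves.cont
  have hflux : ∀ x ∈ Ioo (0 : ℝ) 1, HasDerivAt (fun z => (1 - z ^ 2) * deriv V z)
      (-((1 - x ^ 2) ^ 2 * (ν * V x))) x := by
    intro x hx
    refine (hasDerivAt_fluxInt hV.solves.cont_rhs hx).congr_of_eventuallyEq ?_
    filter_upwards [Ioo_mem_nhds hx.1 hx.2] with y hy
    rw [(hd y hy).deriv, mul_div_cancel₀ _ (one_sub_sq_pos (Ioo_subset_Ico_self hy)).ne']
  have hgrad : ContinuousOn (fun x => (1 - x ^ 2) * (fluxInt (fun x => ν * V x) x / (1 - x ^ 2)) ^ 2)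
      (Icc 0 1) :=
    ContinuousOn.mul (by fun_prop) ((continuousOn_fluxInt_div hV.solves.cont_rhs).pow 2)
  refine ⟨hc.mono Ico_subset_Icc_self, hV.zero, fun x hx => (hd x hx).differentiableAt,
    fun x hx => (hflux x hx).differentiableAt, fun x hx => ?_, ?_, ?_,
    ⟨1 / 2, by norm_num, (hV.pos_of_pos _ (by norm_num)).ne'⟩⟩
  · rw [(hflux x hx).deriv]
    ring
  · refine (hgrad.integrableOn_Icc.mono_set Ioo_subset_Icc_self).congr_fun (fun x hx => ?_)
      measurableSet_Ioo
    simp only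
    rw [(hd x hx).deriv]
  · exact (continuousOn_weight_mul (hc.pow 2)).integrableOn_Icc.mono_set Ioo_subset_Icc_self

/-! ### From states to half states -/

theorem etaZero_sq {x : ℝ} (h : |x| ≤ 1) : etaZero x ^ 2 = 1 - x ^ 2 := by
  rw [etaZero, Real.sq_sqrt]
  rw [← sq_abs]
  nlinarith [abs_nonneg x]

theorem etaZero_pow_four {x : ℝ} (h : |x| ≤ 1) : etaZero x ^ 4 = (1 - x ^ 2) ^ 2 := by
  rw [← etaZero_sq h]; ring

theorem etaZero_neg (x : ℝ) : etaZero (-x) = etaZero x := by simp [etaZero]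

theorem continuous_etaZero : Continuous etaZero := by unfold etaZero; fun_prop

theorem mem_stateInterval_iff {μ y : ℝ} (hμ : 0 < μ) : y ∈ stateInterval μ ↔ |μ * y| < 1 := by
  rw [stateInterval, mem_Ioo, ← abs_lt, abs_mul, abs_of_pos hμ, lt_div_iff₀ hμ, mul_comm]

theorem stateInterval_mem_nhds {μ y : ℝ} (hy : y ∈ stateInterval μ) : stateInterval μ ∈ 𝓝 y :=
  Ioo_mem_nhds hy.1 hy.2

theorem neg_mem_stateInterval {μ y : ℝ} (hy : y ∈ stateInterval μ) : -y ∈ stateInterval μ :=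
  ⟨neg_lt_neg hy.2, by linarith [hy.1]⟩

theorem sin_four_mul_add (w : ℝ) : sin (4 * (π / 4 + w)) = -(4 * sinFour w) := by
  rw [sinFour, show 4 * (π / 4 + w) = 4 * w + π by ring, sin_add_pi]
  ring

namespace IsState

variable {μ : ℝ} {u : ℝ → ℝ}

theorem pi_div_two_sub (h : IsState μ u) : IsState μ (fun y => π / 2 - u y) := by
  have hder : ∀ y, deriv (fun y => π / 2 - u y) y = -deriv u y := fun y => by
    rw [deriv_const_sub]
  have hfl : (fun z => etaZero (μ * z) ^ 2 * deriv (fun y => π / 2 - u y) z)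
      = fun z => -(etaZero (μ * z) ^ 2 * deriv u z) := by
    ext z; rw [hder]; ring
  refine ⟨fun y hy => (h.differentiable y hy).const_sub _, fun y hy => ?_, fun y hy => ?_, ?_, ?_⟩
  · rw [hfl]
    exact (h.differentiable_flux y hy).fun_neg
  · rw [hfl, deriv.fun_neg, show 4 * (π / 2 - u y) = 2 * π - 4 * u y by ring, sin_two_pi_sub]
    linarith [h.euler_lagrange y hy]
  · refine h.finite_energy.congr (Eventually.of_forall fun y => ?_)
    simp only [energyDensity]
    rw [hder, show 2 * (π / 2 - u y) = π - 2 * u y by ring, sin_pi_sub]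
    ring
  · rw [h.center]; ring

theorem comp_neg (h : IsState μ u) : IsState μ (fun y => u (-y)) := by
  have hder : ∀ y, deriv (fun y => u (-y)) y = -deriv u (-y) := fun y => deriv_comp_neg u y
  have hfl : (fun z => etaZero (μ * z) ^ 2 * deriv (fun y => u (-y)) z)
      = fun z => -((fun z => etaZero (μ * z) ^ 2 * deriv u z) (-z)) := by
    ext z
    rw [hder]
    simp only
    rw [mul_neg, mul_neg, etaZero_neg]
  refine ⟨fun y hy => ?_, fun y hy => ?_, fun y hy => ?_, ?_, ?_⟩
  · exact (h.differentiable (-y) (neg_mem_stateInterval hy)).comp y differentiableAt_id.neg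
  · rw [hfl]
    exact ((h.differentiable_flux (-y) (neg_mem_stateInterval hy)).comp y
      differentiableAt_id.neg).fun_neg
  · rw [hfl, deriv.fun_neg, deriv_comp_neg (fun z => etaZero (μ * z) ^ 2 * deriv u z) y]
    have := h.euler_lagrange (-y) (neg_mem_stateInterval hy)
    rw [mul_neg, etaZero_neg] at this
    linarith
  · have h1 : energyDensity μ (fun y => u (-y)) = fun y => energyDensity μ u (-y) := by
      ext y
      simp only [energyDensity]
      rw [hder, mul_neg, etaZero_neg]
      ring
    rw [h1]
    have hle : ∀ {f : ℝ → ℝ}, IntegrableOn f (stateInterval μ) →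
        IntegrableOn (fun y => f (-y)) (stateInterval μ) := by
      intro f hf
      rcases le_or_gt (1 / μ) (-(1 / μ)) with h0 | h0
      · rw [stateInterval, Ioo_eq_empty h0.not_gt]
        exact integrableOn_empty
      · rw [stateInterval, ← intervalIntegrable_iff_integrableOn_Ioo_of_le h0.le] at hf ⊢
        have := (IntervalIntegrable.iff_comp_neg (f := f) (a := -(1 / μ)) (b := 1 / μ)).1 hf
        rw [neg_neg] at this
        exact this.symm
    exact hle h.finite_energy
  · rw [neg_zero, h.center]

/-- The right half of a state, in the variable `x = μ y`. -/
theorem exists_halfState (hμ : 0 < μ) (h : IsState μ u) :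
    ∃ W, IsHalfState (1 / μ ^ 2) W ∧ (∀ x ∈ Ico (0 : ℝ) 1, W x = u (x / μ) - π / 4) := by
  have hmem : ∀ x ∈ Ioo (-1 : ℝ) 1, x / μ ∈ stateInterval μ := by
    intro x hx
    rw [mem_stateInterval_iff hμ, mul_div_cancel₀ _ hμ.ne']
    exact abs_lt.2 hx
  have hmem' : ∀ x ∈ Ico (0 : ℝ) 1, x / μ ∈ stateInterval μ := fun x hx =>
    hmem x ⟨by linarith [hx.1], hx.2⟩
  set W : ℝ → ℝ := fun x => u (x / μ) - π / 4 with hW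
  have hdiff : ∀ x ∈ Ico (0 : ℝ) 1, DifferentiableAt ℝ W x := fun x hx =>
    ((h.differentiable _ (hmem' x hx)).comp x (differentiableAt_id.div_const μ)).sub_const _
  have hder : ∀ x, deriv W x = deriv u (x / μ) / μ := by
    intro x
    simp only [hW]
    rw [deriv_sub_const]
    have := deriv_comp_mul_left μ⁻¹ u x
    simp only [inv_mul_eq_div, smul_eq_mul] at this
    exact this
  have hEL : ∀ x ∈ Ioo (0 : ℝ) 1, HasDerivAt (fun z => (1 - z ^ 2) * deriv W z)
      (-((1 - x ^ 2) ^ 2 * (1 / μ ^ 2 * sinFour (W x)))) x := by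
    intro x hx
    have hxm := hmem' x (Ioo_subset_Ico_self hx)
    have h1 := (h.differentiable_flux _ hxm).hasDerivAt
    have h2 : HasDerivAt (fun x : ℝ => x / μ) (1 / μ) x := (hasDerivAt_id x).div_const μ
    have h3 := (h1.comp x h2).div_const μ
    have h4 : deriv (fun z => etaZero (μ * z) ^ 2 * deriv u z) (x / μ)
        = -((1 - x ^ 2) ^ 2 * sinFour (W x)) := by
      have h5 := h.euler_lagrange _ hxm
      have h6 : u (x / μ) = π / 4 + W x := by simp [hW]
      rw [mul_div_cancel₀ _ hμ.ne', etaZero_pow_four (abs_le.2 ⟨by linarith [hx.1], hx.2.le⟩),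
        h6, sin_four_mul_add] at h5
      linarith
    refine HasDerivAt.congr_deriv (h3.congr_of_eventuallyEq ?_) ?_
    · filter_upwards [Ioo_mem_nhds hx.1 hx.2] with z hz
      simp only [Function.comp]
      rw [mul_div_cancel₀ _ hμ.ne', etaZero_sq (abs_le.2 ⟨by linarith [hz.1], hz.2.le⟩), hder]
      ring
    · rw [h4]
      field_simp
  have hEI : IntegrableOn (fun x => energyDensity μ u (x / μ)) (Ioo 0 1) := by
    have hμ' : 0 < 1 / μ := by positivity
    have h1 : IntervalIntegrable (energyDensity μ u) volume 0 (1 / μ) :=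
      (intervalIntegrable_iff_integrableOn_Ioo_of_le hμ'.le).2
        (h.finite_energy.mono_set (Ioo_subset_Ioo_left (by linarith)))
    have h2 := h1.comp_mul_left (c := 1 / μ)
    rw [zero_div, div_self hμ'.ne', intervalIntegrable_iff_integrableOn_Ioo_of_le zero_le_one] at h2
    refine h2.congr_fun (fun x _ => ?_) measurableSet_Ioo
    simp only
    rw [one_div_mul_eq_div]
  obtain ⟨W', heq, hs⟩ := exists_solves_of_finite_energy (W := W)
    (g := fun w => 1 / μ ^ 2 * sinFour w) (by fun_prop)
    (fun x hx => (hdiff x hx).continuousAt.continuousWithinAt)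
    (fun x hx => hdiff x (Ioo_subset_Ico_self hx)) hEL (by
      refine Integrable.mono' (hEI.const_mul (1 / μ ^ 2)) (Measurable.aestronglyMeasurable
        (by have := measurable_deriv W; fun_prop)) ?_
      filter_upwards [ae_restrict_mem measurableSet_Ioo] with x hx
      have h1 : |x| ≤ 1 := abs_le.2 ⟨by linarith [hx.1], hx.2.le⟩
      have h2 := one_sub_sq_pos (Ioo_subset_Ico_self hx)
      rw [Real.norm_eq_abs, abs_of_nonneg (by positivity), hder, energyDensity,
        mul_div_cancel₀ _ hμ.ne', etaZero_sq h1, etaZero_pow_four h1]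
      have h3 : 0 ≤ 1 / μ ^ 2 * (1 / 4 * (1 - x ^ 2) ^ 2 * sin (2 * u (x / μ)) ^ 2) := by positivity
      calc (1 - x ^ 2) * (deriv u (x / μ) / μ) ^ 2
          = 1 / μ ^ 2 * ((1 - x ^ 2) * deriv u (x / μ) ^ 2) := by field_simp
        _ ≤ _ := by rw [mul_add]; linarith) (by
      -- Since `sinFour` is bounded, this integrability is automatic; the energy is needed only for
      -- the gradient term.
      have hWc : ContinuousOn W (Ioo 0 1) := fun x hx =>
        (hdiff x (Ioo_subset_Ico_self hx)).continuousAt.continuousWithinAt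
      have hc : ContinuousOn (fun x => (1 - x ^ 2) ^ 2 * (1 / μ ^ 2 * sinFour (W x)) ^ 2)
          (Ioo 0 1) := by fun_prop
      refine IntegrableOn.of_bound (by simp) (hc.aestronglyMeasurable measurableSet_Ioo)
        ((1 / μ ^ 2) ^ 2) ?_
      · filter_upwards [ae_restrict_mem measurableSet_Ioo] with x hx
        have h2 := one_sub_sq_pos (Ioo_subset_Ico_self hx)
        have h3 := abs_sinFour_le_quarter (W x)
        have h4 : sinFour (W x) ^ 2 ≤ 1 := by
          rw [← sq_abs]
          nlinarith [abs_nonneg (sinFour (W x))]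
        have h5 : (1 - x ^ 2) ^ 2 ≤ 1 := by nlinarith [sq_nonneg x]
        rw [Real.norm_eq_abs, abs_of_nonneg (by positivity), mul_pow]
        calc (1 - x ^ 2) ^ 2 * ((1 / μ ^ 2) ^ 2 * sinFour (W x) ^ 2)
            ≤ 1 * ((1 / μ ^ 2) ^ 2 * 1) := by gcongr
          _ = _ := by ring)
  refine ⟨W', ⟨hs, ?_⟩, heq⟩
  rw [heq 0 ⟨le_rfl, one_pos⟩]
  simp [hW, h.center]

end IsState

/-! ### From half states to states -/

/-- The odd extension of a function on `[0, 1)`. -/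
noncomputable def oddExtension (W : ℝ → ℝ) (x : ℝ) : ℝ := if 0 ≤ x then W x else -W (-x)

theorem oddExtension_of_nonneg (W : ℝ → ℝ) {x : ℝ} (hx : 0 ≤ x) : oddExtension W x = W x :=
  if_pos hx

/-- A derivative that extends continuously to a puncture. -/
theorem hasDerivAt_zero_of_punctured {F G : ℝ → ℝ} (hF : ContinuousAt F 0)
    (hd : ∀ x ∈ Ioo (-1 : ℝ) 1, x ≠ 0 → HasDerivAt F (G x) x) (hG : ContinuousAt G 0) :
    HasDerivAt F (G 0) 0 := by
  have hr : HasDerivWithinAt F (G 0) (Ici 0) 0 := by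
    refine hasDerivWithinAt_Ici_of_tendsto_deriv (s := Ioo 0 1) (fun x hx => ?_)
      hF.continuousWithinAt (Ioo_mem_nhdsGT one_pos) ?_
    · exact (hd x ⟨by linarith [hx.1], hx.2⟩ hx.1.ne').differentiableAt.differentiableWithinAt
    · refine (hG.tendsto.mono_left nhdsWithin_le_nhds).congr' ?_
      filter_upwards [Ioo_mem_nhdsGT (zero_lt_one' ℝ)] with x hx
      exact (hd x ⟨by linarith [hx.1], hx.2⟩ hx.1.ne').deriv.symm
  have hl : HasDerivWithinAt F (G 0) (Iic 0) 0 := by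
    have hm : Ioo (-1 : ℝ) 0 ∈ 𝓝[<] (0 : ℝ) := Ioo_mem_nhdsLT (by norm_num)
    refine hasDerivWithinAt_Iic_of_tendsto_deriv (s := Ioo (-1) 0) (fun x hx => ?_)
      hF.continuousWithinAt hm ?_
    · exact (hd x ⟨hx.1, by linarith [hx.2]⟩ hx.2.ne).differentiableAt.differentiableWithinAt
    · refine (hG.tendsto.mono_left nhdsWithin_le_nhds).congr' ?_
      filter_upwards [hm] with x hx
      exact (hd x ⟨hx.1, by linarith [hx.2]⟩ hx.2.ne).deriv.symm
  have := hr.union hl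
  rwa [Ici_union_Iic, hasDerivWithinAt_univ] at this

theorem abs_mem_Ico {x : ℝ} (hx : x ∈ Ioo (-1 : ℝ) 1) : |x| ∈ Ico (0 : ℝ) 1 :=
  ⟨abs_nonneg x, abs_lt.2 hx⟩

theorem continuousAt_oddExtension {W : ℝ → ℝ} (hW : ContinuousOn W (Icc 0 1)) (h0 : W 0 = 0) :
    ContinuousAt (oddExtension W) 0 := by
  have h1 : Tendsto (fun x : ℝ => W |x|) (𝓝 0) (𝓝 0) := by
    have h2 : Tendsto W (𝓝[Icc 0 1] 0) (𝓝 0) := by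
      have : Tendsto _ _ _ := hW 0 zero_mem_unit
      rwa [h0] at this
    refine h2.comp (tendsto_nhdsWithin_iff.2 ⟨continuous_abs.tendsto' 0 0 abs_zero, ?_⟩)
    filter_upwards [Ioo_mem_nhds (show (-1 : ℝ) < 0 by norm_num) one_pos] with x hx
    exact Ico_subset_Icc_self (abs_mem_Ico hx)
  have h3 : Tendsto (oddExtension W) (𝓝 0) (𝓝 0) := by
    refine squeeze_zero_norm (fun x => le_of_eq ?_) (by simpa using h1.abs)
    rw [Real.norm_eq_abs]
    rcases le_or_gt 0 x with h | h
    · rw [oddExtension_of_nonneg _ h, abs_of_nonneg h]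
    · rw [oddExtension, if_neg h.not_ge, abs_neg, abs_of_neg h]
  have h4 : oddExtension W 0 = 0 := by rw [oddExtension_of_nonneg _ le_rfl, h0]
  rw [ContinuousAt, h4]
  exact h3

theorem continuousAt_comp_abs {q : ℝ → ℝ} (hq : ContinuousOn q (Icc 0 1)) {x : ℝ}
    (hx : x ∈ Ioo (-1 : ℝ) 1) : ContinuousAt (fun x => q |x|) x := by
  have h1 : Tendsto (fun y : ℝ => |y|) (𝓝 x) (𝓝[Icc 0 1] |x|) := by
    refine tendsto_nhdsWithin_iff.2 ⟨continuous_abs.tendsto x, ?_⟩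
    filter_upwards [Ioo_mem_nhds hx.1 hx.2] with y hy using Ico_subset_Icc_self (abs_mem_Ico hy)
  exact (hq |x| (Ico_subset_Icc_self (abs_mem_Ico hx))).tendsto.comp h1

/-- The derivative of an odd function is even, whence `|x|`. At 0 the condition `W(0) = 0` makes the
extension continuous, and the derivative passes to the limit from both sides. -/
theorem Solves.hasDerivAt_oddExtension {W g : ℝ → ℝ} (h : Solves W g) (h0 : W 0 = 0) {x : ℝ}
    (hx : x ∈ Ioo (-1 : ℝ) 1) :
    HasDerivAt (oddExtension W) (fluxInt g |x| / (1 - x ^ 2)) x := by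
  have hne : ∀ x ∈ Ioo (-1 : ℝ) 1, x ≠ 0 →
      HasDerivAt (oddExtension W) (fluxInt g |x| / (1 - |x| ^ 2)) x := by
    intro x hx hx0
    rcases hx0.lt_or_gt with hneg | hpos
    · have h1 := (h.hasDerivAt (-x) ⟨by linarith, by linarith [hx.1]⟩).comp x (hasDerivAt_neg x)
      rw [abs_of_neg hneg]
      refine (h1.neg.congr_of_eventuallyEq ?_).congr_deriv (by ring)
      filter_upwards [gt_mem_nhds hneg] with y hy
      simp only [oddExtension, if_neg hy.not_ge]
      rfl
    · rw [abs_of_pos hpos]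
      refine (h.hasDerivAt x ⟨hpos, hx.2⟩).congr_of_eventuallyEq ?_
      filter_upwards [lt_mem_nhds hpos] with y hy using oddExtension_of_nonneg _ hy.le
  rw [← sq_abs]
  rcases eq_or_ne x 0 with rfl | hx0
  · exact hasDerivAt_zero_of_punctured (G := fun x => fluxInt g |x| / (1 - |x| ^ 2))
      (continuousAt_oddExtension h.cont h0) hne
      (continuousAt_comp_abs (q := fun s => fluxInt g s / (1 - s ^ 2))
        (continuousOn_fluxInt_div h.cont_rhs) hx)
  · exact hne x hx hx0

theorem IsHalfState.hasDerivAt_flux {k : ℝ} {W : ℝ → ℝ} (h : IsHalfState k W) {x : ℝ}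
    (hx : x ∈ Ioo (-1 : ℝ) 1) :
    HasDerivAt (fun x => fluxInt (fun x => k * sinFour (W x)) |x|)
      (-((1 - x ^ 2) ^ 2 * (k * sinFour (oddExtension W x)))) x := by
  set g : ℝ → ℝ := fun x => k * sinFour (W x) with hg
  have hne : ∀ x ∈ Ioo (-1 : ℝ) 1, x ≠ 0 → HasDerivAt (fun x => fluxInt g |x|)
      (-((1 - x ^ 2) ^ 2 * (k * sinFour (oddExtension W x)))) x := by
    intro x hx hx0
    rcases hx0.lt_or_gt with hneg | hpos
    · have h1 := (hasDerivAt_fluxInt h.solves.cont_rhs (x := -x)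
        ⟨by linarith, by linarith [hx.1]⟩).comp x (hasDerivAt_neg x)
      refine (h1.congr_of_eventuallyEq ?_).congr_deriv ?_
      · filter_upwards [gt_mem_nhds hneg] with y hy
        rw [abs_of_neg hy]
        rfl
      · rw [oddExtension, if_neg hneg.not_ge, sinFour_neg]
        ring
    · rw [oddExtension_of_nonneg _ hpos.le]
      refine (hasDerivAt_fluxInt h.solves.cont_rhs ⟨hpos, hx.2⟩).congr_of_eventuallyEq ?_
      filter_upwards [lt_mem_nhds hpos] with y hy
      rw [abs_of_pos hy]
  rcases eq_or_ne x 0 with rfl | hx0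
  · have hc := continuousAt_oddExtension h.solves.cont h.zero
    refine hasDerivAt_zero_of_punctured
      (G := fun x => -((1 - x ^ 2) ^ 2 * (k * sinFour (oddExtension W x))))
      (continuousAt_comp_abs (continuousOn_fluxInt h.solves.cont_rhs) hx) hne ?_
    have := continuous_sinFour.continuousAt.comp hc
    exact (ContinuousAt.mul (by fun_prop) (this.const_mul k)).neg
  · exact hne x hx hx0

/-- The state with a given half. -/
noncomputable def stateOf (μ : ℝ) (W : ℝ → ℝ) (y : ℝ) : ℝ := π / 4 + oddExtension W (μ * y)

namespace IsHalfState

variable {μ : ℝ} {W : ℝ → ℝ}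

theorem hasDerivAt_stateOf (hμ : 0 < μ) (h : IsHalfState (1 / μ ^ 2) W) {y : ℝ}
    (hy : y ∈ stateInterval μ) : HasDerivAt (stateOf μ W)
      (μ * (fluxInt (fun x => 1 / μ ^ 2 * sinFour (W x)) |μ * y| / (1 - (μ * y) ^ 2))) y := by
  have h1 := h.solves.hasDerivAt_oddExtension h.zero
    (abs_lt.1 ((mem_stateInterval_iff hμ).1 hy))
  have h2 : HasDerivAt (fun y : ℝ => μ * y) μ y := by simpa using (hasDerivAt_id y).const_mul μ
  exact ((h1.comp y h2).const_add (π / 4)).congr_deriv (by ring)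

/-- The energy is finite because `flux/(1 - x²)` is continuous on `[0, 1]`, so that the derivative
of the state is bounded. -/
theorem isState_stateOf (hμ : 0 < μ) (h : IsHalfState (1 / μ ^ 2) W) :
    IsState μ (stateOf μ W) := by
  set g : ℝ → ℝ := fun x => 1 / μ ^ 2 * sinFour (W x) with hg
  have hder : ∀ y ∈ stateInterval μ, deriv (stateOf μ W) y
      = μ * (fluxInt g |μ * y| / (1 - (μ * y) ^ 2)) := fun y hy =>
    (h.hasDerivAt_stateOf hμ hy).deriv
  have hflux : ∀ y ∈ stateInterval μ, HasDerivAt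
      (fun z => etaZero (μ * z) ^ 2 * deriv (stateOf μ W) z)
      (-((1 - (μ * y) ^ 2) ^ 2 * sinFour (oddExtension W (μ * y)))) y := by
    intro y hy
    have h1 := h.hasDerivAt_flux (abs_lt.1 ((mem_stateInterval_iff hμ).1 hy))
    have h2 : HasDerivAt (fun y : ℝ => μ * y) μ y := by simpa using (hasDerivAt_id y).const_mul μ
    refine (((h1.comp y h2).const_mul μ).congr_of_eventuallyEq ?_).congr_deriv ?_
    · filter_upwards [stateInterval_mem_nhds hy] with z hz
      have hz' := (mem_stateInterval_iff hμ).1 hz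
      rw [hder z hz, etaZero_sq hz'.le]
      have := one_sub_sq_pos (x := |μ * z|) ⟨abs_nonneg _, hz'⟩
      rw [sq_abs] at this
      simp only [Function.comp]
      rw [mul_left_comm, mul_div_cancel₀ _ this.ne']
    · field_simp
  refine ⟨fun y hy => (h.hasDerivAt_stateOf hμ hy).differentiableAt,
    fun y hy => (hflux y hy).differentiableAt, fun y hy => ?_, ?_, ?_⟩
  · rw [(hflux y hy).deriv, stateOf, sin_four_mul_add,
      etaZero_pow_four ((mem_stateInterval_iff hμ).1 hy).le]
    ring
  · obtain ⟨M, hM⟩ := isCompact_Icc.exists_bound_of_continuousOn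
      (continuousOn_fluxInt_div h.solves.cont_rhs)
    have hM0 : 0 ≤ M := (norm_nonneg _).trans (hM 0 zero_mem_unit)
    have hsc : ContinuousOn (stateOf μ W) (stateInterval μ) := fun y hy =>
      (h.hasDerivAt_stateOf hμ hy).continuousAt.continuousWithinAt
    refine IntegrableOn.of_bound ?_ ?_ ((μ * M) ^ 2 + 1) ?_
    · simp [stateInterval]
    · unfold energyDensity
      have h1 : Measurable fun y => etaZero (μ * y) ^ 2 * deriv (stateOf μ W) y ^ 2 := by
        have := measurable_deriv (stateOf μ W)
        have := continuous_etaZero.measurable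
        fun_prop
      refine h1.aestronglyMeasurable.add (ContinuousOn.aestronglyMeasurable ?_ measurableSet_Ioo)
      have := continuous_etaZero
      fun_prop
    · filter_upwards [ae_restrict_mem measurableSet_Ioo] with y hy
      have hy' := (mem_stateInterval_iff hμ).1 hy
      have h1 := hM |μ * y| ⟨abs_nonneg _, hy'.le⟩
      rw [sq_abs, Real.norm_eq_abs] at h1
      have h2 : etaZero (μ * y) ^ 2 ≤ 1 := by
        rw [etaZero_sq hy'.le]
        nlinarith [sq_nonneg (μ * y)]
      have h3 : etaZero (μ * y) ^ 4 ≤ 1 := by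
        nlinarith [sq_nonneg (etaZero (μ * y)), sq_nonneg (etaZero (μ * y) ^ 2)]
      have h4 : deriv (stateOf μ W) y ^ 2 ≤ (μ * M) ^ 2 := by
        rw [hder y hy, ← sq_abs, abs_mul, abs_of_pos hμ]
        gcongr
      have h5 := sin_sq_le_one (2 * stateOf μ W y)
      rw [Real.norm_eq_abs, energyDensity, abs_of_nonneg (by positivity)]
      calc _ ≤ 1 * (μ * M) ^ 2 + 1 / 4 * 1 * 1 := by gcongr
        _ ≤ _ := by linarith
  · rw [stateOf, mul_zero, oddExtension_of_nonneg _ le_rfl, h.zero, add_zero]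

theorem deriv_stateOf_zero (hμ : 0 < μ) (h : IsHalfState (1 / μ ^ 2) W) :
    deriv (stateOf μ W) 0 = μ * fluxInt (fun x => 1 / μ ^ 2 * sinFour (W x)) 0 := by
  rw [(h.hasDerivAt_stateOf hμ ((mem_stateInterval_iff hμ).2 (by simp))).deriv]
  simp

end IsHalfState

/-- The slope at the centre of a state and the flux of its right half. -/
theorem IsState.deriv_zero {μ : ℝ} {u W : ℝ → ℝ} (hμ : 0 < μ) (h : IsState μ u)
    (hW : IsHalfState (1 / μ ^ 2) W) (heq : ∀ x ∈ Ico (0 : ℝ) 1, W x = u (x / μ) - π / 4) :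
    deriv u 0 = μ * fluxInt (fun x => 1 / μ ^ 2 * sinFour (W x)) 0 := by
  have h0 : (0 : ℝ) ∈ stateInterval μ := (mem_stateInterval_iff hμ).2 (by simp)
  rw [← hW.deriv_stateOf_zero hμ]
  have h1 := (h.differentiable 0 h0).hasDerivAt.hasDerivWithinAt (s := Ici 0)
  have h2 := (hW.isState_stateOf hμ).differentiable 0 h0 |>.hasDerivAt.hasDerivWithinAt (s := Ici 0)
  refine (uniqueDiffOn_Ici (0 : ℝ) 0 self_mem_Ici).eq_deriv _ h1 (h2.congr_of_eventuallyEq ?_ ?_)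
  · filter_upwards [inter_mem_nhdsWithin (Ici (0 : ℝ)) (stateInterval_mem_nhds h0)] with y hy
    have hy' := (mem_stateInterval_iff hμ).1 hy.2
    have hy0 : 0 ≤ μ * y := mul_nonneg hμ.le hy.1
    rw [abs_of_nonneg hy0] at hy'
    rw [stateOf, oddExtension_of_nonneg _ hy0, heq _ ⟨hy0, hy'⟩, mul_div_cancel_left₀ _ hμ.ne']
    ring
  · rw [h.center, (hW.isState_stateOf hμ).center]

theorem one_div_sq_lt_iff {ν μ : ℝ} (hν : 0 < ν) (hμ : 0 < μ) : ν < 1 / μ ^ 2 ↔ μ < 1 / √ν := by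
  have hs := Real.sqrt_pos.2 hν
  rw [lt_div_iff₀ (by positivity), lt_div_iff₀ hs,
    ← sq_lt_one_iff₀ (a := μ * √ν) (by positivity), mul_pow, Real.sq_sqrt hν.le, mul_comm]

theorem stateOf_congr {μ : ℝ} (hμ : 0 < μ) {W W' : ℝ → ℝ} (h : EqOn W W' (Icc 0 1)) :
    EqOn (stateOf μ W) (stateOf μ W') (stateInterval μ) := by
  intro y hy
  have hy' := abs_lt.1 ((mem_stateInterval_iff hμ).1 hy)
  simp only [stateOf, oddExtension]
  split_ifs with h0
  · rw [h ⟨h0, hy'.2.le⟩]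
  · rw [h ⟨by linarith, by linarith [hy'.1]⟩]

theorem stateOf_neg (μ : ℝ) (W : ℝ → ℝ) (y : ℝ) :
    stateOf μ (fun x => -W x) y = π / 2 - stateOf μ W y := by
  simp only [stateOf, oddExtension]
  split_ifs <;> ring

theorem stateOf_of_nonneg {μ y : ℝ} (W : ℝ → ℝ) (h : 0 ≤ μ * y) :
    stateOf μ W y = π / 4 + W (μ * y) := by
  rw [stateOf, oddExtension_of_nonneg _ h]

theorem eqOn_of_stateOf {μ : ℝ} (hμ : 0 < μ) {W W' : ℝ → ℝ} (hW : ContinuousOn W (Icc 0 1))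
    (hW' : ContinuousOn W' (Icc 0 1))
    (h : EqOn (stateOf μ W) (stateOf μ W') (stateInterval μ)) : EqOn W W' (Icc 0 1) := by
  have h1 : EqOn W W' (Ico 0 1) := by
    intro x hx
    have e : μ * (x / μ) = x := mul_div_cancel₀ _ hμ.ne'
    have h2 := h ((mem_stateInterval_iff hμ (y := x / μ)).2 (by
      rw [e, abs_of_nonneg hx.1]; exact hx.2))
    rw [stateOf_of_nonneg _ (e.symm ▸ hx.1), stateOf_of_nonneg _ (e.symm ▸ hx.1), e] at h2
    linarith
  exact h1.of_subset_closure hW hW' Ico_subset_Icc_self (by rw [closure_Ico zero_ne_one])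

theorem isState_const {μ : ℝ} (hμ : 0 < μ) : IsState μ (fun _ => π / 4) := by
  have h : IsHalfState (1 / μ ^ 2) (fun _ => 0) :=
    ⟨(Solves.const 0).congr_rhs fun _ _ => by simp [sinFour_zero], rfl⟩
  convert h.isState_stateOf hμ using 1
  ext y
  simp [stateOf, oddExtension]

/-! ### Consequences for states -/

namespace IsState

variable {μ : ℝ} {u : ℝ → ℝ}

/-- The left half of `u` is the right half of `y ↦ π/2 - u(-y)`, which is again a state. This
reflection preserves the slope at 0, so both halves have the same flux there. -/
theorem exists_halves (hμ : 0 < μ) (h : IsState μ u) : ∃ W W',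
    IsHalfState (1 / μ ^ 2) W ∧ IsHalfState (1 / μ ^ 2) W' ∧
    (∀ y ∈ stateInterval μ, 0 ≤ y → u y = π / 4 + W (μ * y)) ∧
    (∀ y ∈ stateInterval μ, y ≤ 0 → u y = π / 4 - W' (-(μ * y))) ∧
    fluxInt (fun x => 1 / μ ^ 2 * sinFour (W x)) 0
      = fluxInt (fun x => 1 / μ ^ 2 * sinFour (W' x)) 0 := by
  have h' := h.comp_neg.pi_div_two_sub
  obtain ⟨W, hW, heq⟩ := h.exists_halfState hμ
  obtain ⟨W', hW', heq'⟩ := h'.exists_halfState hμ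
  refine ⟨W, W', hW, hW', fun y hy h0 => ?_, fun y hy h0 => ?_, ?_⟩
  · have hy' := abs_lt.1 ((mem_stateInterval_iff hμ).1 hy)
    rw [heq _ ⟨by positivity, hy'.2⟩, mul_div_cancel_left₀ _ hμ.ne']
    ring
  · have hy' := abs_lt.1 ((mem_stateInterval_iff hμ).1 hy)
    rw [heq' _ ⟨by nlinarith, by linarith⟩, neg_div, mul_div_cancel_left₀ _ hμ.ne', neg_neg]
    ring
  · have h1 := h.deriv_zero hμ hW heq
    have h2 := h'.deriv_zero hμ hW' heq'
    rw [deriv_const_sub, deriv_comp_neg, neg_zero, neg_neg, h1] at h2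
    exact mul_left_cancel₀ hμ.ne' h2

/-- Every value of a state is, up to reflection, a value of a half state. -/
theorem exists_abs_eq (hμ : 0 < μ) (h : IsState μ u) {y : ℝ} (hy : y ∈ stateInterval μ) :
    ∃ W, IsHalfState (1 / μ ^ 2) W ∧ ∃ x ∈ Icc (0 : ℝ) 1, |u y - π / 4| = |W x| := by
  obtain ⟨W, W', hW, hW', h1, h2, -⟩ := h.exists_halves hμ
  have hy' := abs_lt.1 ((mem_stateInterval_iff hμ).1 hy)
  rcases le_total 0 y with h0 | h0
  · exact ⟨W, hW, μ * y, ⟨by positivity, hy'.2.le⟩, by rw [h1 y hy h0, add_sub_cancel_left]⟩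
  · refine ⟨W', hW', -(μ * y), ⟨by nlinarith, by linarith⟩, ?_⟩
    rw [h2 y hy h0, sub_sub_cancel_left, abs_neg]

/-- States near the bifurcation are odd about `π/4`. -/
theorem exists_eqOn_stateOf (hμ : 0 < μ) (h : IsState μ u)
    (hsign : ∀ W, IsHalfState (1 / μ ^ 2) W → 0 < W 1 → ∀ x ∈ Ioc (0 : ℝ) 1, 0 < W x) :
    ∃ W, IsHalfState (1 / μ ^ 2) W ∧ EqOn u (stateOf μ W) (stateInterval μ) := by
  obtain ⟨W, W', hW, hW', h1, h2, hfl⟩ := h.exists_halves hμ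
  -- The common flux at 0 forces the two halves to coincide.
  have heq := hW.eqOn_of_flux (by positivity) hsign hW' (by rw [hfl]) (by rw [hfl])
  refine ⟨W, hW, fun y hy => ?_⟩
  have hy' := abs_lt.1 ((mem_stateInterval_iff hμ).1 hy)
  rcases le_or_gt 0 y with h0 | h0
  · rw [h1 y hy h0, stateOf_of_nonneg _ (by positivity)]
  · have h3 : μ * y < 0 := mul_neg_of_pos_of_neg hμ h0
    rw [h2 y hy h0.le, stateOf, oddExtension, if_neg h3.not_ge,
      heq ⟨by linarith, by linarith⟩]
    ring

theorem lt_of_isNonconstant {ν : ℝ} {V : ℝ → ℝ} (hV : IsPrincipal ν V) (hμ : 0 < μ)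
    (h : IsState μ u) (hn : IsNonconstant μ u) : ν < 1 / μ ^ 2 := by
  obtain ⟨y, hy, hne⟩ := hn
  obtain ⟨W, hW, x, hx, heq⟩ := h.exists_abs_eq hμ hy
  by_contra hcon
  rw [hW.eq_zero_of_le (by positivity) hV (not_lt.1 hcon) hx, abs_zero, abs_eq_zero] at heq
  exact hne (sub_eq_zero.1 heq)

end IsState

/-- For `1/μ² ≤ 2ν` the amplitude bound applies, and `1/μ² - ν` is comparable to `μ₀ - μ`. For
larger `1/μ²`, `μ₀ - μ` is bounded below and the universal bound `|W(1)| < π/4` suffices. The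
constant is the sum of those of the two cases. -/
theorem IsPrincipal.exists_state_bound {ν : ℝ} {V : ℝ → ℝ} (hV : IsPrincipal ν V) :
    ∃ C, 0 < C ∧ ∀ μ ∈ Ioo 0 (1 / √ν), ∀ u, IsState μ u →
      ∀ y ∈ stateInterval μ, |u y - π / 4| ≤ C * √(1 / √ν - μ) := by
  have hν := hV.pos
  obtain ⟨A, hA, hamp⟩ := hV.exists_amplitude_bound
  set s := √ν with hs_def
  have hs : 0 < s := Real.sqrt_pos.2 hν
  have hss : s ^ 2 = ν := Real.sq_sqrt hν.le
  refine ⟨√(6 * A * s ^ 3) + √(4 * s), by positivity, fun μ hμ u h y hy => ?_⟩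
  obtain ⟨hμ0, hμ1⟩ := hμ
  obtain ⟨W, hW, x, hx, heq⟩ := h.exists_abs_eq hμ0 hy
  have hk : ν < 1 / μ ^ 2 := (one_div_sq_lt_iff hν hμ0).2 hμ1
  have hk0 : 0 < 1 / μ ^ 2 := hν.trans hk
  rw [heq]
  refine (hW.abs_le hk0 hx).trans ?_
  have ht : 0 < 1 / s - μ := sub_pos.2 hμ1
  have hsμ : s * μ < 1 := by rwa [lt_div_iff₀ hs, mul_comm] at hμ1
  have hst : 1 - s * μ = s * (1 / s - μ) := by field_simp
  rw [add_mul, ← Real.sqrt_mul (by positivity), ← Real.sqrt_mul (by positivity)]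
  rcases le_or_gt (1 / μ ^ 2) (2 * ν) with h2 | h2
  · have h3 := hamp _ ⟨hk, h2⟩ W hW
    have h4 : |W 1| ≤ √(6 * A * s ^ 3 * (1 / s - μ)) := by
      refine Real.abs_le_sqrt (h3.trans ?_)
      have h5 : 1 / μ ^ 2 - ν ≤ 6 * s ^ 3 * (1 / s - μ) := by
        have e : 1 / μ ^ 2 - ν = (1 / μ ^ 2) * ((1 - s * μ) * (1 + s * μ)) := by
          rw [← hss]; field_simp; ring
        have e' : 6 * s ^ 3 * (1 / s - μ) = 6 * s ^ 2 * (1 - s * μ) := by rw [hst]; ring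
        rw [e, e', ← hss] at *
        have h6 : 0 < 1 - s * μ := by linarith
        have h7 : 0 < s * μ := by positivity
        nlinarith [mul_le_mul_of_nonneg_right h2 (mul_nonneg h6.le (by linarith : 0 ≤ 1 + s * μ)),
          mul_pos (pow_pos hs 2) (mul_pos h6 h6), mul_pos (pow_pos hs 2) h6]
      calc A * (1 / μ ^ 2 - ν) ≤ A * (6 * s ^ 3 * (1 / s - μ)) := by gcongr
        _ = _ := by ring
    exact h4.trans (le_add_of_nonneg_right (Real.sqrt_nonneg _))
  · have h3 := hW.abs_one_lt hk0
    have h4 : |W 1| ≤ 1 := by linarith [pi_lt_four]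
    have h5 : 1 ≤ √(4 * s * (1 / s - μ)) := by
      rw [Real.one_le_sqrt, mul_assoc, ← hst]
      rw [← hss, lt_div_iff₀ (by positivity)] at h2
      nlinarith [mul_pos hs hμ0]
    exact (h4.trans h5).trans (le_add_of_nonneg_left (Real.sqrt_nonneg _))

theorem exists_one_div_sq_lt {ν r : ℝ} (hν : 0 < ν) (hr : 0 < r) : ∃ ρ, 0 < ρ ∧ ρ ≤ 1 / √ν ∧
    ∀ μ, |μ - 1 / √ν| < ρ → 1 / μ ^ 2 < ν + r := by
  have hs := Real.sqrt_pos.2 hν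
  have hc : ContinuousAt (fun μ : ℝ => 1 / μ ^ 2) (1 / √ν) :=
    ContinuousAt.div (by fun_prop) (by fun_prop) (by positivity)
  have h1 : 1 / (1 / √ν) ^ 2 < ν + r := by
    rw [div_pow, one_pow, Real.sq_sqrt hν.le, one_div_one_div]
    linarith
  obtain ⟨ρ, hρ, h2⟩ := Metric.eventually_nhds_iff.1 (hc.eventually (gt_mem_nhds h1))
  refine ⟨min ρ (1 / √ν), by positivity, min_le_right _ _, fun μ hμ => h2 ?_⟩
  rw [Real.dist_eq]
  exact hμ.trans_le (min_le_left _ _)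

theorem IsPrincipal.exists_two_states {ν : ℝ} {V : ℝ → ℝ} (hV : IsPrincipal ν V) :
    ∃ r, 0 < r ∧ r ≤ 1 / √ν ∧ ∀ μ ∈ Ioo (1 / √ν - r) (1 / √ν), ∃ u : ℝ → ℝ,
      IsState μ u ∧ 0 < deriv u 0 ∧ IsState μ (fun y => π / 2 - u y) ∧
      ∀ ũ : ℝ → ℝ, IsState μ ũ → IsNonconstant μ ũ →
        EqOn ũ u (stateInterval μ) ∨ EqOn ũ (fun y => π / 2 - u y) (stateInterval μ) := by
  have hν := hV.pos
  obtain ⟨r, hr, -, hsign, -⟩ := hV.exists_region one_pos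
  obtain ⟨ρ, hρ, hρ', hlt⟩ := exists_one_div_sq_lt hν hr
  refine ⟨ρ, hρ, hρ', fun μ hμ => ?_⟩
  have hμ0 : 0 < μ := by linarith [hμ.1]
  have hk : 1 / μ ^ 2 ∈ Ioo ν (ν + r) := ⟨(one_div_sq_lt_iff hν hμ0).2 hμ.2,
    hlt μ (abs_lt.2 ⟨by linarith [hμ.1], by linarith [hμ.2]⟩)⟩
  have hk0 : 0 < 1 / μ ^ 2 := hν.trans hk.1
  have hs := hsign _ hk
  obtain ⟨W, hW, hpos⟩ := hV.exists_halfState hk.1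
  have hst := hW.isState_stateOf hμ0
  refine ⟨stateOf μ W, hst, ?_, hst.pi_div_two_sub, fun u hu hn => ?_⟩
  · rw [hW.deriv_stateOf_zero hμ0]
    exact mul_pos hμ0 (hW.fluxInt_zero_pos hk0 hpos)
  · obtain ⟨W', hW', heq⟩ := hu.exists_eqOn_stateOf hμ0 hs
    rcases lt_trichotomy (W' 1) 0 with h1 | h1 | h1
    · right
      have hn' := hs _ hW'.neg (neg_pos.2 h1)
      have h2 := stateOf_congr hμ0 (hW'.neg.eqOn_of_pos hk0 hW hn' hpos)
      intro y hy
      have h3 := h2 hy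
      rw [stateOf_neg] at h3
      simp only [heq hy, ← h3]
      ring
    · exfalso
      obtain ⟨y, hy, hne⟩ := hn
      refine hne ?_
      have h2 : EqOn W' (fun _ => 0) (Icc 0 1) := fun x hx => hW'.eq_zero h1 hx
      rw [heq hy, stateOf_congr hμ0 h2 hy]
      simp [stateOf, oddExtension]
    · left
      exact heq.trans (stateOf_congr hμ0 (hW'.eqOn_of_pos hk0 hW (hs _ hW' h1) hpos))

/-! ### The branch and the final assembly -/

/-- A branch `a ↦ (K a, B a)` of half states, parametrized by the amplitude along `v`, that holds
all nonzero half states with parameter in `(ν, ν + r)`. -/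
structure IsHalfBranch (ν : ℝ) (v : ℝ → ℝ) (a₀ C r : ℝ) (K : ℝ → ℝ) (B : ℝ → ℝ → ℝ) : Prop where
  half : ∀ a, |a| < a₀ → IsHalfState (K a) (B a)
  le : ∀ a, |a| < a₀ → ν ≤ K a
  amplitude_eq : ∀ a, |a| < a₀ → amplitude v (B a) = a
  expansion : ∀ a, |a| < a₀ → |1 / K a - 1 / ν - -(8 / 3) * (1 / ν) *
    (fluxInt (fun x => v x ^ 4) 0 / fluxInt (fun x => v x ^ 2) 0) * a ^ 2| ≤ C * a ^ 4
  remainder : ∀ a, |a| < a₀ → ∀ x ∈ Icc (0 : ℝ) 1, |B a x - a * v x| ≤ C * |a| ^ 3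
  lipschitz : ∀ a b, |a| < a₀ → |b| < a₀ → |K a - K b| ≤ C * |a - b| ∧
    ∀ x ∈ Icc (0 : ℝ) 1, |B a x - B b x| ≤ C * |a - b|
  even : ∀ a, |a| < a₀ → K (-a) = K a
  odd : ∀ a, |a| < a₀ → EqOn (B (-a)) (fun x => -B a x) (Icc 0 1)
  zero : K 0 = ν
  lt : ∀ a, |a| < a₀ → a ≠ 0 → ν < K a
  flux_ne_zero : ∀ a, |a| < a₀ → a ≠ 0 → fluxInt (fun x => K a * sinFour (B a x)) 0 ≠ 0
  complete : ∀ k ∈ Ioo ν (ν + r), ∀ W, IsHalfState k W → W 1 ≠ 0 → amplitude v W ≠ 0 ∧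
    |amplitude v W| < a₀ ∧ K (amplitude v W) = k ∧ EqOn W (B (amplitude v W)) (Icc 0 1)
  sign : ∀ k ∈ Ioo ν (ν + r), ∀ W, IsHalfState k W → 0 < W 1 → ∀ x ∈ Ioc (0 : ℝ) 1, 0 < W x

theorem amplitude_eq_zero {v W : ℝ → ℝ} (h : ∀ x ∈ Icc (0 : ℝ) 1, W x = 0) :
    amplitude v W = 0 := by
  rw [amplitude, fluxInt_congr (h := fun _ => 0) zero_mem_unit fun t ht => by rw [h t ht, mul_zero]]
  simp [fluxInt]

theorem amplitude_neg (v W : ℝ → ℝ) : amplitude v (fun x => -W x) = -amplitude v W := by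
  have e : (fun x => v x * -W x) = fun x => -1 * (v x * W x) := by ext; ring
  rw [amplitude, e, fluxInt_const_mul, amplitude]
  ring

theorem IsHalfState.fluxInt_zero_ne_zero {k : ℝ} {W : ℝ → ℝ} (hk : 0 < k) (h : IsHalfState k W)
    (hsign : ∀ W, IsHalfState k W → 0 < W 1 → ∀ x ∈ Ioc (0 : ℝ) 1, 0 < W x) (h1 : W 1 ≠ 0) :
    fluxInt (fun x => k * sinFour (W x)) 0 ≠ 0 := by
  rcases h1.lt_or_gt with h1 | h1
  · have h2 := h.neg.fluxInt_zero_pos hk (hsign _ h.neg (neg_pos.2 h1))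
    have e : (fun x => k * sinFour (-W x)) = fun x => -1 * (k * sinFour (W x)) := by
      ext; rw [sinFour_neg]; ring
    rw [e, fluxInt_const_mul] at h2
    intro h3
    rw [h3] at h2
    linarith
  · exact (h.fluxInt_zero_pos hk (hsign _ h h1)).ne'

theorem IsMode.exists_halfBranch {ν : ℝ} {V v : ℝ → ℝ} (hv : IsMode ν v) (hV : IsPrincipal ν V) :
    ∃ a₀ C r K B, 0 < a₀ ∧ 0 < C ∧ 0 < r ∧ IsHalfBranch ν v a₀ C r K B := by
  have hν := hv.pos
  obtain ⟨ε₁, C₁, hε₁, -, hC₁, hinj⟩ := hv.exists_le_amplitude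
  obtain ⟨ε₂, C₂, hε₂, -, hC₂, hnf⟩ := hv.exists_normal_form
  obtain ⟨ε₃, C₃, hε₃, -, hC₃, hlip⟩ := hv.exists_lipschitz
  obtain ⟨A, hA, hamp⟩ := hv.abs_amplitude_le
  set ε := min ε₁ (min ε₂ ε₃) with hε_def
  have hε : 0 < ε := by positivity
  have le₁ : ε ≤ ε₁ := min_le_left _ _
  have le₂ : ε ≤ ε₂ := (min_le_right _ _).trans (min_le_left _ _)
  have le₃ : ε ≤ ε₃ := (min_le_right _ _).trans (min_le_right _ _)
  obtain ⟨r, hr, -, hsign, -⟩ := hV.exists_region hε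
  obtain ⟨a₀, ha₀, hex⟩ := hv.exists_of_amplitude hV hε hr
  -- Half states with parameter within `r'` are so small that their amplitude is at most `a₀/2`,
  -- hence in the range of the branch.
  obtain ⟨r', hr', -, -, hsmall⟩ := hV.exists_region (lt_min hε (show 0 < a₀ / (2 * A) by positivity))
  choose! K B hKB hKr hKa using hex
  have hne : ∀ a, |a| < a₀ → a ≠ 0 → B a 1 ≠ 0 := fun a ha h0 h1 => h0 <| by
    rw [← hKa a ha]
    exact amplitude_eq_zero fun x hx => (hKB a ha).half.eq_zero h1 hx
  have hlt : ∀ a, |a| < a₀ → a ≠ 0 → ν < K a := fun a ha h0 => by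
    by_contra hcon
    exact hne a ha h0 ((hKB a ha).half.eq_zero_of_le (hν.trans_le (hKB a ha).le) hV
      (not_lt.1 hcon) one_mem_unit)
  -- The Lipschitz estimate at equal amplitudes is a uniqueness statement. Evenness of `K`, oddness
  -- of `B` and completeness of the branch all come from it, although `K` and `B` are arbitrary
  -- choices.
  have hsame : ∀ a, |a| < a₀ → ∀ k W, IsSmall ν ε k W → amplitude v W = a →
      K a = k ∧ EqOn (B a) W (Icc 0 1) := fun a ha k W h h1 => by
    obtain ⟨h2, h3⟩ := hlip _ _ _ _ ((hKB a ha).mono le₃) (h.mono le₃)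
    rw [hKa a ha, h1, sub_self, abs_zero, mul_zero] at h2 h3
    exact ⟨sub_eq_zero.1 (abs_nonpos_iff.1 h2), fun x hx => sub_eq_zero.1 (abs_nonpos_iff.1 (h3 x hx))⟩
  have hneg : ∀ a, |a| < a₀ → K (-a) = K a ∧ EqOn (B (-a)) (fun x => -B a x) (Icc 0 1) :=
    fun a ha => hsame (-a) (by rwa [abs_neg]) _ _ (hKB a ha).neg (by rw [amplitude_neg, hKa a ha])
  refine ⟨a₀, max C₂ C₃, min r r', K, B, ha₀, by positivity, by positivity,
    { half := fun a ha => (hKB a ha).half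
      le := fun a ha => (hKB a ha).le
      amplitude_eq := hKa
      expansion := fun a ha => ?_
      remainder := fun a ha x hx => ?_
      lipschitz := fun a b ha hb => ?_
      even := fun a ha => (hneg a ha).1
      odd := fun a ha => (hneg a ha).2
      zero := ?_
      lt := hlt
      flux_ne_zero := fun a ha h0 => ?_
      complete := fun k hk W h h1 => ?_
      sign := fun k hk => hsign k ⟨hk.1, hk.2.trans_le (by gcongr; exact min_le_left _ _)⟩ }⟩
  · have h1 := (hnf _ _ ((hKB a ha).mono le₂)).1
    rw [hKa a ha] at h1
    exact h1.trans (mul_le_mul_of_nonneg_right (le_max_left _ _) (by positivity))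
  · have h1 := (hnf _ _ ((hKB a ha).mono le₂)).2 x hx
    rw [hKa a ha] at h1
    exact h1.trans (mul_le_mul_of_nonneg_right (le_max_left _ _) (by positivity))
  · obtain ⟨h1, h2⟩ := hlip _ _ _ _ ((hKB a ha).mono le₃) ((hKB b hb).mono le₃)
    rw [hKa a ha, hKa b hb] at h1 h2
    have h3 : C₃ * |a - b| ≤ max C₂ C₃ * |a - b| := by gcongr; exact le_max_right _ _
    exact ⟨h1.trans h3, fun x hx => (h2 x hx).trans h3⟩
  · have h0 : |(0 : ℝ)| < a₀ := by rwa [abs_zero]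
    have h1 := hinj _ _ ((hKB 0 h0).mono le₁)
    rw [hKa 0 h0, abs_zero, mul_zero, abs_nonpos_iff] at h1
    have h2 := (hKB 0 h0).param
    rw [h1] at h2
    linarith [(hKB 0 h0).le]
  · exact (hKB a ha).half.fluxInt_zero_ne_zero (hν.trans (hlt a ha h0))
      (hsign _ ⟨hlt a ha h0, hKr a ha⟩) (hne a ha h0)
  · have hs := hsmall k ⟨hk.1, hk.2.trans_le (by gcongr; exact min_le_right _ _)⟩ W h h1
    have hsε := hs.mono (min_le_left _ _)
    have ha : |amplitude v W| < a₀ := by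
      have h2 := hamp W (a₀ / (2 * A)) h.solves.cont fun x hx =>
        (hs.abs_le hν hx).trans (hs.small.trans (min_le_right _ _))
      refine h2.trans_lt ?_
      rw [show A * (a₀ / (2 * A)) = a₀ / 2 by field_simp]
      linarith
    obtain ⟨h3, h4⟩ := hsame _ ha k W hsε rfl
    refine ⟨fun h0 => h1 ?_, ha, h3, h4.symm⟩
    have h5 := hinj k W (hsε.mono le₁)
    rwa [h0, abs_zero, mul_zero, abs_nonpos_iff] at h5

namespace IsHalfBranch

variable {ν a₀ C r : ℝ} {v v₀ : ℝ → ℝ} {K : ℝ → ℝ} {B : ℝ → ℝ → ℝ}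

theorem parameter_pos (h : IsHalfBranch ν v a₀ C r K B) (hν : 0 < ν) {a : ℝ} (ha : |a| < a₀) :
    0 < K a := hν.trans_le (h.le a ha)

theorem one_div_sq_sqrt (h : IsHalfBranch ν v a₀ C r K B) (hν : 0 < ν) {a : ℝ} (ha : |a| < a₀) :
    1 / √(1 / K a) ^ 2 = K a := by
  rw [Real.sq_sqrt (one_div_nonneg.2 (h.parameter_pos hν ha).le), one_div_one_div]

/-- The states with halves `B a` form a branch. -/
theorem isBranch (h : IsHalfBranch ν v a₀ C r K B) (hv : IsMode ν v) (hC : 0 < C)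
    (heq : ∀ x ∈ Ico (0 : ℝ) 1, v x = v₀ x) :
    IsBranch (1 / √ν) v₀ a₀ (fun a => 1 / K a - 1 / ν) (fun a x => B a x - a * v x)
      (fun a => stateOf √(1 / K a) (B a)) := by
  have hν := hv.pos
  have hμ₀ : (1 / √ν) ^ 2 = 1 / ν := by rw [div_pow, Real.sq_sqrt hν.le, one_pow]
  have hm : ∀ {a}, a ∈ Ioo (-a₀) a₀ → |a| < a₀ := fun ha => abs_lt.2 ha
  have hK : ∀ {a}, a ∈ Ioo (-a₀) a₀ → 0 < K a := fun ha => h.parameter_pos hν (hm ha)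
  have hs : ∀ {a}, a ∈ Ioo (-a₀) a₀ → 0 < √(1 / K a) := fun ha =>
    Real.sqrt_pos.2 (one_div_pos.2 (hK ha))
  have hh : ∀ {a}, a ∈ Ioo (-a₀) a₀ → IsHalfState (1 / √(1 / K a) ^ 2) (B a) := fun ha => by
    rw [h.one_div_sq_sqrt hν (hm ha)]
    exact h.half _ (hm ha)
  have hKc : ContinuousOn K (Ioo (-a₀) a₀) := by
    refine LipschitzOnWith.continuousOn (K := C.toNNReal)
      (LipschitzOnWith.of_dist_le_mul fun a ha b hb => ?_)
    rw [Real.coe_toNNReal _ hC.le, Real.dist_eq, Real.dist_eq]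
    exact (h.lipschitz a b (hm ha) (hm hb)).1
  have hμ : ∀ a, (1 / √ν) ^ 2 + (1 / K a - 1 / ν) = 1 / K a := fun a => by rw [hμ₀]; ring
  refine ⟨?_, fun a ha => ?_, ?_, fun a ha => ?_, fun a ha x hx => ?_, fun a ha => ?_,
    fun a ha => ?_, fun a ha => ?_, fun a ha y hy => ?_, fun a ha h0 => ?_⟩
  · simp only [h.zero, sub_self]
  · simp only [h.even a (hm ha)]
  · exact (continuousOn_const.div hKc fun a ha => (hK ha).ne').sub continuousOn_const
  · rw [hμ]
    exact one_div_pos.2 (hK ha)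
  · simp only [h.odd a (hm ha) (Ico_subset_Icc_self hx)]
    ring
  · obtain ⟨M, hM, hvM⟩ := hv.exists_bound
    rw [Metric.tendstoUniformlyOn_iff]
    intro η hη
    have hηM : 0 < η / (C + M) := by positivity
    filter_upwards [inter_mem_nhdsWithin _ (Metric.ball_mem_nhds a hηM), self_mem_nhdsWithin]
      with b hb hb' x hx
    have h1 : |a - b| < η / (C + M) := by
      rw [abs_sub_comm, ← Real.dist_eq]
      exact hb.2
    rw [lt_div_iff₀ (by positivity)] at h1
    have h2 := (h.lipschitz a b (hm ha) (hm hb')).2 x (Ico_subset_Icc_self hx)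
    have h3 := hvM x (Ico_subset_Icc_self hx)
    rw [Real.dist_eq, show B a x - a * v x - (B b x - b * v x)
      = B a x - B b x - (a - b) * v x by ring]
    calc _ ≤ |B a x - B b x| + |(a - b) * v x| := abs_sub _ _
      _ ≤ C * |a - b| + |a - b| * M := by rw [abs_mul]; gcongr
      _ < η := by linarith
  · refine Eq.trans ?_
      (hv.fluxInt_orthogonal (h.half a (hm ha)).solves.cont (h.amplitude_eq a (hm ha)).symm)
    refine intervalIntegral.integral_congr_Ioo_of_le zero_le_one fun x hx => ?_
    simp only [heq x (Ioo_subset_Ico_self hx)]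
    ring
  · rw [hμ]
    exact (hh ha).isState_stateOf (hs ha)
  · rw [hμ] at hy ⊢
    have h1 : 0 ≤ √(1 / K a) * y := mul_nonneg (hs ha).le hy.1
    have h2 : √(1 / K a) * y < 1 := by
      have := hy.2
      rwa [lt_div_iff₀ (hs ha), mul_comm] at this
    rw [stateOf_of_nonneg _ h1, heq _ ⟨h1, h2⟩]
    ring
  · rw [(hh ha).deriv_stateOf_zero (hs ha), h.one_div_sq_sqrt hν (hm ha)]
    exact mul_ne_zero (hs ha).ne' (h.flux_ne_zero a (hm ha) h0)

/-- The branch of states exhausts the nonconstant states near the bifurcation. -/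
theorem existsUnique (h : IsHalfBranch ν v a₀ C r K B) (hν : 0 < ν) {V : ℝ → ℝ}
    (hV : IsPrincipal ν V) {μ : ℝ} (hμ : 0 < μ) (hr : 1 / μ ^ 2 < ν + r) {u : ℝ → ℝ}
    (hu : IsState μ u) (hn : IsNonconstant μ u) :
    ∃! a : ℝ, a ∈ Ioo (-a₀) a₀ ∧ a ≠ 0 ∧ μ ^ 2 = (1 / √ν) ^ 2 + (1 / K a - 1 / ν) ∧
      EqOn u (stateOf √(1 / K a) (B a)) (stateInterval μ) := by
  have hμ₀ : (1 / √ν) ^ 2 = 1 / ν := by rw [div_pow, Real.sq_sqrt hν.le, one_pow]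
  have hk : 1 / μ ^ 2 ∈ Ioo ν (ν + r) := ⟨hu.lt_of_isNonconstant hV hμ hn, hr⟩
  obtain ⟨W, hW, heq⟩ := hu.exists_eqOn_stateOf hμ (h.sign _ hk)
  have h1 : W 1 ≠ 0 := fun h1 => by
    obtain ⟨y, hy, hne⟩ := hn
    have h2 : EqOn W (fun _ => 0) (Icc 0 1) := fun x hx => hW.eq_zero h1 hx
    refine hne ?_
    rw [heq hy, stateOf_congr hμ h2 hy]
    simp [stateOf, oddExtension]
  obtain ⟨h0, hlt, hKW, hWB⟩ := h.complete _ hk W hW h1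
  refine ⟨amplitude v W, ⟨abs_lt.1 hlt, h0, ?_, ?_⟩, fun b ⟨hb, hb0, hbμ, hbu⟩ => ?_⟩
  · rw [hKW, hμ₀]
    field_simp
    ring
  · rw [hKW, one_div_one_div, Real.sqrt_sq hμ.le]
    exact heq.trans (stateOf_congr hμ hWB)
  -- The parameter is recovered as `√(1 / K b) = μ`, so `B b` and `W` are halves of the same state;
  -- hence `b`, the amplitude of `B b`, is that of `W`.
  · have hb' := abs_lt.2 hb
    have e : √(1 / K b) = μ := by
      rw [show 1 / K b = μ ^ 2 by rw [hbμ, hμ₀]; ring, Real.sqrt_sq hμ.le]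
    rw [e] at hbu
    have h2 := eqOn_of_stateOf hμ (h.half b hb').solves.cont hW.solves.cont (hbu.symm.trans heq)
    rw [← h.amplitude_eq b hb', amplitude, amplitude,
      fluxInt_congr zero_mem_unit fun t ht => by rw [h2 ht]]

end IsHalfBranch

theorem deltaTwo_eq {ν : ℝ} {v v₀ : ℝ → ℝ} (hν : 0 < ν) (heq : ∀ x ∈ Ico (0 : ℝ) 1, v x = v₀ x) :
    deltaTwo (1 / √ν) v₀ = -(8 / 3) * (1 / ν) *
      (fluxInt (fun x => v x ^ 4) 0 / fluxInt (fun x => v x ^ 2) 0) := by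
  have key : ∀ n : ℕ, ∫ x in (0 : ℝ)..1, (1 - x ^ 2) ^ 2 * v₀ x ^ n
      = fluxInt (fun x => v x ^ n) 0 := fun n =>
    intervalIntegral.integral_congr_Ioo_of_le zero_le_one fun x hx => by
      simp only [heq x (Ioo_subset_Ico_self hx)]
  rw [deltaTwo, key, key, div_pow, Real.sq_sqrt hν.le, one_pow]

theorem lemma4p3 :
    ∃ ν₀ μ₀ : ℝ, 0 < ν₀ ∧ IsLeast eigenvalueSet ν₀ ∧ μ₀ = 1 / √ν₀ ∧
      -- `π/4` is a state for every `μ > 0`, and the only one if `μ ≥ μ₀`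
      (∀ μ : ℝ, 0 < μ → IsState μ (fun _ => π / 4)) ∧
      (∀ μ : ℝ, 0 < μ → ∀ u : ℝ → ℝ, IsState μ u → IsNonconstant μ u → μ < μ₀) ∧
      -- the amplitude bound, with a constant that does not depend on `μ`
      (∃ C : ℝ, 0 < C ∧ ∀ μ ∈ Ioo 0 μ₀, ∀ u : ℝ → ℝ, IsState μ u → IsNonconstant μ u →
        ∀ y ∈ stateInterval μ, |u y - π / 4| ≤ C * √(μ₀ - μ)) ∧
      -- just below `μ₀` there are exactly two nonconstant states, exchanged by `u ↦ π/2 - u`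
      (∃ r : ℝ, 0 < r ∧ r ≤ μ₀ ∧ ∀ μ ∈ Ioo (μ₀ - r) μ₀, ∃ u : ℝ → ℝ,
        IsState μ u ∧ 0 < deriv u 0 ∧ IsState μ (fun y => π / 2 - u y) ∧
        ∀ ũ : ℝ → ℝ, IsState μ ũ → IsNonconstant μ ũ →
          EqOn ũ u (stateInterval μ) ∨ EqOn ũ (fun y => π / 2 - u y) (stateInterval μ)) ∧
      -- the normal form of the pitchfork
      (∀ v₀ : ℝ → ℝ, IsEigenfunction ν₀ v₀ →
        deltaTwo μ₀ v₀ < 0 ∧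
        ∃ (a₀ C₀ r : ℝ) (δ : ℝ → ℝ) (w U : ℝ → ℝ → ℝ),
          0 < a₀ ∧ 0 < C₀ ∧ 0 < r ∧ IsBranch μ₀ v₀ a₀ δ w U ∧
          (∀ a ∈ Ioo (-a₀) a₀, |δ a - deltaTwo μ₀ v₀ * a ^ 2| ≤ C₀ * a ^ 4) ∧
          (∀ a ∈ Ioo (-a₀) a₀, ∀ x ∈ Ico (0 : ℝ) 1, |w a x| ≤ C₀ * |a| ^ 3) ∧
          (∀ a ∈ Ioo (-a₀) a₀, a ≠ 0 → δ a < 0) ∧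
          (∀ μ : ℝ, 0 < μ → |μ - μ₀| < r → ∀ u : ℝ → ℝ, IsState μ u → IsNonconstant μ u →
            ∃! a : ℝ, a ∈ Ioo (-a₀) a₀ ∧ a ≠ 0 ∧ μ ^ 2 = μ₀ ^ 2 + δ a ∧
              EqOn u (U a) (stateInterval μ))) := by
  obtain ⟨ν, V, hV⟩ := exists_isPrincipal
  have hν := hV.pos
  refine ⟨ν, 1 / √ν, hν, ⟨⟨V, hV.isEigenfunction⟩, fun κ ⟨v, hκ⟩ => ?_⟩, rfl,
    fun μ hμ => isState_const hμ, fun μ hμ u hu hn =>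
      (one_div_sq_lt_iff hν hμ).1 (hu.lt_of_isNonconstant hV hμ hn), ?_,
    hV.exists_two_states, fun v₀ hv₀ => ?_⟩
  · obtain ⟨v', -, hs, h0, h1⟩ := hκ.exists_solves
    exact hV.le_of_solves hs h0 h1
  · obtain ⟨C, hC, hb⟩ := hV.exists_state_bound
    exact ⟨C, hC, fun μ hμ u hu _ => hb μ hμ u hu⟩
  · obtain ⟨v, heq, hs, h0, h1⟩ := hv₀.exists_solves
    have hv : IsMode ν v := ⟨hν, hs, h0, h1⟩
    have hδ := deltaTwo_eq hν heq
    obtain ⟨a₀, C, r, K, B, ha₀, hC, hr, hB⟩ := hv.exists_halfBranch hV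
    obtain ⟨ρ, hρ, -, hlt⟩ := exists_one_div_sq_lt hν hr
    -- The functions `δ`, `w`, `U` are those of `IsHalfBranch.isBranch`; since `k = 1/μ²`, `δ(a)` is
    -- `1/K(a) - 1/ν`, and it is negative because `K(a) > ν`.
    refine ⟨?_, a₀, C, ρ, _, _, _, ha₀, hC, hρ, hB.isBranch hv hC heq, fun a ha => ?_,
      fun a ha x hx => hB.remainder a (abs_lt.2 ha) x (Ico_subset_Icc_self hx),
      fun a ha h0 => ?_, fun μ hμ hμρ u hu hn => hB.existsUnique hν hV hμ (hlt μ hμρ) hu hn⟩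
    · rw [hδ]
      have := div_pos (hv.fluxInt_pow_pos (n := 4) (by decide)) hv.norm_pos
      have : 0 < 1 / ν := one_div_pos.2 hν
      rw [neg_mul, neg_mul, neg_lt_zero]
      positivity
    · rw [hδ]
      exact hB.expansion a (abs_lt.2 ha)
    · exact sub_neg.2 (one_div_lt_one_div_of_lt hν (hB.lt a (abs_lt.2 ha) h0))
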